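/- Consider the integer linear optimization problem on a UTVPI system with non-negative objective function and non-negative variables: \[ \text{minimize } w^{\mathrm T}x \quad\text{subject to}\quad Ax\ge b,\; x\ge 0,\; x\in\mathbb{Z}^n, \] where $m,n$ are positive integers, $A\in\{-1,0,1\}^{m\times n}$ has at most two nonzero entries in each row, $b\in\mathbb{Z}^m$, and $w\in\mathbb{Q}^n$ with $w\ge 0$. This problem is $2$-approximable: there is an algorithm that, on every instance $(A,b,w)$, runs in time polynomial in the bit length of the instance and, if the instance is feasible, outputs a feasible integer solution $x$ such that $w^{\mathrm T}x$ is at most twice the optimal value (which is attained); if the instance is infeasible, it reports this. -/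

import Mathlib

/-! ## The machine model: a random access machine with logarithmic (bit) cost

Programs are structured programs over finitely many named integer arrays, indexed by integers,
with the arithmetic operations `+`, `-`, `*` and integer division. The cost of an operation is
the total bit length of all the integers it handles (addresses, operands and results), so that
polynomial time here is polynomial time on Turing machines. -/

namespace RAM

/-- The bit length of an integer, counting its sign. -/
def bitLength (z : ℤ) : ℕ := Nat.size z.natAbs + 1

/-- A memory: `M a i` is the content of cell `i` of the array named `a`. -/
abbrev Mem : Type := ℕ → ℤ → ℤ

/-- Expressions. `read a e` is the content of the cell of array `a` whose address is the value
of `e`. Scalar variables are cells at fixed addresses. -/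
inductive Expr : Type
  | const (c : ℤ)
  | read (a : ℕ) (addr : Expr)
  | add (e₁ e₂ : Expr)
  | sub (e₁ e₂ : Expr)
  | mul (e₁ e₂ : Expr)
  | div (e₁ e₂ : Expr)

/-- The value of an expression. Division is Euclidean; division by zero gives zero. -/
def Expr.val (M : Mem) : Expr → ℤ
  | .const c => c
  | .read a e => M a (e.val M)
  | .add e₁ e₂ => e₁.val M + e₂.val M
  | .sub e₁ e₂ => e₁.val M - e₂.val M
  | .mul e₁ e₂ => e₁.val M * e₂.val M
  | .div e₁ e₂ => e₁.val M / e₂.val M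

/-- The cost of evaluating an expression: the total bit length of the values of all its
subexpressions, itself included. -/
def Expr.cost (M : Mem) : Expr → ℕ
  | .const c => bitLength c
  | .read a e => e.cost M + bitLength ((Expr.read a e).val M)
  | .add e₁ e₂ => e₁.cost M + e₂.cost M + bitLength ((Expr.add e₁ e₂).val M)
  | .sub e₁ e₂ => e₁.cost M + e₂.cost M + bitLength ((Expr.sub e₁ e₂).val M)
  | .mul e₁ e₂ => e₁.cost M + e₂.cost M + bitLength ((Expr.mul e₁ e₂).val M)
  | .div e₁ e₂ => e₁.cost M + e₂.cost M + bitLength ((Expr.div e₁ e₂).val M)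

/-- Programs. `write a i e` stores the value of `e` in cell `i` of array `a`; `branch e p q`
runs `p` if `e` is positive and `q` otherwise; `loop e p` runs `p` as long as `e` is positive. -/
inductive Program : Type
  | skip
  | write (a : ℕ) (addr e : Expr)
  | seq (p q : Program)
  | branch (e : Expr) (p q : Program)
  | loop (e : Expr) (p : Program)

/-- The memory after storing `v` in cell `i` of array `a`. -/
def Mem.store (M : Mem) (a : ℕ) (i v : ℤ) : Mem :=
  fun a' i' => if a' = a ∧ i' = i then v else M a' i'

/-- `Exec p M t M'`: started in memory `M`, the program `p` halts in memory `M'` at total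
cost `t`. -/
inductive Exec : Program → Mem → ℕ → Mem → Prop
  | skip (M : Mem) : Exec .skip M 1 M
  | write (M : Mem) (a : ℕ) (i e : Expr) :
      Exec (.write a i e) M (i.cost M + e.cost M + 1) (M.store a (i.val M) (e.val M))
  | seq {p q : Program} {M M' M'' : Mem} {s t : ℕ} :
      Exec p M s M' → Exec q M' t M'' → Exec (.seq p q) M (s + t) M''
  | branch_pos {e : Expr} {p q : Program} {M M' : Mem} {t : ℕ} :
      0 < e.val M → Exec p M t M' → Exec (.branch e p q) M (e.cost M + 1 + t) M'
  | branch_nonpos {e : Expr} {p q : Program} {M M' : Mem} {t : ℕ} :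
      e.val M ≤ 0 → Exec q M t M' → Exec (.branch e p q) M (e.cost M + 1 + t) M'
  | loop_pos {e : Expr} {p : Program} {M M' M'' : Mem} {s t : ℕ} :
      0 < e.val M → Exec p M s M' → Exec (.loop e p) M' t M'' →
      Exec (.loop e p) M (e.cost M + 1 + s + t) M''
  | loop_nonpos {e : Expr} {p : Program} {M : Mem} :
      e.val M ≤ 0 → Exec (.loop e p) M (e.cost M + 1) M

/-- The initial memory on an input list: array `0` holds the list (from cell `0` on), cell `0`
of array `1` holds its length, and all other cells are zero. -/
def initMem (l : List ℤ) : Mem := fun a i =>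
  if a = 0 ∧ 0 ≤ i then l.getD i.toNat 0
  else if a = 1 ∧ i = 0 then (l.length : ℤ)
  else 0

/-- The output list in a final memory: it is held by array `2` (from cell `0` on), and its
length by cell `0` of array `3`. -/
def output (M : Mem) : List ℤ := (List.range (M 3 0).toNat).map fun i => M 2 (i : ℤ)

/-- The size of an input: the total bit length of its entries. -/
def inputSize (l : List ℤ) : ℕ := (l.map bitLength).sum

/-- On input `l`, the program halts within cost `T` and outputs `out`. -/
def Program.OutputsWithin (p : Program) (l out : List ℤ) (T : ℕ) : Prop :=
  ∃ (t : ℕ) (M : Mem), Exec p (initMem l) t M ∧ t ≤ T ∧ output M = out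

end RAM

/-! ## Integer linear optimization on UTVPI systems -/

/-- An instance of: minimize `wᵀx` subject to `Ax ≥ b`, `x ≥ 0`, `x ∈ ℤⁿ`, where `A` has entries
in `{-1, 0, 1}` and at most two nonzero entries per row, `b` is integral, and `w` is rational
and non-negative. -/
structure UTVPIProblem where
  m : ℕ
  n : ℕ
  m_pos : 0 < m
  n_pos : 0 < n
  A : Matrix (Fin m) (Fin n) ℤ
  b : Fin m → ℤ
  w : Fin n → ℚ
  A_mem : ∀ i j, A i j = -1 ∨ A i j = 0 ∨ A i j = 1
  A_row : ∀ i, (Finset.univ.filter fun j => A i j ≠ 0).card ≤ 2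
  w_nonneg : ∀ j, 0 ≤ w j

namespace UTVPIProblem

/-- The feasible (integer) solutions. -/
def Feasible (I : UTVPIProblem) (x : Fin I.n → ℤ) : Prop :=
  (∀ i, I.b i ≤ ∑ j, I.A i j * x j) ∧ ∀ j, 0 ≤ x j

/-- The objective value. -/
def objective (I : UTVPIProblem) (x : Fin I.n → ℤ) : ℚ := ∑ j, I.w j * (x j : ℚ)

/-- The optimal integer solutions. -/
def IsOptimal (I : UTVPIProblem) (x : Fin I.n → ℤ) : Prop :=
  I.Feasible x ∧ ∀ y, I.Feasible y → I.objective x ≤ I.objective y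

/-- The problem has an optimal solution, and `x` is a feasible solution whose objective value
is at most `ρ` times the optimal value. -/
def IsApproxSolution (I : UTVPIProblem) (ρ : ℚ) (x : Fin I.n → ℤ) : Prop :=
  I.Feasible x ∧ ∃ z, I.IsOptimal z ∧ I.objective x ≤ ρ * I.objective z

/-- The encoding of an instance as a list of integers: `m`, `n`, the entries of `A` row by row,
the entries of `b`, the numerators of the entries of `w`, and their denominators. -/
def encode (I : UTVPIProblem) : List ℤ :=
  [(I.m : ℤ), (I.n : ℤ)] ++ (List.ofFn fun i => List.ofFn (I.A i)).flatten ++ List.ofFn I.b ++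
    (List.ofFn fun j => (I.w j).num) ++ List.ofFn fun j => ((I.w j).den : ℤ)

/-- The correct answers of a `ρ`-approximation algorithm: `1` followed by the entries of a
`ρ`-approximate solution if the problem is feasible, and `0` if it is infeasible. -/
def IsApproxAnswer (I : UTVPIProblem) (ρ : ℚ) (out : List ℤ) : Prop :=
  (∃ x, I.IsApproxSolution ρ x ∧ out = 1 :: List.ofFn x) ∨
    ((¬ ∃ x, I.Feasible x) ∧ out = [0])

end UTVPIProblem

/-!
A constraint `±x i ± x j ≥ b` becomes two arcs between the nodes `±i` and `±j`, where `-j` stands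
for `-x j` and `0` for the constant zero, such that the feasible solutions are the potentials `p`
with `p (-u) = -p u`. Dropping the oddness, minimizing `∑ w j * (p j - p (-j))` over all potentials
is the dual of a minimum-cost flow problem whose divergences are the weights at `j` and their
negatives at `-j`. This is solved by scaling: the flow is doubled for each bit of the weights, and
for a bit that is one a unit is sent along a shortest path from `j` to `-j`, which exists thanks to
the arc of the constraint `x j ≥ 0`.

As the network is symmetric, `p u - p (-u)` is again a potential for doubled costs, that is, twice
an optimal half-integral solution. An odd value of it, at `s` say, is removed by lowering by one
the odd values at all nodes that are reachable from `s` along tight arcs, and raising those at their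
negatives. If `-s` is not reachable, then feasibility is preserved. If both `s` and `-s` reach each
other, then twice any integral solution has the odd value at `s`, which is impossible. As each
non-negative half-integer is rounded to a neighbouring integer, it is at most doubled.

The time bound holds as every loop runs as often as the input has bits, a number that is computed
first, and every assignment enlarges the bit length by at most a constant number of bits, or by
those of this number.
-/

namespace RAM

/-! ## A language of bounded loops -/

instance : Add Expr := ⟨Expr.add⟩
instance : Sub Expr := ⟨Expr.sub⟩
instance : Div Expr := ⟨Expr.div⟩
instance (n : ℕ) : OfNat Expr n := ⟨Expr.const n⟩

/-- The scalar variable held by cell `0` of array `a`. -/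
def var (a : ℕ) : Expr := .read a 0

/-- The bound of all loops, held by cell `0` of array `4`. -/
def sizeVar : Expr := var 4

/-- Multiplication by the loop bound. -/
def scale (e : Expr) : Expr := .mul sizeVar e

namespace Expr

variable (M : Mem)

@[simp] theorem val_add (e f : Expr) : (e + f).val M = e.val M + f.val M := rfl
@[simp] theorem val_sub (e f : Expr) : (e - f).val M = e.val M - f.val M := rfl
@[simp] theorem val_div (e f : Expr) : (e / f).val M = e.val M / f.val M := rfl
@[simp] theorem val_zero : (0 : Expr).val M = 0 := rfl
@[simp] theorem val_one : (1 : Expr).val M = 1 := rfl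
@[simp] theorem val_two : (2 : Expr).val M = 2 := rfl
@[simp] theorem val_read (a : ℕ) (e : Expr) : (read a e).val M = M a (e.val M) := rfl
@[simp] theorem val_var (a : ℕ) : (var a).val M = M a 0 := rfl
@[simp] theorem val_sizeVar : sizeVar.val M = M 4 0 := rfl
@[simp] theorem val_scale (e : Expr) : (scale e).val M = M 4 0 * e.val M := rfl

end Expr

namespace Mem

variable (M : Mem) {a b : ℕ}

theorem store_apply (a b : ℕ) (i v : ℤ) :
    M.store a i v b = if b = a then Function.update (M a) i v else M b := by
  funext j
  by_cases h : b = a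
  · subst h
    by_cases hj : j = i <;> simp [store, Function.update, hj]
  · simp [store, h]

@[simp] theorem store_self (a : ℕ) (i v : ℤ) : M.store a i v a = Function.update (M a) i v := by
  simp [store_apply]

theorem store_of_ne (h : b ≠ a) (i v : ℤ) : M.store a i v b = M b := by
  simp [store_apply, h]

/-- All cells hold integers of absolute value at most `2 ^ k`. -/
def BitBounded (k : ℕ) : Prop := ∀ a i, (M a i).natAbs ≤ 2 ^ k

variable {M} {k l : ℕ}

theorem BitBounded.mono (hM : M.BitBounded k) (hkl : k ≤ l) : M.BitBounded l :=
  fun a i => (hM a i).trans (Nat.pow_le_pow_right two_pos hkl)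

theorem BitBounded.store (hM : M.BitBounded k) {v : ℤ} (hv : v.natAbs ≤ 2 ^ k) (a : ℕ) (i : ℤ) :
    (M.store a i v).BitBounded k := by
  intro b j
  unfold Mem.store
  split
  exacts [hv, hM _ _]

end Mem

theorem bitLength_le {z : ℤ} {k : ℕ} (h : z.natAbs ≤ 2 ^ k) : bitLength z ≤ k + 2 := by
  have : Nat.size z.natAbs ≤ k + 1 :=
    Nat.size_le.2 (h.trans_lt (Nat.pow_lt_pow_right one_lt_two k.lt_succ_self))
  unfold bitLength
  omega

namespace Expr

/-- Expressions whose only products are products with the loop bound. Evaluating one adds only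
polynomially many bits in the loop bound, however often it is repeated. -/
def Tame : Expr → Prop
  | .const _ => True
  | .read _ e => e.Tame
  | .add e f => e.Tame ∧ f.Tame
  | .sub e f => e.Tame ∧ f.Tame
  | .mul e f => e = sizeVar ∧ f.Tame
  | .div e f => e.Tame ∧ f.Tame

/-- The size of an expression, with its constants counted by absolute value. -/
def weight : Expr → ℕ
  | .const c => c.natAbs + 1
  | .read _ e => e.weight + 1
  | .add e f => e.weight + f.weight + 1
  | .sub e f => e.weight + f.weight + 1
  | .mul e f => e.weight + f.weight + 1
  | .div e f => e.weight + f.weight + 1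

theorem two_pow_add_two_pow_le {a b c : ℕ} (ha : a < c) (hb : b < c) : 2 ^ a + 2 ^ b ≤ 2 ^ c := by
  obtain ⟨c, rfl⟩ := Nat.exists_eq_succ_of_ne_zero (Nat.ne_zero_of_lt ha)
  rw [pow_succ, mul_two]
  exact add_le_add (Nat.pow_le_pow_right two_pos (by omega))
    (Nat.pow_le_pow_right two_pos (by omega))

variable {M : Mem} {S k : ℕ}

theorem natAbs_val_le (hS : M 4 0 = S) (hM : M.BitBounded k) {e : Expr} (he : e.Tame) :
    (e.val M).natAbs ≤ 2 ^ (k + e.weight * (S + 1)) := by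
  have sum_le : ∀ {x y : ℤ} {p q : ℕ}, x.natAbs ≤ 2 ^ (k + p * (S + 1)) →
      y.natAbs ≤ 2 ^ (k + q * (S + 1)) →
      x.natAbs + y.natAbs ≤ 2 ^ (k + (p + q + 1) * (S + 1)) := fun hx hy =>
    (add_le_add hx hy).trans (two_pow_add_two_pow_le (by nlinarith) (by nlinarith))
  induction e with
  | const c =>
    calc c.natAbs ≤ 2 ^ c.natAbs := Nat.lt_two_pow_self.le
      _ ≤ _ := Nat.pow_le_pow_right two_pos (by
        simp only [weight]
        nlinarith [Nat.zero_le (c.natAbs * S)])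
  | read a e =>
    exact (hM _ _).trans (Nat.pow_le_pow_right two_pos (Nat.le_add_right _ _))
  | add e f ihe ihf => exact (Int.natAbs_add_le _ _).trans (sum_le (ihe he.1) (ihf he.2))
  | sub e f ihe ihf => exact (Int.natAbs_sub_le _ _).trans (sum_le (ihe he.1) (ihf he.2))
  | mul e f ihe ihf =>
    obtain ⟨rfl, hf⟩ := he
    calc (M 4 0 * f.val M).natAbs = S * (f.val M).natAbs := by
          rw [hS, Int.natAbs_mul, Int.natAbs_natCast]
      _ ≤ 2 ^ S * 2 ^ (k + f.weight * (S + 1)) :=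
          Nat.mul_le_mul Nat.lt_two_pow_self.le (ihf hf)
      _ = 2 ^ (S + (k + f.weight * (S + 1))) := (pow_add _ _ _).symm
      _ ≤ _ := Nat.pow_le_pow_right two_pos (by simp only [weight]; nlinarith)
  | div e f ihe ihf =>
    exact (Int.natAbs_ediv_le_natAbs _ _).trans
      ((Nat.le_add_right _ _).trans (sum_le (ihe he.1) (ihf he.2)))

theorem cost_le (hS : M 4 0 = S) (hM : M.BitBounded k) {e : Expr} (he : e.Tame) :
    e.cost M ≤ e.weight * (k + e.weight * (S + 1) + 2) := by
  have bitLength_val_le {e : Expr} (he : e.Tame) : bitLength (e.val M) ≤ _ :=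
    bitLength_le (natAbs_val_le hS hM he)
  have sum_le : ∀ {p q x y c : ℕ}, x ≤ p * (k + p * (S + 1) + 2) →
      y ≤ q * (k + q * (S + 1) + 2) → c ≤ k + (p + q + 1) * (S + 1) + 2 →
      x + y + c ≤ (p + q + 1) * (k + (p + q + 1) * (S + 1) + 2) := by
    intro p q x y c hx hy hc
    have hp : p * (k + p * (S + 1) + 2) ≤ p * (k + (p + q + 1) * (S + 1) + 2) := by
      gcongr; omega
    have hq : q * (k + q * (S + 1) + 2) ≤ q * (k + (p + q + 1) * (S + 1) + 2) := by
      gcongr; omega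
    linarith
  induction e with
  | const c => exact (bitLength_val_le he).trans (Nat.le_mul_of_pos_left _ (Nat.succ_pos _))
  | read a e ih => exact sum_le (q := 0) (y := 0) (ih he) (Nat.zero_le _) (bitLength_val_le he)
  | add e f ihe ihf => exact sum_le (ihe he.1) (ihf he.2) (bitLength_val_le (e := .add e f) he)
  | sub e f ihe ihf => exact sum_le (ihe he.1) (ihf he.2) (bitLength_val_le (e := .sub e f) he)
  | mul e f ihe ihf =>
    exact sum_le (ihe (he.1 ▸ trivial)) (ihf he.2) (bitLength_val_le (e := .mul e f) he)
  | div e f ihe ihf => exact sum_le (ihe he.1) (ihf he.2) (bitLength_val_le (e := .div e f) he)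

/-- A polynomial in the loop bound that bounds the cost of a tame expression per bit of the numbers
in the memory. -/
noncomputable def costBound (e : Expr) : Polynomial ℕ :=
  .C e.weight * (.C e.weight * (.X + 1) + 2)

theorem cost_le_costBound (hS : M 4 0 = S) (hM : M.BitBounded k) {e : Expr} (he : e.Tame) :
    e.cost M ≤ e.costBound.eval S * (k + 1) := by
  refine (cost_le hS hM he).trans ?_
  simp only [costBound, Polynomial.eval_add, Polynomial.eval_mul, Polynomial.eval_C,
    Polynomial.eval_X, Polynomial.eval_one, Polynomial.eval_ofNat]
  rw [mul_assoc]
  gcongr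
  nlinarith [Nat.zero_le (k * (e.weight * (S + 1)))]

end Expr

/-- Commands. `rep a c` runs `c` for the values `0, …, S - 1` of the counter `a`, where `S` is the
loop bound. -/
inductive Cmd : Type
  | skip
  | write (a : ℕ) (i e : Expr)
  | seq (c d : Cmd)
  | ite (e : Expr) (c d : Cmd)
  | rep (a : ℕ) (c : Cmd)

/-- The memory after a given number of rounds of a loop with counter `a` and body `f`. -/
def rounds (a : ℕ) (f : Mem → Mem) (M : Mem) : ℕ → Mem
  | 0 => M.store a 0 0
  | k + 1 => (f (rounds a f M k)).store a 0 ((k : ℤ) + 1)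

theorem rounds_counter (a : ℕ) (f : Mem → Mem) (M : Mem) (n : ℕ) : rounds a f M n a 0 = n := by
  cases n <;> simp [rounds]

namespace Cmd

/-- The effect on the memory of a command with loop bound `S`. -/
def run (S : ℕ) : Cmd → Mem → Mem
  | .skip, M => M
  | .write a i e, M => M.store a (i.val M) (e.val M)
  | .seq c d, M => d.run S (c.run S M)
  | .ite e c d, M => if 0 < e.val M then c.run S M else d.run S M
  | .rep a c, M => rounds a (c.run S) M S

/-- The translation of commands to programs. -/
def toProgram : Cmd → Program
  | .skip => .skip
  | .write a i e => .write a i e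
  | .seq c d => .seq c.toProgram d.toProgram
  | .ite e c d => .branch e c.toProgram d.toProgram
  | .rep a c => .seq (.write a 0 0)
      (.loop (sizeVar - var a) (.seq c.toProgram (.write a 0 (var a + 1))))

/-- The arrays a command may write to. -/
def writes : Cmd → List ℕ
  | .skip => []
  | .write a _ _ => [a]
  | .seq c d => c.writes ++ d.writes
  | .ite _ c d => c.writes ++ d.writes
  | .rep a c => a :: c.writes

/-- Well-formed commands: their expressions are tame, the loop bound is not written, and the
bodies of loops do not write the counters. -/
def WF : Cmd → Prop
  | .skip => True
  | .write a i e => a ≠ 4 ∧ i.Tame ∧ e.Tame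
  | .seq c d => c.WF ∧ d.WF
  | .ite e c d => e.Tame ∧ c.WF ∧ d.WF
  | .rep a c => a ≠ 4 ∧ a ∉ c.writes ∧ c.WF

theorem run_frame (S : ℕ) (c : Cmd) {b : ℕ} (hb : b ∉ c.writes) (M : Mem) :
    c.run S M b = M b := by
  induction c generalizing M with
  | skip => rfl
  | write a i e =>
    simp only [writes, List.mem_singleton] at hb
    exact M.store_of_ne hb _ _
  | seq c d ihc ihd =>
    simp only [writes, List.mem_append, not_or] at hb
    exact (ihd hb.2 _).trans (ihc hb.1 _)
  | ite e c d ihc ihd =>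
    simp only [writes, List.mem_append, not_or] at hb
    simp only [run]
    split
    exacts [ihc hb.1 _, ihd hb.2 _]
  | rep a c ih =>
    simp only [writes, List.mem_cons, not_or] at hb
    suffices ∀ n, rounds a (c.run S) M n b = M b from this S
    intro n
    induction n with
    | zero => exact M.store_of_ne hb.1 _ _
    | succ n ihn => exact (Mem.store_of_ne _ hb.1 _ _).trans ((ih hb.2 _).trans ihn)

theorem WF.size_notMem {c : Cmd} (h : c.WF) : 4 ∉ c.writes := by
  induction c with
  | skip => simp [writes]
  | write a i e => simpa [writes] using h.1.symm
  | seq c d ihc ihd => simp [writes, ihc h.1, ihd h.2]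
  | ite e c d ihc ihd => simp [writes, ihc h.2.1, ihd h.2.2]
  | rep a c ih => simp [writes, ih h.2.2, h.1.symm]

/-- With loop bound `S`, the command adds at most `G S` bits to the numbers in the memory and runs
in time at most `Q S` per bit. -/
def PolyBounded (c : Cmd) (G Q : Polynomial ℕ) : Prop :=
  ∀ ⦃S k : ℕ⦄ ⦃M : Mem⦄, M 4 0 = S → M.BitBounded k → (c.run S M).BitBounded (k + G.eval S) ∧
    ∃ t ≤ Q.eval S * (k + 1), Exec c.toProgram M t (c.run S M)

section PolyBounded

variable {c d : Cmd} {e i : Expr} {a : ℕ} {G G' Q Q' : Polynomial ℕ}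

theorem polyBounded_skip : Cmd.skip.PolyBounded 0 1 :=
  fun _ _ M _ hM => ⟨by simpa [run] using hM, 1, by simp, Exec.skip M⟩

theorem polyBounded_write (hi : i.Tame) (he : e.Tame) :
    (write a i e).PolyBounded (.C e.weight * (.X + 1)) (i.costBound + e.costBound + 1) := by
  refine fun S k M hS hM => ⟨?_, _, ?_, Exec.write M a i e⟩
  · refine (hM.mono (Nat.le_add_right _ _)).store ?_ _ _
    simpa using e.natAbs_val_le hS hM he
  · have hi := i.cost_le_costBound hS hM hi
    have he := e.cost_le_costBound hS hM he
    simp only [Polynomial.eval_add, Polynomial.eval_one, add_mul]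
    omega

theorem PolyBounded.seq (hc : c.PolyBounded G Q) (h4 : 4 ∉ c.writes) (hd : d.PolyBounded G' Q') :
    (c.seq d).PolyBounded (G + G') (Q + Q' * (G + 1)) := by
  intro S k M hS hM
  obtain ⟨hcM, s, hs, hcE⟩ := hc hS hM
  obtain ⟨hdM, t, ht, hdE⟩ := hd (by rw [run_frame S c h4, hS]) hcM
  refine ⟨by simpa [run, add_assoc] using hdM, s + t, ?_, Exec.seq hcE hdE⟩
  calc s + t ≤ Q.eval S * (k + 1) + Q'.eval S * (k + G.eval S + 1) := add_le_add hs ht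
    _ ≤ Q.eval S * (k + 1) + Q'.eval S * ((G.eval S + 1) * (k + 1)) := by
      gcongr
      nlinarith [Nat.zero_le (G.eval S * k)]
    _ = (Q + Q' * (G + 1)).eval S * (k + 1) := by
      simp only [Polynomial.eval_add, Polynomial.eval_mul, Polynomial.eval_one]
      ring

theorem PolyBounded.ite (he : e.Tame) (hc : c.PolyBounded G Q) (hd : d.PolyBounded G' Q') :
    (Cmd.ite e c d).PolyBounded (G + G') (e.costBound + 1 + Q + Q') := by
  intro S k M hS hM
  have heM := e.cost_le_costBound hS hM he
  simp only [run, Polynomial.eval_add, Polynomial.eval_one, add_mul]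
  split
  case isTrue hpos =>
    obtain ⟨hcM, t, ht, hcE⟩ := hc hS hM
    exact ⟨hcM.mono (by omega), e.cost M + 1 + t, by omega, Exec.branch_pos hpos hcE⟩
  case isFalse hpos =>
    obtain ⟨hdM, t, ht, hdE⟩ := hd hS hM
    exact ⟨hdM.mono (by omega), e.cost M + 1 + t, by omega, Exec.branch_nonpos (not_lt.1 hpos) hdE⟩

/-- The body of `rep a c` in the translation to programs. -/
def countedBody (a : ℕ) (c : Cmd) : Cmd := c.seq (.write a 0 (var a + 1))

theorem rounds_succ_eq_run_countedBody (hac : a ∉ c.writes) (S : ℕ) (M : Mem) (n : ℕ) :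
    rounds a (c.run S) M (n + 1) = (countedBody a c).run S (rounds a (c.run S) M n) := by
  simp only [rounds, countedBody, run, Expr.val_zero, Expr.val_add, Expr.val_var, Expr.val_one,
    run_frame S c hac, rounds_counter]

theorem rounds_eq_iterate (hac : a ∉ c.writes) (S : ℕ) (M : Mem) (n : ℕ) :
    rounds a (c.run S) M n = ((countedBody a c).run S)^[n] (M.store a 0 0) := by
  induction n with
  | zero => rfl
  | succ n ih => rw [Function.iterate_succ_apply', ← ih, rounds_succ_eq_run_countedBody hac]

theorem iterate_run_frame (S : ℕ) {b : ℕ} (hb : b ∉ c.writes) (M : Mem) (n : ℕ) :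
    (c.run S)^[n] M b = M b := by
  induction n with
  | zero => rfl
  | succ n ih => rw [Function.iterate_succ_apply', run_frame S c hb, ih]

theorem PolyBounded.bitBounded_iterate (hc : c.PolyBounded G Q) (h4 : 4 ∉ c.writes) {S k : ℕ}
    {M : Mem} (hS : M 4 0 = S) (hM : M.BitBounded k) (n : ℕ) :
    ((c.run S)^[n] M).BitBounded (k + n * G.eval S) := by
  induction n with
  | zero => exact hM.mono (by omega)
  | succ n ih =>
    rw [Function.iterate_succ_apply']
    exact (hc (by rw [iterate_run_frame S h4, hS]) ih).1.mono (by ring_nf; rfl)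

theorem PolyBounded.exec_loop (hc : c.PolyBounded G Q) (h4 : 4 ∉ c.writes) (he : e.Tame)
    {S k n : ℕ} {M : Mem} (hS : M 4 0 = S) (hM : M.BitBounded k)
    (hpos : ∀ i < n, 0 < e.val ((c.run S)^[i] M)) (hdone : e.val ((c.run S)^[n] M) ≤ 0) :
    ∃ t ≤ (n + 1) * ((e.costBound.eval S + Q.eval S + 1) * (k + n * G.eval S + 1)),
      Exec (.loop e c.toProgram) M t ((c.run S)^[n] M) := by
  have bounded (i : ℕ) (hi : i ≤ n) : ((c.run S)^[i] M).BitBounded (k + n * G.eval S) :=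
    (hc.bitBounded_iterate h4 hS hM i).mono (by gcongr)
  have size_eq (i : ℕ) : (c.run S)^[i] M 4 0 = S := by rw [iterate_run_frame S h4, hS]
  have test_cost (i : ℕ) (hi : i ≤ n) := e.cost_le_costBound (size_eq i) (bounded i hi) he
  set D := k + n * G.eval S + 1
  have one_le : 1 ≤ D := Nat.le_add_left _ _
  suffices ∀ r ≤ n, ∃ t ≤ (r + 1) * ((e.costBound.eval S + Q.eval S + 1) * D),
      Exec (.loop e c.toProgram) ((c.run S)^[n - r] M) t ((c.run S)^[n] M) by
    simpa only [Nat.sub_self, Function.iterate_zero, id] using this n le_rfl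
  intro r hr
  induction r with
  | zero =>
    refine ⟨_, ?_, Exec.loop_nonpos hdone⟩
    linarith only [test_cost (n - 0) (Nat.sub_le _ _), one_le, Nat.zero_le (Q.eval S * D)]
  | succ r ih =>
    obtain ⟨t, ht, hloop⟩ := ih (by omega)
    obtain ⟨-, s, hs, hbody⟩ := hc (size_eq (n - (r + 1))) (bounded _ (by omega))
    rw [← Function.iterate_succ_apply' (c.run S), show (n - (r + 1)).succ = n - r by omega] at hbody
    refine ⟨_, ?_, Exec.loop_pos (hpos _ (by omega)) hbody hloop⟩
    linarith only [test_cost (n - (r + 1)) (by omega), show s ≤ Q.eval S * D from hs, ht, one_le]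

theorem PolyBounded.rep (hc : (countedBody a c).PolyBounded G Q) (ha : a ≠ 4)
    (hac : a ∉ c.writes) (h4 : 4 ∉ c.writes) :
    (Cmd.rep a c).PolyBounded (.X * G)
      (3 + (.X + 1) * (((sizeVar - var a).costBound + Q + 1) * (.X * G + 1))) := by
  intro S k M hS hM
  have size_notMem : 4 ∉ (countedBody a c).writes := by simp [countedBody, writes, h4, ha.symm]
  have hS₀ : M.store a 0 0 4 0 = S := by rw [M.store_of_ne ha.symm, hS]
  have hM₀ : (M.store a 0 0).BitBounded k := hM.store (by simp) a 0
  have test_val (i : ℕ) :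
      (sizeVar - var a).val (((countedBody a c).run S)^[i] (M.store a 0 0)) = S - i := by
    rw [Expr.val_sub, Expr.val_sizeVar, Expr.val_var, iterate_run_frame S size_notMem, hS₀,
      ← rounds_eq_iterate hac, rounds_counter]
  obtain ⟨t, ht, hloop⟩ := hc.exec_loop (n := S) size_notMem (e := sizeVar - var a)
    ⟨trivial, trivial⟩ hS₀ hM₀ (fun i hi => by rw [test_val]; omega) (by rw [test_val]; omega)
  simp only [run, rounds_eq_iterate hac, Polynomial.eval_add, Polynomial.eval_mul,
    Polynomial.eval_X, Polynomial.eval_one, Polynomial.eval_ofNat]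
  refine ⟨hc.bitBounded_iterate size_notMem hS₀ hM₀ S, 3 + t, ?_,
    Exec.seq (Exec.write M a 0 0) hloop⟩
  set B := (sizeVar - var a).costBound.eval S + Q.eval S + 1
  calc 3 + t ≤ 3 * (k + 1) + (S + 1) * (B * ((S * G.eval S + 1) * (k + 1))) := by
        refine add_le_add (by omega) (ht.trans ?_)
        gcongr
        nlinarith [Nat.zero_le (S * G.eval S * k)]
    _ = _ := by ring

end PolyBounded

theorem WF.exists_polyBounded {c : Cmd} (hc : c.WF) :
    ∃ G Q : Polynomial ℕ, c.PolyBounded G Q := by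
  induction c with
  | skip => exact ⟨_, _, polyBounded_skip⟩
  | write a i e => exact ⟨_, _, polyBounded_write hc.2.1 hc.2.2⟩
  | seq c d ihc ihd =>
    obtain ⟨G, Q, h⟩ := ihc hc.1
    obtain ⟨G', Q', h'⟩ := ihd hc.2
    exact ⟨_, _, h.seq hc.1.size_notMem h'⟩
  | ite e c d ihc ihd =>
    obtain ⟨G, Q, h⟩ := ihc hc.2.1
    obtain ⟨G', Q', h'⟩ := ihd hc.2.2
    exact ⟨_, _, .ite hc.1 h h'⟩
  | rep a c ih =>
    obtain ⟨ha, hac, hcWF⟩ := hc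
    obtain ⟨G, Q, h⟩ := ih hcWF
    have h4 := hcWF.size_notMem
    exact ⟨_, _, .rep (h.seq h4 (polyBounded_write trivial ⟨trivial, trivial⟩)) ha hac h4⟩

end Cmd

end RAM

namespace UTVPI

/-! ## Shortest paths by rounds of relaxation -/

section ShortestPaths

variable {α : Type*} {V : Finset α} {R A : α → α → ℤ → Prop} {D D₀ E q : α → ℤ} {t h u : α}

/-- `E` arises from the distances `D` by relaxing, in some order, arcs `R t h ℓ` (from `t` to `h`,
of length `ℓ`), among them all those that satisfy `A`. -/
structure Relaxed (R A : α → α → ℤ → Prop) (D E : α → ℤ) : Prop where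
  le : ∀ u, E u ≤ D u
  arc : ∀ t h ℓ, A t h ℓ → E h ≤ D t + ℓ
  attained : ∀ u, E u = D u ∨ ∃ t ℓ, R t u ℓ ∧ E t + ℓ ≤ E u

/-- The distances `D` are stable, and each is an initial one or attained through an arc. -/
structure Settled (R : α → α → ℤ → Prop) (D₀ D : α → ℤ) : Prop where
  arc : ∀ t h ℓ, R t h ℓ → D h ≤ D t + ℓ
  attained : ∀ u, D u = D₀ u ∨ ∃ t ℓ, R t u ℓ ∧ D u = D t + ℓ

/-- The arcs join nodes of `V`, and their lengths become positive after the change of potential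
`q`. This rules out cycles of non-positive length. -/
structure PositiveUpTo (R : α → α → ℤ → Prop) (V : Finset α) (q : α → ℤ) : Prop where
  tail_mem : ∀ {t h ℓ}, R t h ℓ → t ∈ V
  head_mem : ∀ {t h ℓ}, R t h ℓ → h ∈ V
  lt : ∀ {t h ℓ}, R t h ℓ → q h < q t + ℓ

/-- The number of elements of `V` with a smaller value of `G`. -/
def rank (V : Finset α) (G : α → ℤ) (u : α) : ℕ := (V.filter fun v => G v < G u).card

theorem rank_lt_rank {G : α → ℤ} (ht : t ∈ V) (htu : G t < G u) : rank V G t < rank V G u := by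
  refine Finset.card_lt_card (Finset.ssubset_iff_of_subset ?_ |>.2 ⟨t, by simp [ht, htu], by simp⟩)
  exact Finset.monotone_filter_right _ fun v _ hv => lt_trans hv htu

theorem rank_lt_card {G : α → ℤ} (hu : u ∈ V) : rank V G u < V.card :=
  Finset.card_lt_card (Finset.filter_ssubset.2 ⟨u, hu, lt_irrefl _⟩)

theorem PositiveUpTo.rank_lt_rank (hR : PositiveUpTo R V q) {ℓ : ℤ} (hr : R t h ℓ)
    (hD : D t + ℓ ≤ D h) : rank V (D - q) t < rank V (D - q) h :=
  UTVPI.rank_lt_rank (hR.tail_mem hr) (by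
    have := hR.lt hr
    simp only [Pi.sub_apply]
    linarith)

theorem exists_forall_le_of_antitone {s : ℕ → α → ℤ} (hs : Antitone s)
    (hb : ∀ u ∈ V, ∃ b, ∀ i, b ≤ s i u) : ∃ i₀, ∀ i, ∀ u ∈ V, s i₀ u ≤ s i u := by
  have least : ∀ u ∈ V, ∃ j, ∀ i, s j u ≤ s i u := by
    intro u hu
    obtain ⟨b, hb⟩ := hb u hu
    obtain ⟨-, ⟨j, rfl⟩, hj⟩ := Int.exists_least_of_bdd (P := fun z => ∃ i, s i u = z)
      ⟨b, by rintro - ⟨i, rfl⟩; exact hb i⟩ ⟨_, 0, rfl⟩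
    exact ⟨j, fun i => hj _ ⟨i, rfl⟩⟩
  choose! j hj using least
  exact ⟨V.sup j, fun i u hu => (hs (Finset.le_sup hu) u).trans (hj u hu i)⟩

section Rounds

variable {s : ℕ → α → ℤ}

theorem Relaxed.antitone (hs : ∀ i, Relaxed R A (s i) (s (i + 1))) : Antitone s :=
  antitone_nat_of_succ_le fun i => (hs i).le

theorem Relaxed.attained_rounds (hs : ∀ i, Relaxed R A (s i) (s (i + 1))) (i : ℕ) (u : α) :
    s i u = s 0 u ∨ ∃ t ℓ, R t u ℓ ∧ s i t + ℓ ≤ s i u := by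
  induction i generalizing u with
  | zero => exact .inl rfl
  | succ i ih =>
    rcases (hs i).attained u with h | h
    · rw [h]
      refine (ih u).imp_right fun ⟨t, ℓ, hR, ht⟩ => ⟨t, ℓ, hR, ?_⟩
      linarith [(hs i).le t]
    · exact .inr h

theorem PositiveUpTo.exists_forall_le (hR : PositiveUpTo R V q)
    (hs : ∀ i u, s i u = s 0 u ∨ ∃ t ℓ, R t u ℓ ∧ s i t + ℓ ≤ s i u) :
    ∃ b, ∀ i, ∀ u ∈ V, b ≤ s i u - q u := by
  obtain ⟨b, hb⟩ := (V.image (s 0 - q)).bddBelow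
  refine ⟨b, fun i u hu => ?_⟩
  obtain ⟨v, hv, hmin⟩ := V.exists_min_image (s i - q) ⟨u, hu⟩
  refine le_trans ?_ (hmin u hu)
  rcases hs i v with h | ⟨t, ℓ, hr, h⟩
  · simpa [h] using hb (Finset.mem_coe.2 (Finset.mem_image_of_mem _ hv))
  · have := hmin t (hR.tail_mem hr)
    have := hR.lt hr
    simp only [Pi.sub_apply] at *
    linarith

/-- After `i` rounds, the nodes whose shortest paths have at most `i` arcs have their final
distances. -/
theorem PositiveUpTo.eq_of_rank_le (hR : PositiveUpTo R V q)
    (hs : ∀ i, Relaxed R R (s i) (s (i + 1))) {i₀ : ℕ} (hi₀ : ∀ i, ∀ u ∈ V, s i₀ u ≤ s i u)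
    {i : ℕ} (hu : u ∈ V) (hi : rank V (s i₀ - q) u ≤ i) : s i u = s i₀ u := by
  induction i generalizing u with
  | zero =>
    rcases Relaxed.attained_rounds hs i₀ u with h | ⟨t, ℓ, hr, h⟩
    · exact h.symm
    · exact absurd (hR.rank_lt_rank hr h) (by omega)
  | succ i ih =>
    refine le_antisymm ?_ (hi₀ _ u hu)
    rcases Relaxed.attained_rounds hs i₀ u with h | ⟨t, ℓ, hr, h⟩
    · exact (Relaxed.antitone hs (Nat.zero_le _) u).trans h.ge
    · have hlt := hR.rank_lt_rank hr h
      calc s (i + 1) u ≤ s i t + ℓ := (hs i).arc _ _ _ hr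
        _ = s i₀ t + ℓ := by rw [ih (hR.tail_mem hr) (by omega)]
        _ ≤ s i₀ u := h

theorem PositiveUpTo.settled_iterate (hR : PositiveUpTo R V q) {P : (α → ℤ) → α → ℤ}
    (hP : ∀ D, Relaxed R R D (P D)) (D₀ : α → ℤ) {n : ℕ} (hn : V.card ≤ n) :
    Settled R D₀ (P^[n] D₀) := by
  set s : ℕ → α → ℤ := fun i => P^[i] D₀ with hs
  have relaxed : ∀ i, Relaxed R R (s i) (s (i + 1)) := fun i => by
    simpa only [hs, Function.iterate_succ_apply'] using hP _
  have attained := Relaxed.attained_rounds relaxed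
  obtain ⟨b, hb⟩ := hR.exists_forall_le attained
  obtain ⟨i₀, hi₀⟩ := exists_forall_le_of_antitone (Relaxed.antitone relaxed)
    fun u hu => ⟨b + q u, fun i => by linarith [hb i u hu]⟩
  have final : ∀ u ∈ V, s n u = s i₀ u := fun u hu =>
    hR.eq_of_rank_le relaxed hi₀ hu ((rank_lt_card hu).le.trans hn)
  have arc : ∀ t h ℓ, R t h ℓ → s n h ≤ s n t + ℓ := fun t h ℓ hr => by
    rw [final t (hR.tail_mem hr), final h (hR.head_mem hr)]
    exact (hi₀ (i₀ + 1) h (hR.head_mem hr)).trans ((relaxed i₀).arc t h ℓ hr)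
  exact ⟨arc, fun u => (attained n u).imp_right fun ⟨t, ℓ, hr, h⟩ =>
    ⟨t, ℓ, hr, le_antisymm (arc _ _ _ hr) h⟩⟩

end Rounds

theorem Settled.exists_eq_mul_add (hD : Settled R D₀ D) (hR : PositiveUpTo R V q) {S : ℤ}
    (hS : ∀ t h ℓ, R t h ℓ → ∃ a, ℓ = S * a + 1) (hD₀ : ∀ u ∈ V, S ∣ D₀ u) (hu : u ∈ V) :
    ∃ (a : ℤ) (i : ℕ), i ≤ rank V (D - q) u ∧ D u = S * a + i := by
  induction hr : rank V (D - q) u using Nat.strong_induction_on generalizing u with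
  | _ r ih =>
    rcases hD.attained u with h | ⟨t, ℓ, harc, h⟩
    · obtain ⟨a, ha⟩ := hD₀ u hu
      exact ⟨a, 0, Nat.zero_le _, by simp [h, ha]⟩
    · have hlt := hR.rank_lt_rank harc h.ge
      obtain ⟨a, i, hi, hDt⟩ := ih _ (hr ▸ hlt) (hR.tail_mem harc) rfl
      obtain ⟨c, rfl⟩ := hS _ _ _ harc
      exact ⟨a + c, i + 1, by omega, by rw [h, hDt]; push_cast; ring⟩

/-- Modulo `S`, the stable distance counts the arcs of a shortest path. -/
theorem Settled.emod_lt (hD : Settled R D₀ D) (hR : PositiveUpTo R V q) {S : ℕ}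
    (hcard : V.card < S) (hS : ∀ t h ℓ, R t h ℓ → ∃ a, ℓ = S * a + 1)
    (hD₀ : ∀ u ∈ V, (S : ℤ) ∣ D₀ u) (hu : u ∈ V) : D u % S + 1 < S := by
  obtain ⟨a, i, hi, h⟩ := hD.exists_eq_mul_add hR hS hD₀ hu
  have := rank_lt_card (G := D - q) hu
  rw [h, Int.mul_add_emod_self_left, Int.emod_eq_of_lt] <;> omega

/-- The relaxation of an arc. -/
def relax [DecidableEq α] (D : α → ℤ) (t h : α) (ℓ : ℤ) : α → ℤ :=
  if D t + ℓ < D h then Function.update D h (D t + ℓ) else D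

section Relax

variable [DecidableEq α]

theorem relax_of_ne (hu : u ≠ h) (ℓ : ℤ) : relax D t h ℓ u = D u := by
  unfold relax
  split
  exacts [Function.update_of_ne hu _ _, rfl]

theorem relax_head (D : α → ℤ) (t h : α) (ℓ : ℤ) : relax D t h ℓ h = min (D t + ℓ) (D h) := by
  unfold relax
  split
  case isTrue hlt => rw [Function.update_self, min_eq_left hlt.le]
  case isFalse hlt => exact (min_eq_right (not_lt.1 hlt)).symm

theorem relax_le (D : α → ℤ) (t h : α) (ℓ : ℤ) : relax D t h ℓ ≤ D := by
  intro u
  obtain rfl | hu := eq_or_ne u h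
  exacts [(relax_head D t u ℓ).trans_le (min_le_right _ _), (relax_of_ne hu ℓ).le]

theorem Relaxed.relax (hE : Relaxed R A D E) {ℓ : ℤ} (hR : R t h ℓ) :
    Relaxed R (fun t' h' ℓ' => A t' h' ℓ' ∨ t' = t ∧ h' = h ∧ ℓ' = ℓ) D (relax E t h ℓ) where
  le u := (relax_le E t h ℓ u).trans (hE.le u)
  arc := by
    rintro t' h' ℓ' (hA | ⟨rfl, rfl, rfl⟩)
    · exact (relax_le E t h ℓ h').trans (hE.arc _ _ _ hA)
    · rw [relax_head]
      exact (min_le_left _ _).trans (by linarith [hE.le t'])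
  attained u := by
    have hle := relax_le E t h ℓ
    have old : UTVPI.relax E t h ℓ u = E u →
        UTVPI.relax E t h ℓ u = D u ∨
          ∃ t' ℓ', R t' u ℓ' ∧ UTVPI.relax E t h ℓ t' + ℓ' ≤ UTVPI.relax E t h ℓ u := fun hu => by
      rw [hu]
      refine (hE.attained u).imp_right fun ⟨t', ℓ', hR', h'⟩ => ⟨t', ℓ', hR', ?_⟩
      linarith [hle t']
    obtain rfl | hu := eq_or_ne u h
    · rcases le_total (E u) (E t + ℓ) with hlt | hlt
      · exact old (by rw [relax_head, min_eq_right hlt])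
      · refine .inr ⟨t, ℓ, hR, ?_⟩
        rw [relax_head, min_eq_left hlt]
        linarith [hle t]
    · exact old (relax_of_ne hu ℓ)

end Relax

theorem Relaxed.mono {A' : α → α → ℤ → Prop} (hE : Relaxed R A D E)
    (hA : ∀ t h ℓ, A' t h ℓ → A t h ℓ) : Relaxed R A' D E :=
  ⟨hE.le, fun t h ℓ h' => hE.arc t h ℓ (hA t h ℓ h'), hE.attained⟩

end ShortestPaths

theorem ediv_le_of_le {S x y s : ℤ} (hx : x % S + 1 < S) (hS : 0 < S)
    (h : y ≤ x + (S * s + 1)) : y / S ≤ x / S + s := by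
  have := Int.mul_ediv_add_emod x S
  have : y / S < x / S + s + 1 := Int.ediv_lt_of_lt_mul hS (by nlinarith)
  omega

theorem ediv_eq_of_eq {S x y s : ℤ} (hx : x % S + 1 < S) (hS : 0 < S)
    (h : y = x + (S * s + 1)) : y / S = x / S + s := by
  refine le_antisymm (ediv_le_of_le hx hS h.le) (Int.le_ediv_of_mul_le hS ?_)
  have := Int.mul_ediv_add_emod x S
  have := Int.emod_nonneg x hS.ne'
  nlinarith

/-- The composition of the maps `f 0, …, f (n - 1)`. -/
def sweep {β : Type*} (f : ℕ → β → β) : ℕ → β → β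
  | 0, x => x
  | k + 1, x => f k (sweep f k x)

/-! ## Residual networks -/

/-- A network on the node type `α`: arc `k` leads from `tail k` to `head k`. Only the arcs
`0, …, size - 1` matter; the indices are integers because the addresses of arrays are. -/
structure Network (α : Type*) where
  size : ℕ
  tail : ℤ → α
  head : ℤ → α
  cost : ℤ → ℤ

namespace Network

variable {α : Type*} (N : Network α) (F : ℤ → ℤ) (p : α → ℤ)

/-- The arcs join nodes of `V`, and `V` has fewer than `N.size` nodes, so that `N.size` rounds of
relaxation suffice. -/
structure OnNodes (V : Finset α) : Prop where
  card_lt : V.card < N.size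
  tail_mem : ∀ {k : ℕ}, k < N.size → N.tail k ∈ V
  head_mem : ∀ {k : ℕ}, k < N.size → N.head k ∈ V

/-- The slack of arc `k` with respect to the potential `p`. -/
def slack (k : ℤ) : ℤ := p (N.tail k) - p (N.head k) - N.cost k

/-- Feasible potentials. -/
def Potential : Prop := ∀ ⦃k : ℕ⦄, k < N.size → 0 ≤ N.slack p k

/-- Complementary slackness: the flow `F` is nonnegative and only on arcs that are tight for
`p`. -/
structure Complementary : Prop where
  nonneg : ∀ {k : ℕ}, k < N.size → 0 ≤ F k
  slack_eq_zero : ∀ {k : ℕ}, k < N.size → 0 < F k → N.slack p k = 0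

/-- The length of arc `k` in residual networks. Slacks are scaled by `N.size`, and each arc has one
more unit of length, so that a distance also counts the arcs of a path. -/
def arcLength (k : ℤ) : ℤ := N.size * N.slack p k + 1

/-- The arcs of length `ℓ` from `t` to `h` that arc `k` gives in the residual network of the flow
`F`: the arc itself, and its reversal if it carries flow. -/
def ResidualArc (k : ℕ) (t h : α) (ℓ : ℤ) : Prop :=
  t = N.tail k ∧ h = N.head k ∧ ℓ = N.arcLength p k ∨
    0 < F k ∧ t = N.head k ∧ h = N.tail k ∧ ℓ = 1

/-- The arcs of the residual network. -/
def Residual (t h : α) (ℓ : ℤ) : Prop := ∃ k < N.size, N.ResidualArc F p k t h ℓ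

section Relaxation

variable [DecidableEq α]

/-- The relaxation of arc `k` and its reversal. -/
def relaxArc (k : ℕ) (D : α → ℤ) : α → ℤ :=
  let E := relax D (N.tail k) (N.head k) (N.arcLength p k)
  if 0 < F k then relax E (N.head k) (N.tail k) 1 else E

/-- A round of relaxation. -/
def relaxAll (D : α → ℤ) : α → ℤ := sweep (N.relaxArc F p) N.size D

variable {N F p}

theorem _root_.UTVPI.Relaxed.relaxArc {A : α → α → ℤ → Prop} {D E : α → ℤ}
    (hE : Relaxed (N.Residual F p) A D E) {k : ℕ} (hk : k < N.size) :
    Relaxed (N.Residual F p) (fun t h ℓ => A t h ℓ ∨ N.ResidualArc F p k t h ℓ) D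
      (N.relaxArc F p k E) := by
  have forward := hE.relax ⟨k, hk, .inl ⟨rfl, rfl, rfl⟩⟩
  unfold Network.relaxArc
  split
  case isTrue hF =>
    refine (forward.relax ⟨k, hk, .inr ⟨hF, rfl, rfl, rfl⟩⟩).mono ?_
    rintro t h ℓ (hA | hA | hA)
    exacts [.inl (.inl hA), .inl (.inr hA), .inr hA.2]
  case isFalse hF =>
    refine forward.mono ?_
    rintro t h ℓ (hA | hA | hA)
    exacts [.inl hA, .inr hA, absurd hA.1 hF]

variable (N F p)

theorem relaxed_relaxAll (D : α → ℤ) :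
    Relaxed (N.Residual F p) (N.Residual F p) D (N.relaxAll F p D) := by
  suffices ∀ n ≤ N.size, Relaxed (N.Residual F p)
      (fun t h ℓ => ∃ k < n, N.ResidualArc F p k t h ℓ) D (sweep (N.relaxArc F p) n D) from
    this N.size le_rfl
  intro n hn
  induction n with
  | zero => exact ⟨fun _ => le_rfl, fun _ _ _ ⟨k, hk, _⟩ => absurd hk k.not_lt_zero,
      fun _ => .inl rfl⟩
  | succ n ih =>
    refine ((ih (by omega)).relaxArc (by omega)).mono fun t h ℓ ⟨k, hk, hr⟩ => ?_
    rcases Nat.lt_succ_iff_lt_or_eq.1 hk with hk | rfl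
    exacts [.inl ⟨k, hk, hr⟩, .inr hr]

end Relaxation

variable {N F p} {V : Finset α} {k : ℕ} {t h : α} {ℓ : ℤ}

theorem Residual.exists_eq_mul_add_one (t h : α) (ℓ : ℤ) (hr : N.Residual F p t h ℓ) :
    ∃ a, ℓ = N.size * a + 1 := by
  obtain ⟨k, -, ⟨-, -, rfl⟩ | ⟨-, -, -, rfl⟩⟩ := hr
  exacts [⟨_, rfl⟩, ⟨0, by simp⟩]

theorem Residual.pos (hp : N.Potential p) (hr : N.Residual F p t h ℓ) : 0 < ℓ := by
  obtain ⟨k, hk, ⟨-, -, rfl⟩ | ⟨-, -, -, rfl⟩⟩ := hr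
  · have := mul_nonneg N.size.cast_nonneg (hp hk)
    unfold arcLength
    omega
  · exact one_pos

theorem Potential.arcLength_pos (hp : N.Potential p) (hk : k < N.size) : 0 < N.arcLength p k :=
  Residual.pos (F := 0) hp ⟨k, hk, .inl ⟨rfl, rfl, rfl⟩⟩

theorem OnNodes.positiveUpTo (hN : N.OnNodes V) {q : α → ℤ}
    (hq : ∀ t h ℓ, N.Residual F p t h ℓ → q h < q t + ℓ) :
    PositiveUpTo (N.Residual F p) V q where
  tail_mem := by
    rintro t h ℓ ⟨k, hk, ⟨rfl, -⟩ | ⟨-, rfl, -⟩⟩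
    exacts [hN.tail_mem hk, hN.head_mem hk]
  head_mem := by
    rintro t h ℓ ⟨k, hk, ⟨-, rfl, -⟩ | ⟨-, -, rfl, -⟩⟩
    exacts [hN.head_mem hk, hN.tail_mem hk]
  lt := hq _ _ _

theorem Potential.positiveUpTo (hp : N.Potential p) (hN : N.OnNodes V) :
    PositiveUpTo (N.Residual F p) V 0 :=
  hN.positiveUpTo fun _ _ _ hr => by simpa using hr.pos hp

theorem OnNodes.slack_add (hN : N.OnNodes V) {p' d : α → ℤ} (hp' : ∀ u ∈ V, p' u = p u + d u)
    (hk : k < N.size) :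
    N.slack p' k = N.slack p k + d (N.tail k) - d (N.head k) := by
  rw [slack, slack, hp' _ (hN.tail_mem hk), hp' _ (hN.head_mem hk)]
  ring

variable (N F p V) in
/-- The properties of the distances `D` from the node `s`, which are cut off at `N.size * B`. -/
structure Distances (s : α) (B : ℤ) (D : α → ℤ) : Prop where
  arc_le : ∀ t h ℓ, N.Residual F p t h ℓ → D h ≤ D t + ℓ
  attained : ∀ u ∈ V, u ≠ s → D u = N.size * B ∨ ∃ t ℓ, N.Residual F p t u ℓ ∧ D u = D t + ℓ
  source : D s = 0
  nonneg : ∀ u ∈ V, 0 ≤ D u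
  le : ∀ u ∈ V, D u ≤ N.size * B
  emod_lt : ∀ u ∈ V, D u % N.size + 1 < N.size

theorem _root_.UTVPI.Settled.nonneg {D₀ D : α → ℤ} (hD : Settled (N.Residual F p) D₀ D)
    (hp : N.Potential p) (hN : N.OnNodes V) (hD₀ : ∀ u ∈ V, 0 ≤ D₀ u) {u : α} (hu : u ∈ V) :
    0 ≤ D u := by
  obtain ⟨v, hv, hmin⟩ := V.exists_min_image D ⟨u, hu⟩
  refine le_trans ?_ (hmin u hu)
  rcases hD.attained v with h | ⟨t, ℓ, hr, h⟩
  · exact h ▸ hD₀ v hv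
  · have := hmin t ((hp.positiveUpTo hN).tail_mem hr)
    have := hr.pos hp
    omega

namespace Distances

variable {s : α} {B : ℤ} {D : α → ℤ} (hD : N.Distances F p V s B D) (hN : N.OnNodes V)
include hD hN

theorem ediv_head_le (hk : k < N.size) :
    D (N.head k) / N.size ≤ D (N.tail k) / N.size + N.slack p k :=
  ediv_le_of_le (hD.emod_lt _ (hN.tail_mem hk)) (by omega)
    (hD.arc_le _ _ _ ⟨k, hk, .inl ⟨rfl, rfl, rfl⟩⟩)

theorem ediv_tail_le (hk : k < N.size) (hF : 0 < F k) :
    D (N.tail k) / N.size ≤ D (N.head k) / N.size := by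
  simpa using ediv_le_of_le (s := 0) (hD.emod_lt _ (hN.head_mem hk)) (by omega)
    ((hD.arc_le _ _ _ ⟨k, hk, .inr ⟨hF, rfl, rfl, rfl⟩⟩).trans (by simp))

variable {p' : α → ℤ} (hp' : ∀ u ∈ V, p' u = p u + D u / N.size)
include hp'

theorem potential_add : N.Potential p' := fun k hk => by
  rw [hN.slack_add hp' hk]
  linarith [hD.ediv_head_le hN hk]

theorem complementary_add (hF : N.Complementary F p) : N.Complementary F p' where
  nonneg := hF.nonneg
  slack_eq_zero hk hpos := by
    have := hD.ediv_head_le hN hk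
    have := hD.ediv_tail_le hN hk hpos
    have := hF.slack_eq_zero hk hpos
    rw [hN.slack_add hp' hk]
    linarith

end Distances

variable [DecidableEq α]

theorem potential_ediv (hN : N.OnNodes V) {z : α → ℤ} (hz : N.Potential z) {D₀ : α → ℤ}
    (hD₀ : ∀ u ∈ V, D₀ u = 0) :
    N.Potential fun u => (N.relaxAll 0 0)^[N.size] D₀ u / N.size := by
  have hR : PositiveUpTo (N.Residual 0 0) V fun u => N.size * z u := by
    refine hN.positiveUpTo ?_
    rintro t h ℓ ⟨k, hk, ⟨rfl, rfl, rfl⟩ | ⟨h, -⟩⟩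
    · have : (0 : ℤ) ≤ N.size * N.slack z k := mul_nonneg N.size.cast_nonneg (hz hk)
      simp only [arcLength, slack, Pi.zero_apply] at *
      linarith
    · exact absurd h (lt_irrefl 0)
  have settled := hR.settled_iterate (N.relaxed_relaxAll 0 0) D₀ hN.card_lt.le
  intro k hk
  have := ediv_le_of_le (settled.emod_lt hR hN.card_lt Residual.exists_eq_mul_add_one
    (fun u hu => by simp [hD₀ u hu]) (hN.tail_mem hk)) (by omega)
    (settled.arc _ _ _ ⟨k, hk, .inl ⟨rfl, rfl, rfl⟩⟩)
  simp only [slack, Pi.zero_apply] at *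
  linarith

theorem distances_iterate (hN : N.OnNodes V) (hp : N.Potential p) {s : α} {B : ℤ} (hs : s ∈ V)
    (hB : 0 ≤ B) {D₀ : α → ℤ} (hD₀ : ∀ u ∈ V, D₀ u = if u = s then 0 else N.size * B) :
    N.Distances F p V s B ((N.relaxAll F p)^[N.size] D₀) := by
  have hR := hp.positiveUpTo (F := F) hN
  have settled := hR.settled_iterate (N.relaxed_relaxAll F p) D₀ hN.card_lt.le
  have hSB : (0 : ℤ) ≤ N.size * B := mul_nonneg N.size.cast_nonneg hB
  have start_bounds : ∀ u ∈ V, 0 ≤ D₀ u ∧ D₀ u ≤ N.size * B := fun u hu => by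
    rw [hD₀ u hu]
    split <;> simp [hSB]
  have le_start : ∀ u, (N.relaxAll F p)^[N.size] D₀ u ≤ D₀ u :=
    Relaxed.antitone (s := fun i => (N.relaxAll F p)^[i] D₀) (fun i => by
      simpa only [Function.iterate_succ_apply'] using N.relaxed_relaxAll F p _) N.size.zero_le
  have nonneg : ∀ u ∈ V, 0 ≤ (N.relaxAll F p)^[N.size] D₀ u := fun u hu =>
    settled.nonneg hp hN (fun v hv => (start_bounds v hv).1) hu
  exact
    { arc_le := settled.arc
      attained := fun u hu hus => by simpa [hD₀ u hu, hus] using settled.attained u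
      source := le_antisymm ((le_start s).trans_eq (by simp [hD₀ s hs])) (nonneg s hs)
      nonneg
      le := fun u hu => (le_start u).trans (start_bounds u hu).2
      emod_lt := fun u hu => settled.emod_lt hR hN.card_lt Residual.exists_eq_mul_add_one
        (fun u hu => by rw [hD₀ u hu]; split <;> simp) hu }

end Network

/-! ## Flows and duality -/

namespace Network

variable {α : Type*} [DecidableEq α] (N : Network α)

/-- The net flow out of the node `u`. -/
def divergence (F : ℤ → ℤ) (u : α) : ℤ :=
  ∑ k ∈ Finset.range N.size,
    F k * ((if u = N.tail k then 1 else 0) - (if u = N.head k then 1 else 0))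

theorem divergence_update (F : ℤ → ℤ) {k : ℕ} (hk : k < N.size) (a : ℤ) (u : α) :
    N.divergence (Function.update F k (F k + a)) u = N.divergence F u +
      a * ((if u = N.tail k then 1 else 0) - (if u = N.head k then 1 else 0)) := by
  have update_apply : ∀ i : ℕ,
      Function.update F k (F k + a) (i : ℤ) = F i + if i = k then a else 0 := by
    intro i
    obtain rfl | h := eq_or_ne i k
    · simp
    · simp [h]
  simp only [divergence, update_apply, add_mul, Finset.sum_add_distrib, ite_mul, zero_mul]
  rw [Finset.sum_ite_eq' (Finset.range N.size) k, if_pos (Finset.mem_range.2 hk)]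

theorem divergence_two_mul (F : ℤ → ℤ) (u : α) :
    N.divergence (2 * F) u = 2 * N.divergence F u := by
  simp only [divergence, Finset.mul_sum, mul_assoc, Pi.mul_apply, Pi.ofNat_apply]

variable {N} {V : Finset α}

theorem divergence_congr {F F' : ℤ → ℤ} (h : ∀ k : ℕ, k < N.size → F' k = F k) (u : α) :
    N.divergence F' u = N.divergence F u :=
  Finset.sum_congr rfl fun k hk => by rw [h k (Finset.mem_range.1 hk)]

theorem OnNodes.sum_divergence_mul (hN : N.OnNodes V) (F : ℤ → ℤ) (p : α → ℤ) :
    ∑ u ∈ V, N.divergence F u * p u =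
      ∑ k ∈ Finset.range N.size, F k * (p (N.tail k) - p (N.head k)) := by
  simp only [divergence, Finset.sum_mul]
  rw [Finset.sum_comm]
  refine Finset.sum_congr rfl fun k hk => ?_
  have hk := Finset.mem_range.1 hk
  simp only [mul_assoc, sub_mul, ← Finset.mul_sum, Finset.sum_sub_distrib, ite_mul, one_mul,
    zero_mul, Finset.sum_ite_eq', hN.tail_mem hk, hN.head_mem hk, if_true]

theorem Complementary.sum_divergence_mul_le {F : ℤ → ℤ} {p z : α → ℤ}
    (hF : N.Complementary F p) (hN : N.OnNodes V) (hz : N.Potential z) :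
    ∑ u ∈ V, N.divergence F u * p u ≤ ∑ u ∈ V, N.divergence F u * z u := by
  rw [hN.sum_divergence_mul, hN.sum_divergence_mul]
  refine Finset.sum_le_sum fun k hk => ?_
  have hk := Finset.mem_range.1 hk
  rcases (hF.nonneg hk).eq_or_lt with h | h
  · simp [← h]
  · refine mul_le_mul_of_nonneg_left ?_ h.le
    have := hF.slack_eq_zero hk h
    have := hz hk
    simp only [slack] at *
    linarith

end Network

/-! ## Tracing a shortest path -/

theorem progress_trans {β : Type*} {f : β → ℤ} {x y z : β} {P Q : β → Prop}
    (hxy : f y < f x ∨ y = x ∧ P x) (hyz : f z < f y ∨ z = y ∧ Q y) :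
    f z < f x ∨ z = x ∧ P x ∧ Q x := by
  rcases hxy with hxy | ⟨rfl, hP⟩
  · rcases hyz with hyz | ⟨rfl, -⟩
    exacts [.inl (hyz.trans hxy), .inl hxy]
  · exact hyz.imp_right fun ⟨hz, hQ⟩ => ⟨hz, hP, hQ⟩

namespace Network

variable {α : Type*} [DecidableEq α] (N : Network α) (p D : α → ℤ)

/-- Arc `k` ends a shortest path to `v`. -/
def EnabledForward (k : ℕ) (v : α) : Prop :=
  N.head k = v ∧ D (N.tail k) + N.arcLength p k ≤ D (N.head k)

/-- The reversal of arc `k` ends a shortest path to `v` in the residual network of `F`. -/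
def EnabledBackward (F : ℤ → ℤ) (k : ℕ) (v : α) : Prop :=
  N.tail k = v ∧ 0 < F k ∧ D (N.head k) + 1 ≤ D (N.tail k)

instance (k : ℕ) (v : α) : Decidable (N.EnabledForward p D k v) :=
  inferInstanceAs (Decidable (_ ∧ _))

instance (F : ℤ → ℤ) (k : ℕ) (v : α) : Decidable (N.EnabledBackward D F k v) :=
  inferInstanceAs (Decidable (_ ∧ _))

/-- In the state `x` of tracing, `x.1` is the flow and `x.2` the current node. This pushes a unit
of flow along arc `k` if it ends a shortest path to the current node. -/
def traceForward (k : ℕ) (x : (ℤ → ℤ) × α) : (ℤ → ℤ) × α :=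
  if N.EnabledForward p D k x.2 then (Function.update x.1 k (x.1 k + 1), N.tail k) else x

/-- Push a unit of flow back along arc `k` if its reversal ends a shortest path to the current
node. -/
def traceBackward (k : ℕ) (x : (ℤ → ℤ) × α) : (ℤ → ℤ) × α :=
  if N.EnabledBackward D x.1 k x.2 then (Function.update x.1 k (x.1 k + -1), N.head k) else x

/-- A step of tracing a shortest path, with arc `k`. -/
def traceArc (k : ℕ) (x : (ℤ → ℤ) × α) : (ℤ → ℤ) × α :=
  N.traceBackward D k (N.traceForward p D k x)

/-- A round of tracing. -/
def traceAll (x : (ℤ → ℤ) × α) : (ℤ → ℤ) × α := sweep (N.traceArc p D) N.size x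

/-- The invariant of tracing a shortest path back to `s`: the flow stays complementary to the new
potential `p'`, its divergence is `w` up to one unit at the current node, and the path can be
continued. -/
structure Tracing (V : Finset α) (s : α) (p' w : α → ℤ) (x : (ℤ → ℤ) × α) : Prop where
  mem : x.2 ∈ V
  complementary : N.Complementary x.1 p'
  divergence_eq : ∀ u, N.divergence x.1 u = w u + if u = x.2 then 1 else 0
  enabled : ∀ u ∈ V, D u ≤ D x.2 → u ≠ s →
    ∃ k < N.size, N.EnabledForward p D k u ∨ N.EnabledBackward D x.1 k u

variable {N p D} {V : Finset α} {F : ℤ → ℤ} {s : α} {B : ℤ} {p' w : α → ℤ} {x : (ℤ → ℤ) × α}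
  {k : ℕ}

theorem Tracing.push (hx : N.Tracing p D V s p' w x) (hk : k < N.size) {a : ℤ} {v : α}
    (hv : v ∈ V) (hlt : D v < D x.2) (ha : 0 ≤ x.1 k + a) (htight : N.slack p' k = 0)
    (hdiv : ∀ u, a * ((if u = N.tail k then 1 else 0) - (if u = N.head k then 1 else 0)) =
      (if u = v then 1 else 0) - (if u = x.2 then 1 else 0))
    (hpos : 0 < x.1 k → D (N.tail k) ≤ D v → 0 < x.1 k + a) :
    N.Tracing p D V s p' w (Function.update x.1 k (x.1 k + a), v) := by
  have update_of_ne : ∀ i : ℕ, i ≠ k → Function.update x.1 k (x.1 k + a) (i : ℤ) = x.1 i :=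
    fun i hik => Function.update_of_ne (Nat.cast_injective.ne hik) _ _
  refine ⟨hv, ⟨fun {i} hi => ?_, fun {i} hi => ?_⟩, fun u => ?_, fun u hu hDu hus => ?_⟩
  · obtain rfl | hik := eq_or_ne i k
    · simpa using ha
    · simpa only [update_of_ne i hik] using hx.complementary.nonneg hi
  · obtain rfl | hik := eq_or_ne i k
    · exact fun _ => htight
    · simpa only [update_of_ne i hik] using hx.complementary.slack_eq_zero hi
  · rw [N.divergence_update x.1 hk, hx.divergence_eq, hdiv]
    ring
  · obtain ⟨i, hi, h⟩ := hx.enabled u hu (hDu.trans hlt.le) hus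
    refine ⟨i, hi, h.imp_right fun ⟨htail, hFi, hle⟩ => ⟨htail, ?_, hle⟩⟩
    obtain rfl | hik := eq_or_ne i k
    · simpa using hpos hFi (htail ▸ hDu)
    · simpa only [update_of_ne i hik]

theorem Tracing.backward (hN : N.OnNodes V) (hx : N.Tracing p D V s p' w x) (hk : k < N.size) :
    N.Tracing p D V s p' w (N.traceBackward D k x) ∧ (D (N.traceBackward D k x).2 < D x.2 ∨
      N.traceBackward D k x = x ∧ ¬ N.EnabledBackward D x.1 k x.2) := by
  unfold traceBackward
  split
  case isFalse h => exact ⟨hx, .inr ⟨rfl, h⟩⟩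
  case isTrue h =>
    obtain ⟨hv, hpos, hle⟩ := h
    have hlt : D (N.head k) < D x.2 := by rw [← hv]; omega
    refine ⟨hx.push hk (hN.head_mem hk) hlt (by omega) (hx.complementary.slack_eq_zero hk hpos)
      (fun u => by rw [hv]; ring) fun _ h => ?_, .inl hlt⟩
    exact absurd hlt (not_lt.2 (hv ▸ h))

section

variable (hN : N.OnNodes V) (hp : N.Potential p) (hD : N.Distances F p V s B D)
include hN hp hD

theorem Tracing.eq_source (hx : N.Tracing p D V s p' w x) (h0 : D x.2 ≤ 0) : x.2 = s := by
  by_contra hs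
  obtain ⟨k, hk, ⟨h1, h2⟩ | ⟨h1, -, h2⟩⟩ := hx.enabled _ hx.mem le_rfl hs
  · have := hD.nonneg _ (hN.tail_mem hk)
    have := hp.arcLength_pos hk
    rw [h1] at h2
    omega
  · have := hD.nonneg _ (hN.head_mem hk)
    rw [h1] at h2
    omega

variable (hp' : ∀ u ∈ V, p' u = p u + D u / N.size)
include hp'

theorem Tracing.forward (hx : N.Tracing p D V s p' w x) (hk : k < N.size) :
    N.Tracing p D V s p' w (N.traceForward p D k x) ∧ (D (N.traceForward p D k x).2 < D x.2 ∨
      N.traceForward p D k x = x ∧ ¬ N.EnabledForward p D k x.2) := by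
  unfold traceForward
  split
  case isFalse h => exact ⟨hx, .inr ⟨rfl, h⟩⟩
  case isTrue h =>
    obtain ⟨hv, hle⟩ := h
    have hlt : D (N.tail k) < D x.2 := by
      have := hp.arcLength_pos hk
      rw [← hv]
      omega
    have tight : N.slack p' k = 0 := by
      have := ediv_eq_of_eq (hD.emod_lt _ (hN.tail_mem hk)) (by omega)
        (le_antisymm (hD.arc_le _ _ _ ⟨k, hk, .inl ⟨rfl, rfl, rfl⟩⟩) hle)
      rw [hN.slack_add hp' hk, this]
      ring
    have := hx.complementary.nonneg hk
    exact ⟨hx.push hk (hN.tail_mem hk) hlt (by omega) tight (fun u => by rw [hv]; ring)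
      (by omega), .inl hlt⟩

theorem Tracing.arc (hx : N.Tracing p D V s p' w x) (hk : k < N.size) :
    N.Tracing p D V s p' w (N.traceArc p D k x) ∧ (D (N.traceArc p D k x).2 < D x.2 ∨
      N.traceArc p D k x = x ∧ ¬ N.EnabledForward p D k x.2 ∧ ¬ N.EnabledBackward D x.1 k x.2) := by
  obtain ⟨tracing, progress⟩ := hx.forward hN hp hD hp' hk
  obtain ⟨tracing', progress'⟩ := tracing.backward hN hk
  exact ⟨tracing', progress_trans (f := fun x : (ℤ → ℤ) × α => D x.2)
        (P := fun x => ¬ N.EnabledForward p D k x.2)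
    (Q := fun x => ¬ N.EnabledBackward D x.1 k x.2) progress progress'⟩

theorem Tracing.all (hx : N.Tracing p D V s p' w x) :
    N.Tracing p D V s p' w (N.traceAll p D x) ∧
      (D (N.traceAll p D x).2 < D x.2 ∨ N.traceAll p D x = x ∧ x.2 = s) := by
  have sweep_spec : ∀ m ≤ N.size, N.Tracing p D V s p' w (sweep (N.traceArc p D) m x) ∧
      (D (sweep (N.traceArc p D) m x).2 < D x.2 ∨ sweep (N.traceArc p D) m x = x ∧
        ∀ k < m, ¬ N.EnabledForward p D k x.2 ∧ ¬ N.EnabledBackward D x.1 k x.2) := by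
    intro m hm
    induction m with
    | zero => exact ⟨hx, .inr ⟨rfl, fun k hk => absurd hk k.not_lt_zero⟩⟩
    | succ m ih =>
      obtain ⟨tracing, progress⟩ := ih (by omega)
      obtain ⟨tracing', progress'⟩ := tracing.arc hN hp hD hp' hm
      refine ⟨tracing', (progress_trans (f := fun x : (ℤ → ℤ) × α => D x.2)
        (P := fun x => ∀ k < m, ¬ N.EnabledForward p D k x.2 ∧
        ¬ N.EnabledBackward D x.1 k x.2) (Q := fun x => ¬ N.EnabledForward p D m x.2 ∧
        ¬ N.EnabledBackward D x.1 m x.2) progress progress').imp_right fun ⟨h, hlt, hm⟩ =>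
        ⟨h, fun k hk => ?_⟩⟩
      rcases Nat.lt_succ_iff_lt_or_eq.1 hk with hk | rfl
      exacts [hlt k hk, hm]
  obtain ⟨tracing, progress⟩ := sweep_spec N.size le_rfl
  refine ⟨tracing, progress.imp_right fun ⟨h, hnot⟩ => ⟨h, ?_⟩⟩
  by_contra hs
  obtain ⟨k, hk, hE⟩ := hx.enabled _ hx.mem le_rfl hs
  exact hE.elim (hnot k hk).1 (hnot k hk).2

theorem Tracing.iterate (hx : N.Tracing p D V s p' w x) :
    N.Tracing p D V s p' w ((N.traceAll p D)^[N.size] x) ∧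
      ((N.traceAll p D)^[N.size] x).2 = s := by
  have iterate_spec : ∀ i, N.Tracing p D V s p' w ((N.traceAll p D)^[i] x) ∧
      (((N.traceAll p D)^[i] x).2 = s ∨ rank V D ((N.traceAll p D)^[i] x).2 + i ≤ V.card) := by
    intro i
    induction i with
    | zero => exact ⟨hx, .inr (rank_lt_card hx.mem).le⟩
    | succ i ih =>
      obtain ⟨tracing, ih⟩ := ih
      simp only [Function.iterate_succ_apply']
      obtain ⟨tracing', hlt | ⟨h, hs⟩⟩ := tracing.all hN hp hD hp'
      · refine ⟨tracing', ih.imp (fun hs => ?_) fun hrank => ?_⟩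
        · refine tracing'.eq_source hN hp hD (hlt.le.trans ?_)
          rw [hs, hD.source]
        · have := rank_lt_rank tracing'.mem hlt
          omega
      · exact ⟨tracing', .inl (by rw [h, hs])⟩
  obtain ⟨tracing, hs | hrank⟩ := iterate_spec N.size
  · exact ⟨tracing, hs⟩
  · exact absurd hN.card_lt (by omega)

omit hp in
theorem Distances.tracing {k₀ : ℕ} (hk₀ : k₀ < N.size) (htail : N.tail k₀ = s)
    (hB : N.slack p k₀ < B) (hF : N.Complementary F p) :
    N.Tracing p D V s p' (fun u => N.divergence F u - if u = N.head k₀ then 1 else 0)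
      (F, N.head k₀) := by
  refine ⟨hN.head_mem hk₀, hD.complementary_add hN hp' hF, fun u => by simp, ?_⟩
  intro u hu hDu hus
  rcases hD.attained u hu hus with h | ⟨t, ℓ, ⟨k, hk, ⟨rfl, rfl, rfl⟩ | ⟨hf, rfl, rfl, rfl⟩⟩, h⟩
  · have head_le := hD.arc_le _ _ _ ⟨k₀, hk₀, .inl ⟨rfl, rfl, rfl⟩⟩
    rw [htail, hD.source, arcLength] at head_le
    simp only [h] at hDu
    have : 1 < N.size := lt_of_le_of_lt (Finset.card_pos.2 ⟨u, hu⟩) hN.card_lt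
    nlinarith
  · exact ⟨k, hk, .inl ⟨rfl, h.ge⟩⟩
  · exact ⟨k, hk, .inr ⟨rfl, hf, h.ge⟩⟩

/-- Augmenting the flow along a shortest path and adding the distances to the potential keeps them
complementary. -/
theorem Distances.augment {k₀ : ℕ} (hk₀ : k₀ < N.size) (htail : N.tail k₀ = s)
    (hB : N.slack p k₀ < B) (hF : N.Complementary F p) {F' : ℤ → ℤ} {v : α}
    (hF' : (N.traceAll p D)^[N.size] (F, N.head k₀) = (F', v)) :
    N.Complementary F' p' ∧ ∀ u, N.divergence F' u =
      N.divergence F u + (if u = s then 1 else 0) - (if u = N.head k₀ then 1 else 0) := by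
  obtain ⟨tracing, hs⟩ := (hD.tracing hN hp' hk₀ htail hB hF).iterate hN hp hD hp'
  rw [hF'] at tracing hs
  refine ⟨tracing.complementary, fun u => ?_⟩
  rw [tracing.divergence_eq, hs]
  ring

end

end Network

/-! ## Rounding -/

namespace Network

variable {α : Type*} {N : Network α} {V : Finset α} {F : ℤ → ℤ} {X : α → ℤ} {s : α}
  {D : α → ℤ}

/-- An induction principle for the nodes that are reached from `s` along tight arcs. -/
theorem Distances.reach_induction (hD : N.Distances F X V s 1 D) (hN : N.OnNodes V)
    (hX : N.Potential X) (hF : ∀ k : ℕ, k < N.size → F k = 0) {Q : α → Prop} (source : Q s)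
    (arc : ∀ k : ℕ, k < N.size → N.slack X k = 0 → Q (N.tail k) → Q (N.head k))
    {u : α} (hu : u ∈ V) (hDu : D u < N.size) : Q u := by
  induction hr : (D u).toNat using Nat.strong_induction_on generalizing u with
  | _ r ih =>
    by_cases hus : u = s
    · exact hus ▸ source
    rcases hD.attained u hu hus with h | ⟨t, ℓ, ⟨k, hk, ⟨rfl, rfl, rfl⟩ | ⟨hf, -⟩⟩, h⟩
    · omega
    · have htail := hN.tail_mem hk
      have hD0 := hD.nonneg _ htail
      have hlen := hX.arcLength_pos hk
      have tight : N.slack X k = 0 := by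
        by_contra hne
        have hslack : 1 ≤ N.slack X k := by
          have := hX hk
          omega
        unfold arcLength at h
        nlinarith
      exact arc k hk tight (ih _ (by omega) htail (by omega) rfl)
    · exact absurd hf (hF k hk).le.not_gt

theorem Distances.ediv_eq (hD : N.Distances F X V s 1 D) (hN : N.OnNodes V) {u : α}
    (hu : u ∈ V) : D u < N.size ∧ D u / N.size = 0 ∨ D u = N.size ∧ D u / N.size = 1 := by
  have hle := hD.le u hu
  rw [mul_one] at hle
  rcases hle.eq_or_lt with h | h
  · have := hN.card_lt
    exact .inr ⟨h, by rw [h]; exact Int.ediv_self (by omega)⟩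
  · exact .inl ⟨h, Int.ediv_eq_zero_of_lt (hD.nonneg u hu) h⟩

variable [InvolutiveNeg α]

/-- The nodes are closed under negation, and the arcs under the symmetry
`(t, h) ↦ (-h, -t)`. -/
structure Symmetric (N : Network α) (V : Finset α) : Prop where
  neg_mem : ∀ u ∈ V, -u ∈ V
  mirror : ∀ k : ℕ, k < N.size → ∃ k' : ℕ, k' < N.size ∧
    N.tail k' = -N.head k ∧ N.head k' = -N.tail k ∧ N.cost k' = N.cost k

/-- If some odd potential `z` lies below `X` at `s`, then it does at all nodes reached from `s`,
so that `-s` is not among them. -/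
theorem Distances.le_neg_source (hD : N.Distances F X V s 1 D) (hN : N.OnNodes V)
    (hX : N.Potential X) (hF : ∀ k : ℕ, k < N.size → F k = 0) (hs : -s ∈ V) {z : α → ℤ}
    (hz : N.Potential z) (hzneg : z (-s) = -z s) (hXneg : X (-s) = -X s) (hzs : z s < X s) :
    N.size ≤ D (-s) := by
  by_contra hlt
  have := hD.reach_induction hN hX hF (Q := fun u => z u < X u) hzs
    (fun k hk h1 h2 => by
      have := hz hk
      unfold slack at *
      omega)
    hs (not_le.1 hlt)
  rw [hzneg, hXneg] at this
  omega

section Round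

variable (hD : N.Distances F X V s 1 D) (hN : N.OnNodes V) (hsym : N.Symmetric V)
  (hcost : ∀ k : ℕ, k < N.size → Even (N.cost k)) (hX : N.Potential X)
  (hXneg : ∀ u ∈ V, X (-u) = -X u) (hF : ∀ k : ℕ, k < N.size → F k = 0) (hs : s ∈ V)
  (hodd : Odd (X s)) (hDs : N.size ≤ D (-s))

section

include hD hN hcost hX hF hodd

omit [InvolutiveNeg α] in
theorem Distances.odd_of_lt {u : α} (hu : u ∈ V) (hDu : D u < N.size) : Odd (X u) := by
  refine hD.reach_induction hN hX hF (Q := fun u => Odd (X u)) hodd (fun k hk tight htail => ?_)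
    hu hDu
  rw [show X (N.head k) = X (N.tail k) - N.cost k by unfold slack at tight; omega]
  exact htail.sub_even (hcost k hk)

end

section

include hD hN hsym hXneg

theorem Distances.ediv_neg_tail_le {k : ℕ} (hk : k < N.size) :
    D (-N.tail k) / N.size ≤ D (-N.head k) / N.size + N.slack X k := by
  obtain ⟨k', hk', htail, hhead, hcost⟩ := hsym.mirror k hk
  have := hD.ediv_head_le hN hk'
  rw [slack, htail, hhead, hcost, hXneg _ (hN.head_mem hk), hXneg _ (hN.tail_mem hk)] at this
  unfold slack
  linarith

include hX hF hDs

theorem Distances.le_neg_of_lt {u : α} (hu : u ∈ V) (hDu : D u < N.size) : N.size ≤ D (-u) := by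
  refine hD.reach_induction hN hX hF (Q := fun u => N.size ≤ D (-u)) hDs
    (fun k hk tight htail => ?_) hu hDu
  have mirror_le := hD.ediv_neg_tail_le hN hsym hXneg hk
  rw [tight] at mirror_le
  rcases hD.ediv_eq hN (hsym.neg_mem _ (hN.tail_mem hk)) with h | h <;>
    rcases hD.ediv_eq hN (hsym.neg_mem _ (hN.head_mem hk)) with h' | h' <;> omega

end

variable {X' : α → ℤ} (hX' : ∀ u ∈ V, X' u = X u + (D u / N.size - D (-u) / N.size))

section

include hXneg hsym hX'

theorem Symmetric.neg_round {u : α} (hu : u ∈ V) : X' (-u) = -X' u := by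
  rw [hX' _ hu, hX' _ (hsym.neg_mem u hu), hXneg u hu, neg_neg]
  ring

end

section

include hD hN hsym hs hodd hDs hX'

theorem Distances.even_round : Even (X' s) := by
  rw [hX' s hs, hD.source]
  rcases hD.ediv_eq hN (hsym.neg_mem s hs) with h | h
  · omega
  · rw [h.2, Int.zero_ediv]
    exact hodd.add_odd (by decide)

end

include hD hN hsym hcost hX hXneg hF hodd hX'

theorem Distances.round_eq_or (hDs : N.size ≤ D (-s)) {u : α} (hu : u ∈ V) :
    X' u = X u ∨ Odd (X u) ∧ (X' u = X u + 1 ∨ X' u = X u - 1) := by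
  have hneg := hsym.neg_mem u hu
  rw [hX' u hu]
  rcases hD.ediv_eq hN hu with hl | hl <;> rcases hD.ediv_eq hN hneg with hr | hr
  · exact absurd hr.1 (hD.le_neg_of_lt hN hsym hX hXneg hF hDs hu hl.1).not_gt
  · exact .inr ⟨hD.odd_of_lt hN hcost hX hF hodd hu hl.1, .inr (by omega)⟩
  · have := hD.odd_of_lt hN hcost hX hF hodd hneg hr.1
    rw [hXneg u hu, odd_neg] at this
    exact .inr ⟨this, .inl (by omega)⟩
  · exact .inl (by omega)

/-- Rounding can lower a slack by `2` only if `t` and `-h` are both reached. Then both ends have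
odd values, and the slack is even, so that it is not `1`. -/
theorem Distances.potential_round : N.Potential X' := by
  intro k hk
  have htail := hN.tail_mem hk
  have hhead := hN.head_mem hk
  have head_le := hD.ediv_head_le hN hk
  have mirror_le := hD.ediv_neg_tail_le hN hsym hXneg hk
  have hslack := hX hk
  have slack_ne_one : D (N.tail k) < N.size → D (-N.head k) < N.size → N.slack X k ≠ 1 := by
    intro hl hr
    obtain ⟨a, ha⟩ := hD.odd_of_lt hN hcost hX hF hodd htail hl
    obtain ⟨b, hb⟩ := hD.odd_of_lt hN hcost hX hF hodd (hsym.neg_mem _ hhead) hr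
    obtain ⟨c, hc⟩ := hcost k hk
    rw [hXneg _ hhead] at hb
    unfold slack
    omega
  rw [hN.slack_add hX' hk]
  rcases hD.ediv_eq hN htail with h₁ | h₁ <;> rcases hD.ediv_eq hN hhead with h₂ | h₂ <;>
    rcases hD.ediv_eq hN (hsym.neg_mem _ htail) with h₃ | h₃ <;>
    rcases hD.ediv_eq hN (hsym.neg_mem _ hhead) with h₄ | h₄ <;> omega

end Round

end Network

/-! ## Nodes and odd functions -/

/-- The nodes `j` and `-j`, which stand for `x j` and `-x j`, and the node `0`, which stands for
the constant `0`. -/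
noncomputable def nodes (n : ℕ) : Finset ℤ := Finset.Icc (-n) n

theorem mem_nodes {n : ℕ} {u : ℤ} : u ∈ nodes n ↔ -n ≤ u ∧ u ≤ n := Finset.mem_Icc

theorem neg_mem_nodes {n : ℕ} {u : ℤ} (hu : u ∈ nodes n) : -u ∈ nodes n := by
  rw [mem_nodes] at *
  omega

theorem card_nodes (n : ℕ) : (nodes n).card = 2 * n + 1 := by
  rw [nodes, Int.card_Icc]
  omega

/-- The odd extension of a function on the positive integers. -/
def oddExt (a : ℤ → ℤ) (u : ℤ) : ℤ := if 0 < u then a u else if u < 0 then -a (-u) else 0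

theorem oddExt_of_pos (a : ℤ → ℤ) {u : ℤ} (h : 0 < u) : oddExt a u = a u := if_pos h

@[simp] theorem oddExt_zero (a : ℤ → ℤ) : oddExt a 0 = 0 := by simp [oddExt]

theorem oddExt_neg (a : ℤ → ℤ) (u : ℤ) : oddExt a (-u) = -oddExt a u := by
  unfold oddExt
  rcases lt_trichotomy u 0 with h | rfl | h
  · simp [h, h.not_gt]
  · simp
  · simp [h, h.not_gt]

theorem oddExt_congr {a b : ℤ → ℤ} (h : ∀ u, 0 < u → a u = b u) : oddExt a = oddExt b := by
  funext u
  unfold oddExt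
  split_ifs with hpos hneg
  exacts [h u hpos, by rw [h (-u) (by omega)], rfl]

theorem oddExt_two_mul (a : ℤ → ℤ) (u : ℤ) :
    oddExt (fun u => 2 * a u) u = 2 * oddExt a u := by
  unfold oddExt
  split_ifs <;> ring

theorem oddExt_add_single (a : ℤ → ℤ) {s : ℤ} (hs : 0 < s) (u : ℤ) :
    oddExt (fun u => a u + if u = s then 1 else 0) u =
      oddExt a u + (if u = s then 1 else 0) - (if u = -s then 1 else 0) := by
  simp only [oddExt]
  split_ifs <;> omega

theorem sum_oddExt_mul (a p : ℤ → ℤ) (n : ℕ) : ∑ u ∈ nodes n, oddExt a u * p u =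
    ∑ j ∈ Finset.range n, a (j + 1) * (p (j + 1) - p (-(j + 1))) := by
  induction n with
  | zero => simp [nodes, oddExt]
  | succ n ih =>
    have nodes_succ :
        nodes (n + 1) = insert ((n : ℤ) + 1) (insert (-((n : ℤ) + 1)) (nodes n)) := by
      ext u
      simp only [Finset.mem_insert, mem_nodes]
      push_cast
      omega
    have neg_notMem : -((n : ℤ) + 1) ∉ nodes n := by
      rw [mem_nodes]
      omega
    have notMem : (n : ℤ) + 1 ∉ insert (-((n : ℤ) + 1)) (nodes n) := by
      rw [Finset.mem_insert, mem_nodes]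
      omega
    rw [nodes_succ, Finset.sum_insert notMem, Finset.sum_insert neg_notMem, ih,
      Finset.sum_range_succ, oddExt_neg, oddExt_of_pos _ (by omega)]
    ring

theorem sweep_const {α : Type*} (g : α → α) (n : ℕ) (x : α) :
    sweep (fun _ => g) n x = g^[n] x := by
  induction n with
  | zero => rfl
  | succ n ih => rw [Function.iterate_succ_apply', sweep, ih]

theorem sweep_update (φ : ℤ → ℤ → ℤ) (c : ℤ) (m : ℕ) (g : ℤ → ℤ) (u : ℤ) :
    sweep (fun k g => Function.update g (k - c) (φ (k - c) (g (k - c)))) m g u =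
      if -c ≤ u ∧ u < m - c then φ u (g u) else g u := by
  induction m generalizing u with
  | zero =>
    rw [if_neg (by push_cast; omega)]
    rfl
  | succ m ih =>
    simp only [sweep]
    by_cases hu : u = m - c
    · subst hu
      rw [Function.update_self, ih, if_neg (by omega), if_pos (by push_cast; omega)]
    · rw [Function.update_of_ne hu, ih]
      refine if_congr ?_ rfl rfl
      push_cast
      omega

end UTVPI

namespace RAM.Cmd

open UTVPI (sweep sweep_const sweep_update)

/-! ## Reasoning about loops -/

theorem run_skip (S : ℕ) (M : Mem) : Cmd.skip.run S M = M := rfl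

theorem run_write (S : ℕ) (a : ℕ) (i e : Expr) (M : Mem) :
    (Cmd.write a i e).run S M = M.store a (i.val M) (e.val M) := rfl

theorem run_seq (S : ℕ) (c d : Cmd) (M : Mem) :
    (Cmd.seq c d).run S M = d.run S (c.run S M) := rfl

theorem run_ite (S : ℕ) (e : Expr) (c d : Cmd) (M : Mem) :
    (Cmd.ite e c d).run S M = if 0 < e.val M then c.run S M else d.run S M := rfl

theorem rounds_frame (S : ℕ) {a b : ℕ} {c : Cmd} (hb : b ∉ a :: c.writes) (M : Mem) (n : ℕ) :
    rounds a (c.run S) M n b = M b := by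
  rw [List.mem_cons, not_or] at hb
  induction n with
  | zero => exact M.store_of_ne hb.1 _ _
  | succ k ih => exact (Mem.store_of_ne _ hb.1 _ _).trans ((run_frame S c hb.2 _).trans ih)

variable {S : ℕ} {a : ℕ} {c : Cmd} {M : Mem}

theorem run_rep_induction {I : ℕ → Mem → Prop} (zero : I 0 (M.store a 0 0))
    (succ : ∀ k < S, ∀ N : Mem, (∀ b ∉ a :: c.writes, N b = M b) → N a 0 = k → I k N →
      I (k + 1) ((c.run S N).store a 0 (k + 1))) :
    I S ((Cmd.rep a c).run S M) := by
  suffices ∀ n ≤ S, I n (rounds a (c.run S) M n) from this S le_rfl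
  intro n
  induction n with
  | zero => exact fun _ => zero
  | succ k ih =>
    exact fun hk => succ k hk _ (fun b hb => rounds_frame S hb M k) (rounds_counter a _ M k)
      (ih (by omega))

variable {α : Type*} {π : Mem → α} {f : ℕ → α → α}

theorem run_rep_sweep (hπ : ∀ N v, π (Mem.store N a 0 v) = π N)
    (step : ∀ k < S, ∀ N : Mem, (∀ b ∉ a :: c.writes, N b = M b) → N a 0 = k →
      π (c.run S N) = f k (π N)) :
    π ((Cmd.rep a c).run S M) = sweep f S (π M) := by
  refine run_rep_induction (I := fun k N => π N = sweep f k (π M)) (hπ _ _) ?_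
  intro k hk N hN hNa ih
  rw [hπ, step k hk N hN hNa, ih, sweep]

theorem run_rep_rep_sweep {a' : ℕ} (hπ : ∀ N v, π (Mem.store N a 0 v) = π N)
    (hπ' : ∀ N v, π (Mem.store N a' 0 v) = π N)
    (step : ∀ k < S, ∀ N : Mem, (∀ b ∉ a' :: a :: c.writes, N b = M b) → N a 0 = k →
      π (c.run S N) = f k (π N)) :
    π ((Cmd.rep a' (.rep a c)).run S M) = (sweep f S)^[S] (π M) := by
  rw [← sweep_const]
  refine run_rep_sweep hπ' fun _ _ N hN _ => run_rep_sweep hπ fun k hk N' hN' hk' => ?_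
  refine step k hk N' (fun b hb => ?_) hk'
  rw [hN' b (List.not_mem_of_not_mem_cons hb), hN b hb]

theorem run_rep_map {d : ℕ} (hda : d ≠ a) (b : ℤ) (φ : ℤ → ℤ → ℤ)
    (step : ∀ k < S, ∀ N : Mem, (∀ x ∉ a :: c.writes, N x = M x) → N a 0 = k →
      c.run S N d = Function.update (N d) (k - b) (φ (k - b) (N d (k - b)))) (u : ℤ) :
    (Cmd.rep a c).run S M d u = if -b ≤ u ∧ u < S - b then φ u (M d u) else M d u := by
  rw [run_rep_sweep (π := fun N => N d)
    (f := fun k g => Function.update g (k - b) (φ (k - b) (g (k - b))))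
    (fun N v => N.store_of_ne hda 0 v) step, sweep_update]

end RAM.Cmd

namespace UTVPI

open RAM RAM.Cmd

/-! ## Minimum-cost flow commands -/

/- Names of arrays. The machine fixes the roles of the arrays `0` to `3`, and cell `0` of array `4`
is the loop bound; the names with `c` belong to loop counters. -/
notation "aIn" => (0 : ℕ)
notation "aInLen" => (1 : ℕ)
notation "aOut" => (2 : ℕ)
notation "aOutLen" => (3 : ℕ)
notation "aSize" => (4 : ℕ)
notation "aPos" => (5 : ℕ)
notation "aRest" => (6 : ℕ)
notation "aN" => (7 : ℕ)
notation "aM" => (8 : ℕ)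
notation "aPtr" => (9 : ℕ)
notation "aTail" => (10 : ℕ)
notation "aHead" => (11 : ℕ)
notation "aCost" => (12 : ℕ)
notation "aFlow" => (13 : ℕ)
notation "aPot" => (14 : ℕ)
notation "aDist" => (15 : ℕ)
notation "aCount" => (16 : ℕ)
notation "aWeight" => (17 : ℕ)
notation "aSrc" => (18 : ℕ)
notation "aBound" => (19 : ℕ)
notation "aCur" => (20 : ℕ)
notation "aLit" => (21 : ℕ)
notation "aPrev" => (22 : ℕ)
notation "aAcc" => (24 : ℕ)
notation "aMul" => (25 : ℕ)
notation "aBits" => (26 : ℕ)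
notation "aPow" => (27 : ℕ)
notation "aFlag" => (28 : ℕ)
notation "cBit" => (30 : ℕ)
notation "cVar" => (31 : ℕ)
notation "cRound" => (32 : ℕ)
notation "cArc" => (33 : ℕ)
notation "cMap" => (34 : ℕ)

notation "rd" => Expr.read

infixr:60 ";;" => Cmd.seq

/-- The memory `M` holds the network `N` on the nodes `nodes n`, with the size of `N` as loop
bound. -/
structure Holds (N : Network ℤ) (n : ℕ) (M : Mem) : Prop where
  size : M aSize 0 = N.size
  vars : M aN 0 = n
  tail : M aTail = N.tail
  head : M aHead = N.head
  cost : M aCost = N.cost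

section Holds

variable {N : Network ℤ} {n : ℕ} {M M' : Mem}

theorem Holds.of_frame (hM : Holds N n M) {l : List ℕ}
    (hl : ∀ a ∈ [aSize, aN, aTail, aHead, aCost], a ∉ l) (h : ∀ b ∉ l, M' b = M b) :
    Holds N n M' := by
  simp only [List.forall_mem_cons] at hl
  obtain ⟨hsize, hvars, htail, hhead, hcost, -⟩ := hl
  exact ⟨h _ hsize ▸ hM.size, h _ hvars ▸ hM.vars, h _ htail ▸ hM.tail, h _ hhead ▸ hM.head,
    h _ hcost ▸ hM.cost⟩

theorem Holds.run (hM : Holds N n M) {c : Cmd}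
    (hc : ∀ a ∈ [aSize, aN, aTail, aHead, aCost], a ∉ c.writes) (S : ℕ) :
    Holds N n (c.run S M) :=
  hM.of_frame hc fun _ hb => run_frame S c hb M

theorem Holds.store (hM : Holds N n M) {a : ℕ} (ha : a ∉ [aSize, aN, aTail, aHead, aCost])
    (i v : ℤ) : Holds N n (M.store a i v) := by
  refine hM.of_frame (l := [a]) (fun b hb hba => ?_) fun b hb =>
    M.store_of_ne (List.ne_of_not_mem_cons hb) i v
  exact ha (List.mem_singleton.1 hba ▸ hb)

end Holds

/-- The tail of the current arc. -/
def tailE : Expr := rd aTail (var cArc)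

/-- The head of the current arc. -/
def headE : Expr := rd aHead (var cArc)

/-- The length of the current arc. -/
def lengthE : Expr := scale (rd aPot tailE - rd aPot headE - rd aCost (var cArc)) + 1

/-- The current node in a loop over all nodes. -/
def nodeE : Expr := var cMap - var aN

/-- Relax an arc. -/
def relaxToCmd (t h l : Expr) : Cmd :=
  .ite (rd aDist h - (rd aDist t + l)) (.write aDist h (rd aDist t + l)) .skip

/-- Relax the current arc and its reversal. -/
def relaxCmd : Cmd :=
  relaxToCmd tailE headE lengthE ;;
  .ite (rd aFlow (var cArc)) (relaxToCmd headE tailE 1) .skip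

/-- Compute the distances from the source. -/
def distCmd : Cmd :=
  .rep cMap (.write aDist nodeE (scale (var aBound))) ;;
  .write aDist (var aSrc) 0 ;;
  .rep cRound (.rep cArc relaxCmd)

/-- Run `c` if two expressions are equal. -/
def ifEq (e f : Expr) (c : Cmd) : Cmd := .ite (e - f) .skip (.ite (f - e) .skip c)

/-- A step of tracing a shortest path along the current arc. -/
def traceForwardCmd : Cmd :=
  ifEq headE (var aCur) (.ite (rd aDist tailE + lengthE - rd aDist headE) .skip
    (.write aFlow (var cArc) (rd aFlow (var cArc) + 1) ;; .write aCur 0 tailE))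

/-- A step of tracing a shortest path along the reversal of the current arc. -/
def traceBackwardCmd : Cmd :=
  ifEq tailE (var aCur) (.ite (rd aFlow (var cArc))
    (.ite (rd aDist headE + 1 - rd aDist tailE) .skip
      (.write aFlow (var cArc) (rd aFlow (var cArc) - 1) ;; .write aCur 0 headE)) .skip)

/-- Augment the flow along a shortest path to the negative of the source. -/
def traceCmd : Cmd :=
  .write aCur 0 (0 - var aSrc) ;; .rep cRound (.rep cArc (traceForwardCmd ;; traceBackwardCmd))

/-- Add the distances to the potential. -/
def addDistCmd : Cmd :=
  .rep cMap (.write aPot nodeE (rd aPot nodeE + rd aDist nodeE / sizeVar))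

/-- Send a unit of flow from the source to its negative. -/
def augmentCmd : Cmd := distCmd ;; traceCmd ;; addDistCmd

theorem run_ifEq (S : ℕ) (e f : Expr) (c : Cmd) (M : Mem) :
    (ifEq e f c).run S M = if e.val M = f.val M then c.run S M else M := by
  simp only [ifEq, run_ite, run_skip, Expr.val_sub, sub_pos]
  split_ifs <;> first | rfl | omega

theorem run_relaxToCmd (S : ℕ) (M : Mem) (t h l : Expr) :
    (relaxToCmd t h l).run S M aDist = relax (M aDist) (t.val M) (h.val M) (l.val M) := by
  rw [relaxToCmd, run_ite, run_write, run_skip, apply_ite (fun M : Mem => M aDist),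
    Mem.store_self]
  exact if_congr sub_pos rfl rfl

/-- A flow of divergence `w` and a potential that are optimal for each other. -/
structure Network.Solves (N : Network ℤ) (w F p : ℤ → ℤ) : Prop where
  potential : N.Potential p
  complementary : N.Complementary F p
  divergence_eq : ∀ u, N.divergence F u = w u

section Run

variable {N : Network ℤ} {n : ℕ} {M : Mem} (hM : Holds N n M)

include hM

theorem Holds.val_tailE {k : ℕ} (hk : M cArc 0 = k) : tailE.val M = N.tail k := by
  rw [tailE, Expr.val_read, Expr.val_var, hk, hM.tail]

theorem Holds.val_headE {k : ℕ} (hk : M cArc 0 = k) : headE.val M = N.head k := by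
  rw [headE, Expr.val_read, Expr.val_var, hk, hM.head]

theorem Holds.val_lengthE {k : ℕ} (hk : M cArc 0 = k) :
    lengthE.val M = N.arcLength (M aPot) k := by
  simp only [lengthE, Expr.val_add, Expr.val_sub, Expr.val_scale, Expr.val_read, Expr.val_var,
    Expr.val_one, hM.val_tailE hk, hM.val_headE hk, hk, hM.size, hM.cost, Network.arcLength,
    Network.slack]

theorem Holds.run_relaxCmd {k : ℕ} (hk : M cArc 0 = k) :
    relaxCmd.run N.size M aDist = N.relaxArc (M aFlow) (M aPot) k (M aDist) := by
  set M₁ := (relaxToCmd tailE headE lengthE).run N.size M with hM₁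
  have frame : ∀ b ∉ [aDist], M₁ b = M b := fun b hb =>
    run_frame _ (relaxToCmd _ _ _) (by simpa [relaxToCmd, writes] using hb) _
  have holds₁ : Holds N n M₁ := hM.run (by decide) _
  have hk₁ : M₁ cArc 0 = k := by rw [frame cArc (by decide), hk]
  have forward : M₁ aDist = relax (M aDist) (N.tail k) (N.head k) (N.arcLength (M aPot) k) := by
    rw [hM₁, run_relaxToCmd, hM.val_tailE hk, hM.val_headE hk, hM.val_lengthE hk]
  rw [relaxCmd, run_seq, ← hM₁, run_ite, run_skip, apply_ite (fun M : Mem => M aDist),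
    run_relaxToCmd, holds₁.val_tailE hk₁, holds₁.val_headE hk₁, forward, Expr.val_read,
    Expr.val_var, hk₁, frame aFlow (by decide), Expr.val_one, Network.relaxArc]

theorem Holds.run_distCmd (hN : N.OnNodes (nodes n)) : ∃ D₀ : ℤ → ℤ,
    (∀ u ∈ nodes n, D₀ u = if u = M aSrc 0 then 0 else N.size * M aBound 0) ∧
    distCmd.run N.size M aDist = (N.relaxAll (M aFlow) (M aPot))^[N.size] D₀ := by
  set M₁ := (Cmd.rep cMap (.write aDist nodeE (scale (var aBound)))).run N.size M with hM₁
  have frame : ∀ b ∉ [cMap, aDist], M₁ b = M b := fun b hb => run_frame _ _ hb _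
  have fill : ∀ u ∈ nodes n, M₁ aDist u = N.size * M aBound 0 := fun u hu => by
    have := card_nodes n ▸ hN.card_lt
    rw [mem_nodes] at hu
    rw [hM₁, run_rep_map (by decide) n fun _ _ => N.size * M aBound 0, if_pos (by omega)]
    intro k _ M' hM' hk'
    have := hM.of_frame (by decide) hM'
    rw [run_write, Mem.store_self, nodeE, Expr.val_sub, Expr.val_scale, Expr.val_var, Expr.val_var,
      Expr.val_var, hk', this.size, this.vars, hM' aBound (by decide)]
  have relaxed := run_rep_rep_sweep (S := N.size) (a' := cRound) (a := cArc) (c := relaxCmd)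
    (M := M₁.store aDist (M aSrc 0) 0) (π := fun M => M aDist)
    (f := N.relaxArc (M aFlow) (M aPot)) (fun M v => M.store_of_ne (by decide) 0 v)
    (fun M v => M.store_of_ne (by decide) 0 v) fun k _ M' hM' hk' => by
      have := ((hM.run (by decide) _).store (by decide) _ _).of_frame (by decide) hM'
      rw [this.run_relaxCmd hk', hM' aFlow (by decide), hM' aPot (by decide)]
      simp (disch := decide) only [Mem.store_of_ne, frame]
  refine ⟨M₁.store aDist (M aSrc 0) 0 aDist, fun u hu => ?_, ?_⟩
  · rw [Mem.store_self, Function.update_apply, fill u hu]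
  · rw [distCmd, run_seq, run_seq, run_write, ← hM₁, Expr.val_var, Expr.val_zero,
      frame aSrc (by decide)]
    exact relaxed

theorem Holds.distances_distCmd (hN : N.OnNodes (nodes n)) (hp : N.Potential (M aPot))
    (hs : M aSrc 0 ∈ nodes n) (hB : 0 ≤ M aBound 0) :
    N.Distances (M aFlow) (M aPot) (nodes n) (M aSrc 0) (M aBound 0)
      (distCmd.run N.size M aDist) := by
  obtain ⟨D₀, hD₀, dist_eq⟩ := hM.run_distCmd hN
  exact dist_eq ▸ Network.distances_iterate hN hp hs hB hD₀

theorem Holds.run_traceForwardCmd {k : ℕ} (hk : M cArc 0 = k) :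
    ((traceForwardCmd.run N.size M aFlow, traceForwardCmd.run N.size M aCur 0) : (ℤ → ℤ) × ℤ) =
      N.traceForward (M aPot) (M aDist) k (M aFlow, M aCur 0) := by
  have run_eq : traceForwardCmd.run N.size M =
      if N.EnabledForward (M aPot) (M aDist) k (M aCur 0) then
        (M.store aFlow k (M aFlow k + 1)).store aCur 0 (N.tail k) else M := by
    have tail_eq : tailE.val (M.store aFlow k (M aFlow k + 1)) = N.tail k :=
      (hM.store (by decide) _ _).val_tailE (by simp (disch := decide) only [Mem.store_of_ne, hk])
    rw [traceForwardCmd, run_ifEq, hM.val_headE hk, run_ite, Expr.val_sub, Expr.val_add,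
      Expr.val_read, Expr.val_read, hM.val_headE hk, hM.val_tailE hk, hM.val_lengthE hk, run_seq,
      run_write, run_write, Expr.val_add, Expr.val_read]
    simp only [Expr.val_var, Expr.val_one, Expr.val_zero, hk, tail_eq, run_skip, sub_pos,
      Network.EnabledForward]
    split_ifs <;> grind
  rw [run_eq, Network.traceForward]
  split
  · simp (disch := decide) only [Mem.store_of_ne, Mem.store_self, Function.update_self]
  · rfl

theorem Holds.run_traceBackwardCmd {k : ℕ} (hk : M cArc 0 = k) :
    ((traceBackwardCmd.run N.size M aFlow, traceBackwardCmd.run N.size M aCur 0) : (ℤ → ℤ) × ℤ) =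
      N.traceBackward (M aDist) k (M aFlow, M aCur 0) := by
  have run_eq : traceBackwardCmd.run N.size M =
      if N.EnabledBackward (M aDist) (M aFlow) k (M aCur 0) then
        (M.store aFlow k (M aFlow k + -1)).store aCur 0 (N.head k) else M := by
    have head_eq : headE.val (M.store aFlow k (M aFlow k - 1)) = N.head k :=
      (hM.store (by decide) _ _).val_headE (by simp (disch := decide) only [Mem.store_of_ne, hk])
    rw [traceBackwardCmd, run_ifEq, hM.val_tailE hk, run_ite, run_ite, Expr.val_sub, Expr.val_add,
      Expr.val_read, Expr.val_read, Expr.val_read, hM.val_headE hk, hM.val_tailE hk, run_seq,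
      run_write, run_write, Expr.val_sub, Expr.val_read]
    simp only [Expr.val_var, Expr.val_one, Expr.val_zero, hk, head_eq, run_skip, sub_pos,
      Network.EnabledBackward]
    split_ifs <;> grind
  rw [run_eq, Network.traceBackward]
  split
  · simp (disch := decide) only [Mem.store_of_ne, Mem.store_self, Function.update_self]
  · rfl

theorem Holds.run_traceCmd :
    ((traceCmd.run N.size M aFlow, traceCmd.run N.size M aCur 0) : (ℤ → ℤ) × ℤ) =
      (N.traceAll (M aPot) (M aDist))^[N.size] (M aFlow, -M aSrc 0) := by
  set π : Mem → (ℤ → ℤ) × ℤ := fun M => (M aFlow, M aCur 0)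
  have start : (M aFlow, -M aSrc 0) = π (M.store aCur 0 (0 - M aSrc 0)) := by
    simp (disch := decide) [π, Mem.store_of_ne]
  have counter : ∀ a ∉ [aFlow, aCur], ∀ (M : Mem) v, π (M.store a 0 v) = π M := by
    intro a ha M v
    simp only [List.mem_cons, List.not_mem_nil, or_false, not_or] at ha
    simp only [π, Mem.store_of_ne M (Ne.symm ha.1), Mem.store_of_ne M (Ne.symm ha.2)]
  rw [start]
  refine run_rep_rep_sweep (π := π) (a' := cRound) (a := cArc) (counter _ (by decide))
    (counter _ (by decide)) fun k _ M' hM' hk' => ?_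
  have holds' : Holds N n M' := (hM.store (by decide) _ _).of_frame (by decide) hM'
  have forward : π (traceForwardCmd.run N.size M') = N.traceForward (M' aPot) (M' aDist) k (π M') :=
    holds'.run_traceForwardCmd hk'
  have backward : π (traceBackwardCmd.run N.size (traceForwardCmd.run N.size M')) =
      N.traceBackward (M' aDist) k (π (traceForwardCmd.run N.size M')) := by
    rw [← run_frame N.size traceForwardCmd (b := aDist) (by decide) M']
    exact (holds'.run (by decide) _).run_traceBackwardCmd (by rw [run_frame _ _ (by decide), hk'])
  rw [run_seq, backward, forward, hM' aPot (by decide), hM' aDist (by decide),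
    run_frame _ _ (by decide), run_frame _ _ (by decide), Network.traceArc]

theorem Holds.run_addDistCmd (hN : N.OnNodes (nodes n)) {u : ℤ} (hu : u ∈ nodes n) :
    addDistCmd.run N.size M aPot u = M aPot u + M aDist u / N.size := by
  have := card_nodes n ▸ hN.card_lt
  rw [mem_nodes] at hu
  rw [addDistCmd, run_rep_map (by decide) n fun u x => x + M aDist u / N.size,
    if_pos (by omega)]
  intro k _ M' hM' hk'
  have := hM.of_frame (by decide) hM'
  simp only [run_write, Mem.store_self, nodeE, Expr.val_add, Expr.val_sub, Expr.val_div,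
    Expr.val_read, Expr.val_var, Expr.val_sizeVar, hk', this.size, this.vars,
    hM' aDist (by decide)]

theorem Holds.run_augmentCmd (hN : N.OnNodes (nodes n)) {w : ℤ → ℤ}
    (hw : N.Solves w (M aFlow) (M aPot)) {k₀ : ℕ} (hk₀ : k₀ < N.size)
    (htail : N.tail k₀ = M aSrc 0) (hhead : N.head k₀ = -M aSrc 0)
    (hbound : N.slack (M aPot) k₀ < M aBound 0) :
    N.Solves (fun u => w u + (if u = M aSrc 0 then 1 else 0) - if u = -M aSrc 0 then 1 else 0)
      (augmentCmd.run N.size M aFlow) (augmentCmd.run N.size M aPot) := by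
  have source_mem : M aSrc 0 ∈ nodes n := htail ▸ hN.tail_mem hk₀
  set M₁ := distCmd.run N.size M
  set M₂ := traceCmd.run N.size M₁ with hM₂
  have frame₁ : ∀ b ∉ distCmd.writes, M₁ b = M b := fun b hb => run_frame _ _ hb _
  have frame₂ : ∀ b ∉ traceCmd.writes, M₂ b = M₁ b := fun b hb => run_frame _ _ hb _
  have holds₁ : Holds N n M₁ := hM.run (by decide) _
  have holds₂ : Holds N n M₂ := holds₁.run (by decide) _
  have trace := holds₁.run_traceCmd
  have dist : N.Distances (M aFlow) (M aPot) (nodes n) (M aSrc 0) (M aBound 0) (M₁ aDist) :=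
    hM.distances_distCmd hN hw.potential source_mem ((hw.potential hk₀).trans hbound.le)
  rw [← hM₂, frame₁ aPot (by decide), frame₁ aFlow (by decide), frame₁ aSrc (by decide),
    ← hhead] at trace
  have flow_eq : augmentCmd.run N.size M aFlow = M₂ aFlow := run_frame _ addDistCmd (by decide) _
  have pot_eq : ∀ u ∈ nodes n,
      augmentCmd.run N.size M aPot u = M aPot u + M₁ aDist u / N.size := fun u hu => by
    refine (holds₂.run_addDistCmd hN hu).trans ?_
    rw [frame₂ aPot (by decide), frame₂ aDist (by decide), frame₁ aPot (by decide)]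
  obtain ⟨complementary, divergence_eq⟩ :=
    dist.augment hN hw.potential pot_eq hk₀ htail hbound hw.complementary trace.symm
  rw [flow_eq]
  refine ⟨dist.potential_add hN pot_eq, complementary, fun u => ?_⟩
  rw [divergence_eq, hw.divergence_eq, hhead]

end Run

/-! ## Scaling of the weights -/

/-- A positive value means that `e` is odd. -/
def oddE (e : Expr) : Expr := e - (e / 2 + e / 2)

/-- Compute a first potential, with distances that are all cut off at `0`. -/
def initPotCmd : Cmd :=
  .write aSrc 0 0 ;; .write aBound 0 0 ;; distCmd ;; addDistCmd

/-- Compute `2 ^ S`. -/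
def powCmd : Cmd :=
  .write aPow 0 1 ;; .rep cMap (.write aPow 0 (var aPow + var aPow))

/-- Double the flow. -/
def doubleFlowCmd : Cmd :=
  .rep cMap (.write aFlow (var cMap) (rd aFlow (var cMap) + rd aFlow (var cMap)))

/-- Increase the weight of the current variable by one. -/
def addUnitCmd : Cmd :=
  .write aSrc 0 (var cVar + 1) ;;
  .write aBound 0 (rd aPot (var aSrc) - rd aPot (0 - var aSrc) + 1) ;; augmentCmd

/-- Increase the weights by the current bits. -/
def addBitsCmd : Cmd :=
  .rep cVar (.ite (oddE (rd aWeight (var cVar + 1) / var aPow)) addUnitCmd .skip)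

/-- Append the next bits to the weights. -/
def nextBitsCmd : Cmd := .write aPow 0 (var aPow / 2) ;; doubleFlowCmd ;; addBitsCmd

/-- Solve the linear relaxation, for the bits of the weights from the top. -/
def solveCmd : Cmd := powCmd ;; .rep cBit nextBitsCmd

theorem val_oddE_pos {M : Mem} {e : Expr} : 0 < (oddE e).val M ↔ Odd (e.val M) := by
  simp only [oddE, Expr.val_sub, Expr.val_add, Expr.val_div, Expr.val_two, Int.odd_iff]
  omega

namespace Network

variable {N : Network ℤ} {n : ℕ} {a F p : ℤ → ℤ}

theorem OnNodes.potential_congr {V : Finset ℤ} (hN : N.OnNodes V) (hp : N.Potential p)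
    {p' : ℤ → ℤ} (h : ∀ u ∈ V, p' u = p u) : N.Potential p' := fun k hk => by
  rw [slack, h _ (hN.tail_mem hk), h _ (hN.head_mem hk)]
  exact hp hk

variable (N n) in
/-- The network has the arcs of the constraints `0 ≤ x j`. -/
def HasNonnegArcs : Prop :=
  ∀ j < n, ∃ k < N.size, N.tail k = j + 1 ∧ N.head k = -(j + 1) ∧ N.cost k = 0

theorem Solves.two_mul (h : N.Solves (oddExt a) F p) {F' : ℤ → ℤ}
    (hF' : ∀ k : ℕ, k < N.size → F' k = 2 * F k) : N.Solves (oddExt fun u => 2 * a u) F' p where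
  potential := h.potential
  complementary := by
    refine ⟨fun hk => ?_, fun hk hpos => h.complementary.slack_eq_zero hk ?_⟩
    · have := h.complementary.nonneg hk
      rw [hF' _ hk]
      omega
    · rw [hF' _ hk] at hpos
      omega
  divergence_eq u := by
    rw [divergence_congr (F := 2 * F) hF', divergence_two_mul, h.divergence_eq, oddExt_two_mul]

theorem Potential.solves_zero (hp : N.Potential p) : N.Solves (oddExt 0) 0 p :=
  ⟨hp, ⟨fun _ => le_rfl, fun _ h => absurd h (lt_irrefl _)⟩, fun u => by
    simp [divergence, oddExt]⟩

end Network

/-- The weights `b` with the lowest bits of the variables after the first `j` removed. -/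
def bitsUpTo (b : ℤ → ℤ) (j : ℕ) (u : ℤ) : ℤ := if u ≤ j then b u else 2 * (b u / 2)

theorem oddExt_bitsUpTo_zero (b : ℤ → ℤ) :
    oddExt (bitsUpTo b 0) = oddExt fun u => 2 * (b u / 2) :=
  oddExt_congr fun _ hu => if_neg (by simpa using hu)

theorem bitsUpTo_succ (b : ℤ → ℤ) (j : ℕ) :
    bitsUpTo b (j + 1) =
      fun u => bitsUpTo b j u + if u = j + 1 then b (j + 1) % 2 else 0 := by
  funext u
  simp only [bitsUpTo, Nat.cast_add, Nat.cast_one]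
  split_ifs <;> first | omega | (subst u; omega)

theorem bitsUpTo_eq_self {b : ℤ → ℤ} {j : ℕ} (h : ∀ u, (j : ℤ) < u → b u = 0) :
    bitsUpTo b j = b := by
  funext u
  unfold bitsUpTo
  split_ifs with hu
  · rfl
  · rw [h u (by omega), Int.zero_ediv, mul_zero]

theorem run_powCmd (S : ℕ) (M : Mem) : powCmd.run S M aPow 0 = 2 ^ S := by
  rw [powCmd, run_seq]
  refine run_rep_induction (I := fun k N => N aPow 0 = 2 ^ k) ?_ fun k _ N _ _ ih => ?_
  · simp (disch := decide) [run_write, Mem.store_of_ne]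
  · simp (disch := decide) [run_write, Mem.store_of_ne, ih, pow_succ, mul_two]

theorem run_doubleFlowCmd (S : ℕ) (M : Mem) {k : ℕ} (hk : k < S) :
    doubleFlowCmd.run S M aFlow k = 2 * M aFlow k := by
  rw [doubleFlowCmd, run_rep_map (by decide) 0 fun _ x => 2 * x, if_pos (by omega)]
  intro i _ N _ hi
  simp [run_write, hi, two_mul]

theorem run_aPow_nextBitsCmd (S : ℕ) (M : Mem) :
    nextBitsCmd.run S M aPow 0 = M aPow 0 / 2 := by
  rw [nextBitsCmd, run_seq, run_seq, run_frame _ _ (by decide), run_frame _ _ (by decide),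
    run_write, Expr.val_zero, Mem.store_self, Function.update_self, Expr.val_div, Expr.val_var,
    Expr.val_two]

section Run

variable {N : Network ℤ} {n : ℕ} {M : Mem} (hM : Holds N n M) (hN : N.OnNodes (nodes n))

include hM hN

theorem Holds.run_initPotCmd (hF : M aFlow = 0) (hp : M aPot = 0) {z : ℤ → ℤ}
    (hz : N.Potential z) : N.Potential (initPotCmd.run N.size M aPot) := by
  set M₁ := (M.store aSrc 0 0).store aBound 0 0 with hM₁
  have holds₁ : Holds N n M₁ := (hM.store (by decide) _ _).store (by decide) _ _
  have flow₁ : M₁ aFlow = 0 := by simp (disch := decide) only [hM₁, Mem.store_of_ne, hF]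
  have pot₁ : M₁ aPot = 0 := by simp (disch := decide) only [hM₁, Mem.store_of_ne, hp]
  have bound₁ : M₁ aBound 0 = 0 := by rw [hM₁, Mem.store_self, Function.update_self]
  obtain ⟨D₀, hD₀, dist_eq⟩ := holds₁.run_distCmd hN
  simp only [bound₁, mul_zero, ite_self] at hD₀
  refine hN.potential_congr (Network.potential_ediv hN hz hD₀) fun u hu => ?_
  rw [flow₁, pot₁] at dist_eq
  refine ((holds₁.run (by decide) _).run_addDistCmd hN hu).trans ?_
  rw [dist_eq, run_frame _ _ (by decide), pot₁, Pi.zero_apply, zero_add]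

variable (hA : N.HasNonnegArcs n)

include hA

theorem Holds.run_addUnitCmd {j : ℕ} (hj : M cVar 0 = j) (hjn : j < n) {a : ℤ → ℤ}
    (ha : N.Solves (oddExt a) (M aFlow) (M aPot)) :
    N.Solves (oddExt fun u => a u + if u = j + 1 then 1 else 0)
      (addUnitCmd.run N.size M aFlow) (addUnitCmd.run N.size M aPot) := by
  set M₁ := (M.store aSrc 0 (j + 1)).store aBound 0 (M aPot (j + 1) - M aPot (-(j + 1)) + 1)
    with hM₁
  have run_eq : addUnitCmd.run N.size M = augmentCmd.run N.size M₁ := by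
    simp (disch := decide) only [addUnitCmd, run_seq, run_write, Expr.val_add, Expr.val_sub,
      Expr.val_read, Expr.val_var, Expr.val_one, Expr.val_zero, hj, Mem.store_of_ne,
      Mem.store_self, Function.update_self, hM₁, zero_sub]
  have holds₁ : Holds N n M₁ := (hM.store (by decide) _ _).store (by decide) _ _
  have frame₁ : ∀ b ∉ [aSrc, aBound], M₁ b = M b := fun b hb => by
    rw [List.mem_pair, not_or] at hb
    rw [hM₁, Mem.store_of_ne _ hb.2, M.store_of_ne hb.1]
  have src₁ : M₁ aSrc 0 = j + 1 := by
    simp (disch := decide) only [hM₁, Mem.store_of_ne, Mem.store_self, Function.update_self]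
  have bound₁ : M₁ aBound 0 = M aPot (j + 1) - M aPot (-(j + 1)) + 1 := by
    rw [hM₁, Mem.store_self, Function.update_self]
  obtain ⟨k₀, hk₀, htail, hhead, hcost⟩ := hA j hjn
  have augmented := holds₁.run_augmentCmd hN (w := oddExt a)
    (by rwa [frame₁ aFlow (by decide), frame₁ aPot (by decide)]) hk₀ (by rw [htail, src₁])
    (by rw [hhead, src₁])
    (by rw [Network.slack, htail, hhead, hcost, bound₁, frame₁ aPot (by decide)]; omega)
  rw [run_eq]
  refine ⟨augmented.potential, augmented.complementary, fun u => ?_⟩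
  rw [augmented.divergence_eq, src₁, oddExt_add_single a (by omega)]

theorem Holds.run_addBitsCmd (hW : ∀ u, (n : ℤ) < u → M aWeight u = 0)
    (hw : N.Solves (oddExt fun u => 2 * (M aWeight u / M aPow 0 / 2)) (M aFlow) (M aPot)) :
    N.Solves (oddExt fun u => M aWeight u / M aPow 0)
      (addBitsCmd.run N.size M aFlow) (addBitsCmd.run N.size M aPot) := by
  set b : ℤ → ℤ := fun u => M aWeight u / M aPow 0 with hb
  have b_eq_zero : ∀ u, (n : ℤ) < u → b u = 0 := fun u hu => by
    simp only [hb, hW u hu, Int.zero_ediv]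
  have := card_nodes n ▸ hN.card_lt
  rw [← bitsUpTo_eq_self (b := b) (j := N.size) fun u hu => b_eq_zero u (by omega)]
  refine run_rep_induction
    (I := fun j M' => N.Solves (oddExt (bitsUpTo b j)) (M' aFlow) (M' aPot)) ?_ ?_
  · rwa [oddExt_bitsUpTo_zero, M.store_of_ne (by decide), M.store_of_ne (by decide)]
  · intro j _ M' hM' hj ih
    rw [Mem.store_of_ne _ (by decide), Mem.store_of_ne _ (by decide), bitsUpTo_succ, run_ite]
    have bit_eq : (rd aWeight (var cVar + 1) / var aPow).val M' = b (j + 1) := by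
      simp only [Expr.val_div, Expr.val_read, Expr.val_add, Expr.val_var, Expr.val_one, hj,
        hM' aWeight (by decide), hM' aPow (by decide), hb]
    rcases Int.emod_two_eq_zero_or_one (b (j + 1)) with heven | hodd
    · have : ¬Odd (b (j + 1)) := Int.not_odd_iff.2 heven
      rw [if_neg (by rwa [val_oddE_pos, bit_eq]), run_skip]
      simpa only [heven, ite_self, add_zero] using ih
    · rw [if_pos (by rwa [val_oddE_pos, bit_eq, Int.odd_iff]), hodd]
      refine (hM.of_frame (by decide) hM').run_addUnitCmd hN hA hj ?_ ih
      by_contra hjn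
      rw [b_eq_zero _ (by omega)] at hodd
      exact absurd hodd (by decide)

theorem Holds.run_nextBitsCmd (hW : ∀ u, (n : ℤ) < u → M aWeight u = 0) {P : ℤ} (hP : 0 ≤ P)
    (hpow : M aPow 0 = P * 2)
    (hw : N.Solves (oddExt fun u => M aWeight u / (P * 2)) (M aFlow) (M aPot)) :
    N.Solves (oddExt fun u => M aWeight u / P)
      (nextBitsCmd.run N.size M aFlow) (nextBitsCmd.run N.size M aPot) := by
  set M₁ := M.store aPow 0 P with hM₁
  set M₂ := doubleFlowCmd.run N.size M₁ with hM₂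
  have run_eq : nextBitsCmd.run N.size M = addBitsCmd.run N.size M₂ := by
    rw [nextBitsCmd, run_seq, run_seq, run_write, Expr.val_div, Expr.val_var, Expr.val_two,
      Expr.val_zero, hpow, Int.mul_ediv_cancel _ two_ne_zero]
  have holds₂ : Holds N n M₂ := (hM.store (by decide) _ _).run (by decide) _
  have frame₂ : ∀ b ∉ [aPow, aFlow, cMap], M₂ b = M b := fun b hb => by
    rw [List.mem_cons, not_or] at hb
    rw [hM₂, run_frame _ doubleFlowCmd (by simpa [doubleFlowCmd, writes, and_comm] using hb.2),
      hM₁, M.store_of_ne hb.1]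
  have pow₂ : M₂ aPow 0 = P := by
    rw [hM₂, run_frame _ _ (by decide), hM₁, Mem.store_self, Function.update_self]
  have flow₂ : ∀ k : ℕ, k < N.size → M₂ aFlow k = 2 * M aFlow k := fun k hk => by
    rw [hM₂, run_doubleFlowCmd _ _ hk, hM₁, M.store_of_ne (by decide)]
  have doubled := hw.two_mul flow₂
  rw [run_eq]
  have := holds₂.run_addBitsCmd hN hA
  rw [frame₂ aWeight (by decide), pow₂, frame₂ aPot (by decide)] at this
  refine this hW ?_
  simpa only [Int.ediv_ediv_of_nonneg hP] using doubled

theorem Holds.run_solveCmd (hF : M aFlow = 0) (hW : ∀ u, (n : ℤ) < u → M aWeight u = 0)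
    (hW₀ : ∀ u, 0 ≤ M aWeight u) (hW₂ : ∀ u, M aWeight u < 2 ^ N.size)
    (hp : N.Potential (M aPot)) :
    N.Solves (oddExt (M aWeight)) (solveCmd.run N.size M aFlow) (solveCmd.run N.size M aPot) := by
  set M₁ := powCmd.run N.size M
  have frame₁ : ∀ b ∉ powCmd.writes, M₁ b = M b := fun b hb => run_frame _ _ hb _
  have pow₁ : M₁ aPow 0 = 2 ^ N.size := run_powCmd _ _
  suffices solveCmd.run N.size M aPow 0 = 2 ^ (N.size - N.size) ∧
      N.Solves (oddExt fun u => M aWeight u / 2 ^ (N.size - N.size))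
        (solveCmd.run N.size M aFlow) (solveCmd.run N.size M aPot) by
    simpa only [Nat.sub_self, pow_zero, Int.ediv_one] using this.2
  refine run_rep_induction (I := fun t M' => M' aPow 0 = 2 ^ (N.size - t) ∧
    N.Solves (oddExt fun u => M aWeight u / 2 ^ (N.size - t)) (M' aFlow) (M' aPot)) ?_ ?_
  · have no_bits : (fun u => M aWeight u / 2 ^ (N.size - 0)) = 0 :=
      funext fun u => Int.ediv_eq_zero_of_lt (hW₀ u) (hW₂ u)
    rw [no_bits, Mem.store_of_ne _ (by decide), Mem.store_of_ne _ (by decide),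
      Mem.store_of_ne _ (by decide), run_frame _ _ (b := aFlow) (by decide),
      run_frame _ _ (b := aPot) (by decide), hF]
    exact ⟨pow₁, hp.solves_zero⟩
  · rintro t ht M' hM' - ⟨pow_eq, ih⟩
    have pow_succ_eq : (2 : ℤ) ^ (N.size - t) = 2 ^ (N.size - (t + 1)) * 2 := by
      rw [← pow_succ]
      congr 1
      omega
    have weight_eq : M' aWeight = M aWeight := by
      rw [hM' aWeight (by decide)]
      exact frame₁ aWeight (by decide)
    have holds' : Holds N n M' := (hM.run (by decide) _).of_frame (by decide) hM'
    rw [pow_succ_eq] at pow_eq ih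
    rw [← weight_eq] at hW ih ⊢
    rw [Mem.store_of_ne _ (by decide), Mem.store_of_ne _ (by decide),
      Mem.store_of_ne _ (by decide)]
    refine ⟨?_, holds'.run_nextBitsCmd hN hA hW (by positivity) pow_eq ih⟩
    rw [run_aPow_nextBitsCmd, pow_eq, Int.mul_ediv_cancel _ two_ne_zero]

end Run

/-! ## Rounding commands -/

namespace Network

section Double

variable {α : Type*} {N : Network α} {V : Finset α} {k : ℕ} {p : α → ℤ}

/-- The network with the costs of the arcs doubled, so that half-integral potentials of `N` become
integral. -/
def double (N : Network α) : Network α :=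
  { N with cost := fun k => if 0 ≤ k ∧ k < N.size then 2 * N.cost k else N.cost k }

theorem cost_double (N : Network α) (hk : k < N.size) : N.double.cost k = 2 * N.cost k :=
  if_pos ⟨k.cast_nonneg, Int.ofNat_lt.2 hk⟩

theorem even_cost_double (k : ℕ) (hk : k < N.double.size) : Even (N.double.cost k) :=
  cost_double N hk ▸ even_two_mul _

theorem OnNodes.double (hN : N.OnNodes V) : N.double.OnNodes V :=
  ⟨hN.card_lt, hN.tail_mem, hN.head_mem⟩

theorem Symmetric.double [InvolutiveNeg α] (hN : N.Symmetric V) : N.double.Symmetric V where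
  neg_mem := hN.neg_mem
  mirror k hk := by
    obtain ⟨k', hk', htail, hhead, hcost⟩ := hN.mirror k hk
    exact ⟨k', hk', htail, hhead, by rw [cost_double N hk', cost_double N hk, hcost]⟩

theorem slack_double_two_mul (hk : k < N.size) :
    N.double.slack (fun u => 2 * p u) k = 2 * N.slack p k := by
  rw [slack, cost_double N hk, slack, double]
  ring

theorem potential_double_two_mul : N.double.Potential (fun u => 2 * p u) ↔ N.Potential p := by
  refine forall₂_congr fun k hk => ?_
  rw [slack_double_two_mul (N := N) hk]
  omega

theorem Symmetric.potential_double [InvolutiveNeg α] (hN : N.Symmetric V) (hp : N.Potential p) :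
    N.double.Potential fun u => p u - p (-u) := by
  intro k hk
  obtain ⟨k', hk', htail, hhead, hcost⟩ := hN.mirror k hk
  have hslack := hp hk
  have mirror_slack := hp hk'
  rw [slack, htail, hhead, hcost] at mirror_slack
  rw [slack] at hslack
  rw [slack, cost_double N hk, Network.double]
  linarith

end Double

section Rounded

variable {α : Type*} [InvolutiveNeg α] {N : Network α} {V : Finset α} {F X₀ X X' D : α → ℤ} {s : α}

/-- `X` is a potential, odd as a function, that is obtained from `X₀` by rounding some odd values
to a neighbouring even value. -/
structure Rounded (N : Network α) (V : Finset α) (X₀ X : α → ℤ) : Prop where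
  potential : N.Potential X
  neg : ∀ u ∈ V, X (-u) = -X u
  near : ∀ u ∈ V, X u = X₀ u ∨ Odd (X₀ u) ∧ Even (X u) ∧ (X u = X₀ u + 1 ∨ X u = X₀ u - 1)

theorem Rounded.round {F : ℤ → ℤ} (hX : N.Rounded V X₀ X) (hD : N.Distances F X V s 1 D)
    (hN : N.OnNodes V) (hsym : N.Symmetric V) (hcost : ∀ k : ℕ, k < N.size → Even (N.cost k))
    (hF : ∀ k : ℕ, k < N.size → F k = 0) (hodd : Odd (X s)) (hDs : N.size ≤ D (-s))
    (hX' : ∀ u ∈ V, X' u = X u + (D u / N.size - D (-u) / N.size)) : N.Rounded V X₀ X' where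
  potential := hD.potential_round hN hsym hcost hX.potential hX.neg hF hodd hX'
  neg u hu := hsym.neg_round hX.neg hX' hu
  near u hu := by
    rcases hD.round_eq_or hN hsym hcost hX.potential hX.neg hF hodd hX' hDs hu with
      same | ⟨odd_u, moved⟩
    · exact same ▸ hX.near u hu
    rcases hX.near u hu with unrounded | ⟨-, even_u, -⟩
    · rw [← unrounded]
      refine .inr ⟨odd_u, ?_, moved⟩
      rcases moved with h | h <;> rw [h]
      exacts [odd_u.add_odd odd_one, odd_u.sub_odd odd_one]
    · exact absurd odd_u (Int.not_odd_iff_even.2 even_u)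

end Rounded

end Network

/-- Replace the potential by its odd part, doubled, double the costs, and clear the flow. -/
def symmetrizeCmd : Cmd :=
  .rep cMap (.write aDist nodeE (rd aPot nodeE)) ;;
  .rep cMap (.write aPot nodeE (rd aDist nodeE - rd aDist (0 - nodeE))) ;;
  .rep cArc (.write aCost (var cArc) (rd aCost (var cArc) + rd aCost (var cArc)) ;;
    .write aFlow (var cArc) 0)

/-- Compute the distances from `e`, cut off at `S`. -/
def reachFromCmd (e : Expr) : Cmd := .write aSrc 0 e ;; .write aBound 0 1 ;; distCmd

/-- Compute the distances from a variable or its negative that does not reach its own negative. -/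
def reachCmd : Cmd :=
  reachFromCmd (var cVar + 1) ;;
  .ite (sizeVar - rd aDist (0 - var aSrc)) (reachFromCmd (0 - var aSrc)) .skip

/-- Round the nodes that are reached down, and their negatives up. -/
def shiftCmd : Cmd :=
  .rep cMap (.write aPot nodeE (rd aPot nodeE +
    (rd aDist nodeE / sizeVar - rd aDist (0 - nodeE) / sizeVar)))

/-- Make the potential of the current variable even. -/
def roundVarCmd : Cmd :=
  .ite (var aN - var cVar)
    (.ite (oddE (rd aPot (var cVar + 1))) (reachCmd ;; shiftCmd) .skip) .skip

/-- Make all potentials even. -/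
def roundCmd : Cmd := .rep cVar roundVarCmd

section Run

variable {N : Network ℤ} {n : ℕ} {M : Mem} (hM : Holds N n M) (hN : N.OnNodes (nodes n))

include hM

theorem Holds.val_nodeE {k : ℕ} (hk : M cMap 0 = k) : nodeE.val M = k - n := by
  rw [nodeE, Expr.val_sub, Expr.val_var, Expr.val_var, hk, hM.vars]

include hN

theorem Holds.run_symmetrizeCmd_pot {u : ℤ} (hu : u ∈ nodes n) :
    symmetrizeCmd.run N.size M aPot u = M aPot u - M aPot (-u) := by
  set M₁ := (Cmd.rep cMap (.write aDist nodeE (rd aPot nodeE))).run N.size M with hM₁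
  have frame₁ : ∀ b ∉ [cMap, aDist], M₁ b = M b := fun b hb => run_frame _ _ hb _
  have holds₁ : Holds N n M₁ := hM.run (by decide) _
  have := card_nodes n ▸ hN.card_lt
  have copy : ∀ u ∈ nodes n, M₁ aDist u = M aPot u := fun u hu => by
    rw [mem_nodes] at hu
    rw [hM₁, run_rep_map (by decide) n fun u _ => M aPot u, if_pos (by omega)]
    intro k _ M' hM' hk'
    simp only [run_write, Mem.store_self, Expr.val_read,
      (hM.of_frame (by decide) hM').val_nodeE hk', hM' aPot (by decide)]
  rw [symmetrizeCmd, run_seq, ← hM₁, run_seq, run_frame _ _ (by decide),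
    run_rep_map (by decide) n fun u _ => M₁ aDist u - M₁ aDist (-u),
    if_pos (by rw [mem_nodes] at hu; omega), copy u hu, copy _ (neg_mem_nodes hu)]
  intro k _ M' hM' hk'
  simp only [run_write, Mem.store_self, Expr.val_sub, Expr.val_read, Expr.val_zero, zero_sub,
    (holds₁.of_frame (by decide) hM').val_nodeE hk', hM' aDist (by decide)]

omit hN in
theorem Holds.run_symmetrizeCmd : Holds N.double n (symmetrizeCmd.run N.size M) := by
  have frame : ∀ b ∉ symmetrizeCmd.writes, symmetrizeCmd.run N.size M b = M b :=
    fun b hb => run_frame _ _ hb _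
  refine ⟨frame aSize (by decide) ▸ hM.size, frame aN (by decide) ▸ hM.vars,
    frame aTail (by decide) ▸ hM.tail, frame aHead (by decide) ▸ hM.head, funext fun u => ?_⟩
  rw [symmetrizeCmd, run_seq, run_seq, run_rep_map (by decide) 0 fun _ x => 2 * x]
  · simp (disch := decide) only [run_frame, hM.cost, neg_zero, sub_zero, Network.double]
  · intro k _ M' _ hk'
    rw [run_seq, run_frame _ _ (by decide), run_write, Mem.store_self]
    simp only [Expr.val_add, Expr.val_read, Expr.val_var, hk', sub_zero, two_mul]

omit hM hN in
theorem run_symmetrizeCmd_flow (S : ℕ) (M : Mem) {k : ℕ} (hk : k < S) :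
    symmetrizeCmd.run S M aFlow k = 0 := by
  rw [symmetrizeCmd, run_seq, run_seq, run_rep_map (by decide) 0 fun _ _ => 0,
    if_pos (by omega)]
  intro k _ M' _ hk'
  rw [run_seq, run_write, run_write, Mem.store_self, Mem.store_of_ne _ (by decide)]
  simp only [Expr.val_var, Mem.store_of_ne _ (show cArc ≠ aCost by decide), hk', sub_zero,
    Expr.val_zero]

theorem Holds.run_shiftCmd {u : ℤ} (hu : u ∈ nodes n) : shiftCmd.run N.size M aPot u =
    M aPot u + (M aDist u / N.size - M aDist (-u) / N.size) := by
  have := card_nodes n ▸ hN.card_lt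
  rw [mem_nodes] at hu
  rw [shiftCmd, run_rep_map (by decide) n
    fun u x => x + (M aDist u / N.size - M aDist (-u) / N.size), if_pos (by omega)]
  intro k _ M' hM' hk'
  have holds' := hM.of_frame (by decide) hM'
  simp only [run_write, Mem.store_self, Expr.val_add, Expr.val_sub, Expr.val_div, Expr.val_read,
    Expr.val_sizeVar, Expr.val_zero, zero_sub, holds'.val_nodeE hk', holds'.size,
    hM' aDist (by decide)]

section Reach

variable (hp : N.Potential (M aPot))

include hp

theorem Holds.run_reachFromCmd {e : Expr} (he : e.val M ∈ nodes n) :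
    N.Distances (M aFlow) (M aPot) (nodes n) (e.val M) 1
      ((reachFromCmd e).run N.size M aDist) := by
  set M₁ := (M.store aSrc 0 (e.val M)).store aBound 0 1 with hM₁
  have holds₁ : Holds N n M₁ := (hM.store (by decide) _ _).store (by decide) _ _
  have flow₁ : M₁ aFlow = M aFlow := by simp (disch := decide) only [hM₁, Mem.store_of_ne]
  have pot₁ : M₁ aPot = M aPot := by simp (disch := decide) only [hM₁, Mem.store_of_ne]
  have src₁ : M₁ aSrc 0 = e.val M := by
    rw [hM₁, Mem.store_of_ne _ (by decide), Mem.store_self, Function.update_self]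
  have bound₁ : M₁ aBound 0 = 1 := by rw [hM₁, Mem.store_self, Function.update_self]
  have dist := holds₁.distances_distCmd hN (pot₁ ▸ hp) (src₁ ▸ he) (bound₁ ▸ zero_le_one)
  rwa [flow₁, pot₁, src₁, bound₁] at dist

/-- If `z` lies below the potential at `j + 1`, then `j + 1` does not reach its negative, and
otherwise `-(j + 1)` does not reach its negative. -/
theorem Holds.run_reachCmd (hF : ∀ k : ℕ, k < N.size → M aFlow k = 0)
    (hneg : ∀ u ∈ nodes n, M aPot (-u) = -M aPot u) {z : ℤ → ℤ} (hz : N.Potential z)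
    (hzneg : ∀ u, z (-u) = -z u) {j : ℕ} (hj : M cVar 0 = j) (hjn : j < n)
    (hne : z (j + 1) ≠ M aPot (j + 1)) : ∃ s : ℤ, (s = j + 1 ∨ s = -(j + 1)) ∧
      N.Distances (M aFlow) (M aPot) (nodes n) s 1 (reachCmd.run N.size M aDist) ∧
      N.size ≤ reachCmd.run N.size M aDist (-s) := by
  have hj₁ : (var cVar + 1).val M = j + 1 := by simp only [Expr.val_add, Expr.val_var, hj,
    Expr.val_one]
  have mem : (j + 1 : ℤ) ∈ nodes n := by rw [mem_nodes]; omega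
  have neg_mem := neg_mem_nodes mem
  have dist := hM.run_reachFromCmd hN hp (hj₁ ▸ mem)
  rw [hj₁] at dist
  set M₁ := (reachFromCmd (var cVar + 1)).run N.size M with hM₁
  have frame : ∀ b ∉ (reachFromCmd (var cVar + 1)).writes, M₁ b = M b :=
    fun b hb => run_frame _ _ hb _
  have holds₁ : Holds N n M₁ := hM.run (by decide) _
  have src₁ : M₁ aSrc 0 = j + 1 := by
    rw [hM₁, reachFromCmd, run_seq, run_seq, run_frame _ _ (by decide), run_write,
      run_write, Mem.store_of_ne _ (by decide), Mem.store_self, hj₁]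
    exact Function.update_self ..
  have neg_src : (0 - var aSrc : Expr).val M₁ = -(j + 1) := by
    rw [Expr.val_sub, Expr.val_zero, Expr.val_var, src₁, zero_sub]
  rw [reachCmd, run_seq, ← hM₁, run_ite, Expr.val_sub, Expr.val_sizeVar, Expr.val_read, neg_src,
    holds₁.size]
  split_ifs with hlt
  · have dist' := holds₁.run_reachFromCmd hN (frame aPot (by decide) ▸ hp) (neg_src ▸ neg_mem)
    rw [neg_src, frame aPot (by decide), frame aFlow (by decide)] at dist'
    refine ⟨-(j + 1), .inr rfl, dist', dist'.le_neg_source hN hp hF (neg_neg (_ : ℤ) ▸ mem) hz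
      (hzneg _) (hneg _ neg_mem) ?_⟩
    have not_lt : ¬ z (j + 1) < M aPot (j + 1) := fun hlt' => absurd
      (dist.le_neg_source hN hp hF neg_mem hz (hzneg _) (hneg _ mem) hlt') (by omega)
    rw [hzneg, hneg _ mem]
    omega
  · exact ⟨j + 1, .inl rfl, dist, by rw [run_skip]; omega⟩

end Reach

variable (hsym : N.Symmetric (nodes n)) (hcost : ∀ k : ℕ, k < N.size → Even (N.cost k))
  (hF : ∀ k : ℕ, k < N.size → M aFlow k = 0) {z : ℤ → ℤ} (hz : N.Potential z)
  (hzneg : ∀ u, z (-u) = -z u) (hzeven : ∀ u, Even (z u)) {X₀ : ℤ → ℤ}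

include hsym hcost hF hz hzneg hzeven

theorem Holds.run_roundVarCmd (hX : N.Rounded (nodes n) X₀ (M aPot)) {j : ℕ}
    (hj : M cVar 0 = j) : N.Rounded (nodes n) X₀ (roundVarCmd.run N.size M aPot) ∧
      (∀ u ∈ nodes n, Even (M aPot u) → Even (roundVarCmd.run N.size M aPot u)) ∧
      (j < n → Even (roundVarCmd.run N.size M aPot (j + 1))) := by
  have hj₁ : (var cVar + 1).val M = j + 1 := by simp only [Expr.val_add, Expr.val_var, hj,
    Expr.val_one]
  have in_range : 0 < (var aN - var cVar).val M ↔ j < n := by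
    rw [Expr.val_sub, Expr.val_var, Expr.val_var, hj, hM.vars, sub_pos, Int.ofNat_lt]
  simp only [roundVarCmd, run_ite, run_skip, val_oddE_pos, Expr.val_read, hj₁, in_range]
  split_ifs with hjn hodd
  · have hne : z (j + 1) ≠ M aPot (j + 1) := fun h =>
      Int.not_odd_iff_even.2 (hzeven _) (h ▸ hodd)
    obtain ⟨s, hs, hD, hDs⟩ := hM.run_reachCmd hN hX.potential hF hX.neg hz hzneg hj hjn hne
    rw [run_seq]
    set M₁ := reachCmd.run N.size M
    have holds₁ : Holds N n M₁ := hM.run (by decide) _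
    have pot₁ : M₁ aPot = M aPot := run_frame _ _ (by decide) _
    have shift : ∀ u ∈ nodes n, shiftCmd.run N.size M₁ aPot u = _ :=
      fun u hu => pot₁ ▸ holds₁.run_shiftCmd hN hu
    have mem : (j + 1 : ℤ) ∈ nodes n := by rw [mem_nodes]; omega
    have hodd_s : Odd (M aPot s) := by
      rcases hs with rfl | rfl
      exacts [hodd, hX.neg _ mem ▸ hodd.neg]
    have rounded := hX.round hD hN hsym hcost hF hodd_s hDs shift
    have hs_mem : s ∈ nodes n := by rcases hs with rfl | rfl; exacts [mem, neg_mem_nodes mem]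
    have even_s := hD.even_round hN hsym hs_mem hodd_s hDs shift
    refine ⟨rounded, fun u hu even_u => ?_, fun _ => ?_⟩
    · rcases hD.round_eq_or hN hsym hcost hX.potential hX.neg hF hodd_s shift hDs hu with h | h
      exacts [h ▸ even_u, absurd h.1 (Int.not_odd_iff_even.2 even_u)]
    · rcases hs with rfl | rfl
      exacts [even_s, even_neg.1 (rounded.neg _ mem ▸ even_s)]
  · exact ⟨hX, fun _ _ => id, fun _ => Int.not_odd_iff_even.1 hodd⟩
  · exact ⟨hX, fun _ _ => id, fun h => absurd h hjn⟩

theorem Holds.run_roundCmd (hp : N.Potential (M aPot))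
    (hneg : ∀ u ∈ nodes n, M aPot (-u) = -M aPot u) :
    N.Rounded (nodes n) (M aPot) (roundCmd.run N.size M aPot) ∧
      ∀ j : ℕ, j < n → Even (roundCmd.run N.size M aPot (j + 1)) := by
  have hsize := card_nodes n ▸ hN.card_lt
  suffices N.Rounded (nodes n) (M aPot) (roundCmd.run N.size M aPot) ∧
      ∀ j : ℕ, j < n → j < N.size → Even (roundCmd.run N.size M aPot (j + 1)) from
    ⟨this.1, fun j hj => this.2 j hj (by omega)⟩
  refine run_rep_induction (I := fun i M' => N.Rounded (nodes n) (M aPot) (M' aPot) ∧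
    ∀ j : ℕ, j < n → j < i → Even (M' aPot (j + 1))) ?_ ?_
  · rw [Mem.store_of_ne _ (by decide)]
    exact ⟨⟨hp, hneg, fun _ _ => .inl rfl⟩, fun j _ hj => absurd hj j.not_lt_zero⟩
  · intro i _ M' hM' hi ⟨rounded, even⟩
    have step := (hM.of_frame (by decide) hM').run_roundVarCmd hN hsym hcost
      (hM' aFlow (by decide) ▸ hF) hz hzneg hzeven rounded hi
    rw [Mem.store_of_ne _ (by decide)]
    refine ⟨step.1, fun j hj hji => ?_⟩
    rcases Nat.lt_succ_iff_lt_or_eq.1 hji with h | rfl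
    · exact step.2.1 _ (by rw [mem_nodes]; omega) (even j hj h)
    · exact step.2.2 hj

end Run

end UTVPI

namespace RAM

theorem output_eq (M : Mem) :
    output M = (List.range (M 3 0).toNat).map fun i : ℕ => M 2 i := by
  simp only [output, List.bind_eq_flatMap, List.map_flatMap, List.pure_def, List.map_cons,
    List.map_nil]
  exact List.map_eq_flatMap.symm

end RAM

namespace UTVPI

open RAM RAM.Cmd

/-! ## Output commands -/

/-- Halve the potentials of the variables. -/
def halveCmd : Cmd :=
  .rep cMap (.ite nodeE (.write aOut nodeE (rd aPot nodeE / 2))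
    (.write aOut nodeE (0 - rd aPot (0 - nodeE) / 2))) ;;
  .write aOut 0 0

/-- Clear the flag if the values violate the current constraint, with doubled cost. -/
def checkArcCmd : Cmd :=
  .ite (rd aCost (var cArc) - ((rd aOut tailE - rd aOut headE) + (rd aOut tailE - rd aOut headE)))
    (.write aFlag 0 0) .skip

/-- Check the constraints. -/
def checkCmd : Cmd := .write aFlag 0 1 ;; .rep cArc checkArcCmd

/-- Output the flag, followed by the values if it is set. -/
def emitCmd : Cmd :=
  .ite (var aFlag) (.write aOutLen 0 (var aN + 1)) (.write aOutLen 0 1) ;;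
  .write aOut 0 (var aFlag)

/-- Halve the potentials, check the constraints, and output. -/
def outputCmd : Cmd := halveCmd ;; checkCmd ;; emitCmd

theorem run_emitCmd (S : ℕ) {n : ℕ} {M : Mem} (hn : M aN 0 = n) : output (emitCmd.run S M) =
    M aFlag 0 :: if 0 < M aFlag 0 then List.ofFn fun j : Fin n => M aOut (j + 1) else [] := by
  rw [output_eq, emitCmd, run_seq, run_ite, Expr.val_var]
  split_ifs
  · have toNat : ((n : ℤ) + 1).toNat = n + 1 := by omega
    refine List.ext_getElem (by simp [run_write, hn, toNat, Mem.store_apply]) fun i _ _ => ?_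
    cases i <;> simp [run_write, Mem.store_apply, Function.update_of_ne, Nat.cast_add_one_ne_zero]
  · simp [run_write, Mem.store_apply]

section Run

variable {N : Network ℤ} {n : ℕ} {M : Mem}

theorem Holds.run_halveCmd (hM : Holds N n M) (hN : N.OnNodes (nodes n)) {u : ℤ}
    (hu : u ∈ nodes n) :
    halveCmd.run N.size M aOut u = oddExt (fun u => M aPot u / 2) u := by
  have := card_nodes n ▸ hN.card_lt
  rw [mem_nodes] at hu
  rw [halveCmd, run_seq, run_write, Mem.store_self, Expr.val_zero]
  obtain rfl | hu₀ := eq_or_ne u 0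
  · exact Function.update_self ..
  rw [Function.update_of_ne hu₀, run_rep_map (by decide) n
    fun u _ => if 0 < u then M aPot u / 2 else -(M aPot (-u) / 2), if_pos (by omega), oddExt]
  · split_ifs <;> first | rfl | omega
  · intro k _ M' hM' hk'
    have hnode := (hM.of_frame (by decide) hM').val_nodeE hk'
    rw [run_ite, hnode]
    split_ifs <;> simp only [run_write, Mem.store_self, hnode, Expr.val_sub, Expr.val_div,
      Expr.val_read, Expr.val_zero, Expr.val_two, zero_sub, hM' aPot (by decide)]

theorem Holds.run_checkArcCmd (hM : Holds N n M) {k : ℕ} (hk : M cArc 0 = k) :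
    checkArcCmd.run N.size M aFlag 0 =
      if 0 ≤ N.slack (fun u => 2 * M aOut u) k then M aFlag 0 else 0 := by
  have hval : (rd aCost (var cArc) - ((rd aOut tailE - rd aOut headE) +
      (rd aOut tailE - rd aOut headE))).val M = -N.slack (fun u => 2 * M aOut u) k := by
    simp only [Expr.val_sub, Expr.val_add, Expr.val_read, Expr.val_var, hM.val_tailE hk,
      hM.val_headE hk, hk, hM.cost, Network.slack]
    ring
  rw [checkArcCmd, run_ite, hval]
  split_ifs <;> first | omega | simp only [run_skip, run_write, Mem.store_self, Expr.val_zero,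
    Function.update_self]

open scoped Classical in
theorem Holds.run_checkCmd (hM : Holds N n M) : checkCmd.run N.size M aFlag 0 =
    if N.Potential fun u => 2 * M aOut u then 1 else 0 := by
  refine (run_rep_induction (I := fun i M' => M' aFlag 0 =
    if ∀ k : ℕ, k < i → 0 ≤ N.slack (fun u => 2 * M aOut u) k then 1 else 0) ?_ ?_).trans
    (if_congr Iff.rfl rfl rfl)
  · simp [run_write, Mem.store_apply]
  · intro i _ M' hM' hi ih
    have holds' : Holds N n M' :=
      (hM.run (c := .write aFlag 0 1) (by decide) N.size).of_frame (by decide) hM'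
    rw [Mem.store_of_ne _ (by decide), holds'.run_checkArcCmd hi, ih,
      show M' aOut = M aOut from (hM' aOut (by decide)).trans (run_frame _ _ (by decide) _)]
    simp only [Nat.lt_succ_iff_lt_or_eq, or_imp, forall_and, forall_eq]
    split_ifs <;> tauto

theorem Holds.run_outputCmd (hM : Holds N.double n M) (hN : N.OnNodes (nodes n)) :
    N.Potential (oddExt fun u => M aPot u / 2) ∧ output (outputCmd.run N.size M) =
      1 :: List.ofFn (fun j : Fin n => M aPot ((j : ℤ) + 1) / 2) ∨
    ¬ N.Potential (oddExt fun u => M aPot u / 2) ∧ output (outputCmd.run N.size M) = [0] := by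
  set M₁ := halveCmd.run N.size M
  have holds₁ : Holds N.double n M₁ := hM.run (by decide) _
  have out₁ : ∀ u ∈ nodes n, M₁ aOut u = oddExt (fun u => M aPot u / 2) u :=
    fun u hu => hM.run_halveCmd hN.double hu
  have potential_iff : N.double.Potential (fun u => 2 * M₁ aOut u) ↔
      N.Potential (oddExt fun u => M aPot u / 2) := by
    rw [Network.potential_double_two_mul]
    exact ⟨fun h => hN.potential_congr h fun u hu => (out₁ u hu).symm,
      fun h => hN.potential_congr h out₁⟩
  set M₂ := checkCmd.run N.size M₁
  classical
  have flag₂ :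
      M₂ aFlag 0 = if N.double.Potential fun u => 2 * M₁ aOut u then 1 else 0 := holds₁.run_checkCmd
  have holds₂ : Holds N.double n M₂ := holds₁.run (by decide) _
  rw [outputCmd, run_seq, run_seq, run_emitCmd _ holds₂.vars, flag₂]
  simp only [potential_iff]
  split_ifs with h h'
  · refine .inl ⟨h, congrArg _ (congrArg _ (funext fun j => ?_))⟩
    have : (j + 1 : ℤ) ∈ nodes n := by rw [mem_nodes]; omega
    rw [show M₂ aOut = M₁ aOut from run_frame _ _ (by decide) _, out₁ _ this,
      oddExt_of_pos _ (by omega)]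
  all_goals first | omega | exact .inr ⟨h, rfl⟩

end Run

end UTVPI

namespace RAM.Cmd

/-- Run `c` for the values `0, …, m - 1` of the counter `a`, where `m` is the scalar variable `b`,
which must not exceed the loop bound. -/
def upTo (b a : ℕ) (c : Cmd) : Cmd := .rep a (.ite (var b - var a) c .skip)

section UpTo

variable {S m a b : ℕ} {c : Cmd} {M : Mem}

theorem run_upTo_induction (hb : b ∉ a :: c.writes) (hm : M b 0 = m) (hmS : m ≤ S)
    {I : ℕ → Mem → Prop} (store : ∀ k N v, I k N → I k (N.store a 0 v)) (zero : I 0 M)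
    (succ : ∀ k < m, ∀ N : Mem, (∀ d ∉ a :: c.writes, N d = M d) → N a 0 = k → I k N →
      I (k + 1) (c.run S N)) :
    I m ((upTo b a c).run S M) := by
  suffices I (min S m) ((upTo b a c).run S M) by rwa [min_eq_right hmS] at this
  refine run_rep_induction (I := fun k N => I (min k m) N)
    (store _ _ _ (by rwa [Nat.zero_min])) fun k _ N hN hNa hI => store _ _ _ ?_
  simp only [writes, List.append_nil] at hN
  rw [run_ite, Expr.val_sub, Expr.val_var, Expr.val_var, hN b hb, hm, hNa]
  split_ifs with hkm
  · rw [min_eq_left (by omega)] at hI ⊢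
    exact succ k (by omega) N hN hNa hI
  · rw [min_eq_right (by omega)] at hI ⊢
    exact hI

theorem run_upTo_map (hb : b ∉ a :: c.writes) (hm : M b 0 = m) (hmS : m ≤ S) {d : ℕ} (hda : d ≠ a)
    (l : ℤ) (φ : ℤ → ℤ)
    (step : ∀ k < m, ∀ N : Mem, (∀ x ∉ a :: c.writes, N x = M x) → N a 0 = k →
      c.run S N d = Function.update (N d) (l + k) (φ k)) (u : ℤ) :
    (upTo b a c).run S M d u = if l ≤ u ∧ u < l + m then φ (u - l) else M d u := by
  revert u
  refine run_upTo_induction hb hm hmS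
    (I := fun k N => ∀ u, N d u = if l ≤ u ∧ u < l + k then φ (u - l) else M d u) ?_ ?_ ?_
  · intro k N v hI
    rwa [N.store_of_ne hda]
  · intro u
    rw [if_neg (by push_cast; omega)]
  · intro k hk N hN hNa hI u
    rw [step k hk N hN hNa]
    obtain rfl | hu := eq_or_ne u (l + k)
    · rw [Function.update_self, if_pos (by push_cast; omega), add_sub_cancel_left]
    · rw [Function.update_of_ne hu, hI]
      exact if_congr (by push_cast; omega) rfl rfl

end UpTo

end RAM.Cmd

namespace UTVPI

open RAM RAM.Cmd

/-! ## Rows with at most two nonzero entries -/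

/-- Add the literal of the entry `a` in column `q` to the last two literals of a row. -/
def pushLiteral (a : ℤ) (q : ℕ) (l : ℤ × ℤ) : ℤ × ℤ :=
  if 0 < a then (q + 1, l.1) else if a < 0 then (-(q + 1), l.1) else l

/-- The last two literals among the first entries of the row `a`, with the last one first. A
positive entry in column `j` gives the literal `j + 1` and a negative one the literal `-(j + 1)`;
missing literals are `0`. -/
def literals (a : ℕ → ℤ) : ℕ → ℤ × ℤ
  | 0 => (0, 0)
  | q + 1 => pushLiteral (a q) q (literals a q)

section Literals

variable {a : ℕ → ℤ}

theorem literals_mem (a : ℕ → ℤ) (q : ℕ) :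
    (literals a q).1 ∈ nodes q ∧ (literals a q).2 ∈ nodes q := by
  induction q with
  | zero => simp [literals, mem_nodes]
  | succ q ih =>
    simp only [mem_nodes] at ih ⊢
    simp only [literals, pushLiteral]
    push_cast
    split_ifs <;> omega

theorem literals_fst_eq_zero {q : ℕ} (h : Nat.count (a · ≠ 0) q = 0) : (literals a q).1 = 0 := by
  induction q with
  | zero => rfl
  | succ q ih =>
    rw [Nat.count_succ] at h
    have : a q = 0 := by
      by_contra hq
      simp [hq] at h
    simpa [literals, pushLiteral, this] using ih (by omega)

theorem literals_snd_eq_zero {q : ℕ} (h : Nat.count (a · ≠ 0) q ≤ 1) : (literals a q).2 = 0 := by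
  induction q with
  | zero => rfl
  | succ q ih =>
    rw [Nat.count_succ] at h
    by_cases hq : a q = 0
    · simpa [literals, pushLiteral, hq] using ih (by omega)
    · have := literals_fst_eq_zero (a := a) (q := q) (by rw [if_pos hq] at h; omega)
      simp only [literals, pushLiteral]
      split_ifs <;> first | exact this | omega

theorem sum_mul_eq_literals {q : ℕ} (ha : ∀ j < q, a j = -1 ∨ a j = 0 ∨ a j = 1)
    (h : Nat.count (a · ≠ 0) q ≤ 2) (x : ℤ → ℤ) : ∑ j ∈ Finset.range q, a j * x (j + 1) =
      oddExt x (literals a q).1 + oddExt x (literals a q).2 := by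
  induction q with
  | zero => simp [literals]
  | succ q ih =>
    rw [Nat.count_succ] at h
    have ih := ih (fun j hj => ha j (by omega)) (by omega)
    have snd_eq (hq : a q ≠ 0) : (literals a q).2 = 0 :=
      literals_snd_eq_zero (by rw [if_pos hq] at h; omega)
    rw [Finset.sum_range_succ, ih]
    have last_eq : oddExt x (q + 1) = x (q + 1) := oddExt_of_pos _ (by omega)
    rcases ha q q.lt_succ_self with hq | hq | hq
    · simp only [literals, pushLiteral, hq, snd_eq (by omega), oddExt_zero, reduceIte, Int.reduceLT,
        Int.reduceNeg, oddExt_neg, last_eq]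
      ring
    · simp only [literals, pushLiteral, hq, lt_self_iff_false, reduceIte, zero_mul, add_zero]
    · simp only [literals, pushLiteral, hq, snd_eq (by omega), oddExt_zero, reduceIte, Int.reduceLT,
        last_eq]
      ring

end Literals

/-! ## Networks of constraints -/

/-- The arcs `2 * i` and `2 * i + 1` represent the constraint `β i ≤ y (U i) + y (V i)` on odd
functions `y`. -/
structure Network.OfConstraints (N : Network ℤ) (U V β : ℕ → ℤ) : Prop where
  tail : ∀ k < N.size, N.tail k = if Odd k then V (k / 2) else U (k / 2)
  head : ∀ k < N.size, N.head k = if Odd k then -U (k / 2) else -V (k / 2)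
  cost : ∀ k < N.size, N.cost k = β (k / 2)

namespace Network.OfConstraints

variable {N : Network ℤ} {U V β : ℕ → ℤ} (hN : N.OfConstraints U V β)
include hN

theorem onNodes {n : ℕ} (hn : 2 * n + 1 < N.size) (hU : ∀ i, U i ∈ nodes n)
    (hV : ∀ i, V i ∈ nodes n) : N.OnNodes (nodes n) where
  card_lt := by rwa [card_nodes]
  tail_mem hk := by
    rw [hN.tail _ hk]
    split_ifs
    exacts [hV _, hU _]
  head_mem hk := by
    rw [hN.head _ hk]
    split_ifs
    exacts [neg_mem_nodes (hU _), neg_mem_nodes (hV _)]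

/-- The hypothesis covers the case that `2 * i` is the last arc. -/
theorem symmetric {n : ℕ} (h : ∀ i, N.size = 2 * i + 1 → U i = V i) : N.Symmetric (nodes n) where
  neg_mem _ := neg_mem_nodes
  mirror k hk := by
    have half (i : ℕ) : (2 * i + 1) / 2 = i := by omega
    have not_odd (i : ℕ) : ¬ Odd (2 * i) := by simp
    obtain ⟨i, rfl | rfl⟩ := Nat.even_or_odd' k
    · obtain hlast | hlast := eq_or_ne N.size (2 * i + 1)
      · refine ⟨2 * i, hk, ?_⟩
        rw [hN.tail _ hk, hN.head _ hk]
        simp [h i hlast]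
      · have hk' : 2 * i + 1 < N.size := by omega
        refine ⟨2 * i + 1, hk', ?_⟩
        rw [hN.tail _ hk, hN.head _ hk, hN.tail _ hk', hN.head _ hk', hN.cost _ hk, hN.cost _ hk']
        simp [half, not_odd]
    · have hk' : 2 * i < N.size := by omega
      refine ⟨2 * i, hk', ?_⟩
      rw [hN.tail _ hk, hN.head _ hk, hN.tail _ hk', hN.head _ hk', hN.cost _ hk, hN.cost _ hk']
      simp [half, not_odd]

theorem slack_eq {y : ℤ → ℤ} (hy : ∀ u, y (-u) = -y u) {k : ℕ} (hk : k < N.size) :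
    N.slack y k = y (U (k / 2)) + y (V (k / 2)) - β (k / 2) := by
  rw [slack, hN.tail _ hk, hN.head _ hk, hN.cost _ hk]
  split_ifs <;> rw [hy] <;> ring

theorem potential_iff {y : ℤ → ℤ} (hy : ∀ u, y (-u) = -y u) :
    N.Potential y ↔ ∀ i, 2 * i < N.size → β i ≤ y (U i) + y (V i) := by
  refine ⟨fun h i hi => ?_, fun h k hk => ?_⟩
  · have := h hi
    rw [hN.slack_eq hy hi, Nat.mul_div_cancel_left i two_pos] at this
    omega
  · rw [hN.slack_eq hy hk]
    have := h (k / 2) (by omega)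
    omega

end Network.OfConstraints

/-! ## The network of an instance -/

/-- The array `f` holds the encoding of `I`. -/
structure Encodes (I : UTVPIProblem) (f : ℤ → ℤ) : Prop where
  rows : f 0 = I.m
  cols : f 1 = I.n
  matrix : ∀ (i : Fin I.m) (j : Fin I.n), f (2 + (i : ℤ) * I.n + j) = I.A i j
  rhs : ∀ i : Fin I.m, f (2 + (I.m : ℤ) * I.n + i) = I.b i
  num : ∀ j : Fin I.n, f (2 + (I.m : ℤ) * I.n + I.m + j) = (I.w j).num
  den : ∀ j : Fin I.n, f (2 + (I.m : ℤ) * I.n + I.m + I.n + j) = (I.w j).den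

/-- The literals of row `i` of the matrix in the input `f`. -/
def rowLiterals (f : ℤ → ℤ) (n i : ℕ) : ℤ × ℤ := literals (fun j => f (2 + (i : ℤ) * n + j)) n

/-- Feasible potentials of the network that are odd are the feasible solutions of `I`. -/
structure Represents (I : UTVPIProblem) (N : Network ℤ) : Prop where
  onNodes : N.OnNodes (nodes I.n)
  symmetric : N.Symmetric (nodes I.n)
  nonnegArcs : N.HasNonnegArcs I.n
  potential_iff : ∀ x : ℤ → ℤ,
    N.Potential (oddExt x) ↔ I.Feasible fun j : Fin I.n => x ((j : ℤ) + 1)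

section Represents

variable {I : UTVPIProblem} {f : ℤ → ℤ} {N : Network ℤ} {U V β : ℕ → ℤ}

theorem Encodes.sum_mul_eq (hf : Encodes I f) (i : Fin I.m) (x : ℤ → ℤ) :
    ∑ j, I.A i j * x ((j : ℤ) + 1) =
      oddExt x (rowLiterals f I.n i).1 + oddExt x (rowLiterals f I.n i).2 := by
  have count_le : Nat.count (fun j : ℕ => f (2 + (i : ℤ) * I.n + j) ≠ 0) I.n ≤ 2 := by
    rw [Nat.count_eq_card_filter_range]
    refine (Finset.card_le_card fun j hj => ?_).trans
      ((Finset.card_image_le (f := Fin.val)).trans (I.A_row i))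
    rw [Finset.mem_filter, Finset.mem_range] at hj
    simp only [Finset.mem_image, Finset.mem_filter, Finset.mem_univ, true_and]
    exact ⟨⟨j, hj.1⟩, by rw [← hf.matrix]; exact hj.2, rfl⟩
  have entry_mem (j : ℕ) (hj : j < I.n) := hf.matrix i ⟨j, hj⟩ ▸ I.A_mem i ⟨j, hj⟩
  rw [rowLiterals, ← sum_mul_eq_literals entry_mem count_le x, Finset.sum_range]
  exact Finset.sum_congr rfl fun j _ => by rw [hf.matrix]

/-- The functions `U`, `V` and `β` describe the constraints of the instance in the input `f`, in the
order in which the commands below read them: the rows of the matrix, then `0 ≤ x j + x j` for all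
`j`, and then trivial ones. -/
structure Lists (I : UTVPIProblem) (f : ℤ → ℤ) (U V β : ℕ → ℤ) : Prop where
  row : ∀ i < I.m, U i = (rowLiterals f I.n i).1 ∧ V i = (rowLiterals f I.n i).2 ∧
    β i = f (2 + (I.m : ℤ) * I.n + i)
  nonneg : ∀ j < I.n, U (I.m + j) = j + 1 ∧ V (I.m + j) = j + 1 ∧ β (I.m + j) = 0
  trivial : ∀ i, I.m + I.n ≤ i → U i = 0 ∧ V i = 0 ∧ β i = 0

theorem Lists.mem_nodes (h : Lists I f U V β) (i : ℕ) : U i ∈ nodes I.n ∧ V i ∈ nodes I.n := by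
  obtain hi | hi := lt_or_ge i I.m
  · obtain ⟨hU, hV, -⟩ := h.row i hi
    rw [hU, hV]
    exact literals_mem _ _
  obtain ⟨j, rfl⟩ := Nat.exists_eq_add_of_le hi
  obtain hj | hj := lt_or_ge j I.n
  · obtain ⟨hU, hV, -⟩ := h.nonneg j hj
    rw [hU, hV, UTVPI.mem_nodes]
    omega
  · obtain ⟨hU, hV, -⟩ := h.trivial (I.m + j) (by omega)
    rw [hU, hV, UTVPI.mem_nodes]
    omega

theorem Lists.feasible_iff (h : Lists I f U V β) (hf : Encodes I f) (x : ℤ → ℤ) :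
    (I.Feasible fun j : Fin I.n => x ((j : ℤ) + 1)) ↔
      ∀ i < I.m + I.n, β i ≤ oddExt x (U i) + oddExt x (V i) := by
  have row_iff (i : Fin I.m) : β i ≤ oddExt x (U i) + oddExt x (V i) ↔
      I.b i ≤ ∑ j, I.A i j * x ((j : ℤ) + 1) := by
    obtain ⟨hU, hV, hβ⟩ := h.row i i.2
    rw [hf.sum_mul_eq, hU, hV, hβ, hf.rhs]
  have nonneg_iff (j : Fin I.n) :
      β (I.m + j) ≤ oddExt x (U (I.m + j)) + oddExt x (V (I.m + j)) ↔ 0 ≤ x ((j : ℤ) + 1) := by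
    obtain ⟨hU, hV, hβ⟩ := h.nonneg j j.2
    rw [hU, hV, hβ, oddExt_of_pos _ (by omega)]
    omega
  constructor
  · rintro ⟨hrow, hnonneg⟩ i hi
    obtain hi' | hi' := lt_or_ge i I.m
    · exact (row_iff ⟨i, hi'⟩).2 (hrow _)
    · obtain ⟨j, rfl⟩ := Nat.exists_eq_add_of_le hi'
      exact (nonneg_iff ⟨j, by omega⟩).2 (hnonneg _)
  · exact fun hx => ⟨fun i => (row_iff i).1 (hx i (by omega)),
      fun j => (nonneg_iff j).1 (hx (I.m + j) (by omega))⟩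

theorem Lists.represents (h : Lists I f U V β) (hf : Encodes I f) (hN : N.OfConstraints U V β)
    (hS : 2 * (I.m + I.n) ≤ N.size) : Represents I N where
  onNodes := hN.onNodes (by have := I.m_pos; omega) (fun i => (h.mem_nodes i).1)
    fun i => (h.mem_nodes i).2
  symmetric := hN.symmetric fun i hi => by
    obtain ⟨hU, hV, -⟩ := h.trivial i (by omega)
    rw [hU, hV]
  nonnegArcs j hj := by
    obtain ⟨hU, hV, hβ⟩ := h.nonneg j hj
    have hk : 2 * (I.m + j) < N.size := by omega
    refine ⟨_, hk, ?_⟩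
    rw [hN.tail _ hk, hN.head _ hk, hN.cost _ hk]
    simp [hU, hV, hβ]
  potential_iff x := by
    rw [hN.potential_iff (oddExt_neg x), h.feasible_iff hf]
    refine ⟨fun hx i hi => hx i (by omega), fun hx i _ => ?_⟩
    obtain hi | hi := lt_or_ge i (I.m + I.n)
    · exact hx i hi
    · obtain ⟨hU, hV, hβ⟩ := h.trivial i hi
      simp [hU, hV, hβ]

end Represents

/-! ## Reading commands -/

/-- Read the numbers of rows and columns. -/
def headerCmd : Cmd :=
  .write aM 0 (rd aIn 0) ;; .write aN 0 (rd aIn 1) ;; .write aPtr 0 2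

/-- Make an expression the last literal of the current row. -/
def pushCmd (e : Expr) : Cmd :=
  .write aPrev (var cVar) (rd aLit (var cVar)) ;; .write aLit (var cVar) e

/-- Read an entry of the current row. -/
def entryCmd : Cmd :=
  .ite (rd aIn (var aPtr)) (pushCmd (var cMap + 1))
    (.ite (0 - rd aIn (var aPtr)) (pushCmd (0 - (var cMap + 1))) .skip) ;;
  .write aPtr 0 (var aPtr + 1)

/-- Read the matrix. -/
def matrixCmd : Cmd := upTo aM cVar (upTo aN cMap entryCmd)

/-- Append the literals of the constraints `0 ≤ x j + x j`. -/
def nonnegCmd : Cmd :=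
  upTo aN cVar (.write aLit (var aM + var cVar) (var cVar + 1) ;;
    .write aPrev (var aM + var cVar) (var cVar + 1))

/-- Store the current arc. -/
def arcCmd : Cmd :=
  .ite (oddE (var cArc))
    (.write aTail (var cArc) (rd aPrev (var cArc / 2)) ;;
     .write aHead (var cArc) (0 - rd aLit (var cArc / 2)))
    (.write aTail (var cArc) (rd aLit (var cArc / 2)) ;;
     .write aHead (var cArc) (0 - rd aPrev (var cArc / 2))) ;;
  .ite (var aM - var cArc / 2) (.write aCost (var cArc) (rd aIn (var aPtr + var cArc / 2)))
    (.write aCost (var cArc) 0)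

/-- Read the constraints. -/
def constraintsCmd : Cmd := headerCmd ;; matrixCmd ;; nonnegCmd

/-- Read the constraints, and store their network. -/
def networkCmd : Cmd := constraintsCmd ;; .rep cArc arcCmd

theorem run_entryCmd (S : ℕ) {i k : ℕ} {M : Mem} (hi : M cVar 0 = i) (hk : M cMap 0 = k) :
    entryCmd.run S M aLit = Function.update (M aLit) i
      (pushLiteral (M aIn (M aPtr 0)) k (M aLit i, M aPrev i)).1 ∧
    entryCmd.run S M aPrev = Function.update (M aPrev) i
      (pushLiteral (M aIn (M aPtr 0)) k (M aLit i, M aPrev i)).2 ∧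
    entryCmd.run S M aPtr 0 = M aPtr 0 + 1 := by
  rw [entryCmd, run_seq, run_ite, run_ite, pushCmd, pushCmd]
  simp only [Expr.val_read, Expr.val_var, Expr.val_sub, Expr.val_zero, zero_sub, Left.neg_pos_iff,
    pushLiteral]
  split_ifs <;> simp [run_seq, run_write, run_skip, Mem.store_apply, hk, hi]

section Run

variable {S m n : ℕ} {M : Mem}

theorem run_upTo_entryCmd (hn : M aN 0 = n) (hnS : n ≤ S) {i : ℕ} (hi : M cVar 0 = i)
    (hptr : M aPtr 0 = 2 + i * n) (hlit : M aLit i = 0) (hprev : M aPrev i = 0) :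
    (upTo aN cMap entryCmd).run S M aLit =
      Function.update (M aLit) i (rowLiterals (M aIn) n i).1 ∧
    (upTo aN cMap entryCmd).run S M aPrev =
      Function.update (M aPrev) i (rowLiterals (M aIn) n i).2 ∧
    (upTo aN cMap entryCmd).run S M aPtr 0 = 2 + i * n + n := by
  set l := literals fun j => M aIn (2 + (i : ℤ) * n + j)
  refine run_upTo_induction (by decide) hn hnS
    (I := fun k N => N aLit = Function.update (M aLit) i (l k).1 ∧
      N aPrev = Function.update (M aPrev) i (l k).2 ∧ N aPtr 0 = 2 + i * n + k) ?_ ?_ ?_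
  · intro k N v h
    simpa (disch := decide) only [Mem.store_of_ne] using h
  · exact ⟨(Function.update_eq_self_iff.2 hlit.symm).symm,
      (Function.update_eq_self_iff.2 hprev.symm).symm, by simpa using hptr⟩
  · rintro k - N hN hNk ⟨hlit', hprev', hptr'⟩
    obtain ⟨hlit'', hprev'', hptr''⟩ := run_entryCmd S ((hN cVar (by decide)).symm ▸ hi) hNk
    rw [hlit'', hprev'', hptr'', hlit', hprev', hptr', hN aIn (by decide)]
    simp only [Function.update_idem, Function.update_self]
    exact ⟨rfl, rfl, by push_cast; ring⟩

theorem run_matrixCmd (hm : M aM 0 = m) (hn : M aN 0 = n) (hmS : m ≤ S) (hnS : n ≤ S)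
    (hptr : M aPtr 0 = 2) (hlit : M aLit = 0) (hprev : M aPrev = 0) :
    (∀ i : ℕ, matrixCmd.run S M aLit i = if i < m then (rowLiterals (M aIn) n i).1 else 0) ∧
    (∀ i : ℕ, matrixCmd.run S M aPrev i = if i < m then (rowLiterals (M aIn) n i).2 else 0) ∧
    matrixCmd.run S M aPtr 0 = 2 + m * n := by
  refine run_upTo_induction (by decide) hm hmS (I := fun k N =>
    (∀ i : ℕ, N aLit i = if i < k then (rowLiterals (M aIn) n i).1 else 0) ∧
    (∀ i : ℕ, N aPrev i = if i < k then (rowLiterals (M aIn) n i).2 else 0) ∧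
    N aPtr 0 = 2 + k * n) ?_ ?_ ?_
  · intro k N v h
    simpa (disch := decide) only [Mem.store_of_ne] using h
  · simp [hptr, hlit, hprev]
  · rintro k - N hN hNk ⟨hlit', hprev', hptr'⟩
    obtain ⟨hlit'', hprev'', hptr''⟩ := run_upTo_entryCmd ((hN aN (by decide)).symm ▸ hn) hnS hNk
      hptr' (by simp [hlit']) (by simp [hprev'])
    rw [hlit'', hprev'', hptr'', hN aIn (by decide)]
    refine ⟨fun i => ?_, fun i => ?_, by push_cast; ring⟩
    all_goals
      simp only [Function.update_apply, Nat.cast_inj, hlit', hprev', Nat.lt_succ_iff_lt_or_eq]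
      split_ifs <;> grind

theorem run_nonnegCmd (hm : M aM 0 = m) (hn : M aN 0 = n) (hnS : n ≤ S) (u : ℤ) :
    nonnegCmd.run S M aLit u = (if m ≤ u ∧ u < m + n then u - m + 1 else M aLit u) ∧
    nonnegCmd.run S M aPrev u = (if m ≤ u ∧ u < m + n then u - m + 1 else M aPrev u) := by
  constructor
  all_goals
    refine run_upTo_map (by decide) hn hnS (by decide) m (fun k => k + 1) (fun k _ N hN hNk => ?_) u
    simp [run_seq, run_write, Mem.store_apply, hN aM (by decide), hm, hNk]

theorem run_arcCmd (S : ℕ) (M : Mem) :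
    arcCmd.run S M aTail = Function.update (M aTail) (M cArc 0)
      (if Odd (M cArc 0) then M aPrev (M cArc 0 / 2) else M aLit (M cArc 0 / 2)) ∧
    arcCmd.run S M aHead = Function.update (M aHead) (M cArc 0)
      (if Odd (M cArc 0) then -M aLit (M cArc 0 / 2) else -M aPrev (M cArc 0 / 2)) ∧
    arcCmd.run S M aCost = Function.update (M aCost) (M cArc 0)
      (if M cArc 0 / 2 < M aM 0 then M aIn (M aPtr 0 + M cArc 0 / 2) else 0) := by
  rw [arcCmd, run_seq, run_ite, run_ite]
  simp only [val_oddE_pos, Expr.val_var, Expr.val_sub, Expr.val_div, Expr.val_two, sub_pos]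
  split_ifs <;> simp_all [run_seq, run_write, Mem.store_apply]

theorem run_rep_arcCmd {k : ℕ} (hk : k < S) :
    (Cmd.rep cArc arcCmd).run S M aTail k =
      (if Odd k then M aPrev (k / 2 : ℕ) else M aLit (k / 2 : ℕ)) ∧
    (Cmd.rep cArc arcCmd).run S M aHead k =
      (if Odd k then -M aLit (k / 2 : ℕ) else -M aPrev (k / 2 : ℕ)) ∧
    (Cmd.rep cArc arcCmd).run S M aCost k =
      if (k / 2 : ℕ) < M aM 0 then M aIn (M aPtr 0 + (k / 2 : ℕ)) else 0 := by
  have mem_range : -(0 : ℤ) ≤ k ∧ (k : ℤ) < S - 0 := by omega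
  simp only [← Int.odd_coe_nat k, Nat.cast_ofNat, Int.natCast_ediv]
  refine ⟨?_, ?_, ?_⟩
  · rw [run_rep_map (by decide) 0
      fun k _ => if Odd k then M aPrev (k / 2) else M aLit (k / 2), if_pos mem_range]
    intro k _ N hN hNk
    rw [(run_arcCmd S N).1, hNk, hN aPrev (by decide), hN aLit (by decide), sub_zero]
  · rw [run_rep_map (by decide) 0
      fun k _ => if Odd k then -M aLit (k / 2) else -M aPrev (k / 2), if_pos mem_range]
    intro k _ N hN hNk
    rw [(run_arcCmd S N).2.1, hNk, hN aPrev (by decide), hN aLit (by decide), sub_zero]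
  · rw [run_rep_map (by decide) 0
      fun k _ => if k / 2 < M aM 0 then M aIn (M aPtr 0 + k / 2) else 0, if_pos mem_range]
    intro k _ N hN hNk
    rw [(run_arcCmd S N).2.2, hNk, hN aM (by decide), hN aPtr (by decide), hN aIn (by decide),
      sub_zero]

theorem run_headerCmd (S : ℕ) (M : Mem) : headerCmd.run S M aM 0 = M aIn 0 ∧
    headerCmd.run S M aN 0 = M aIn 1 ∧ headerCmd.run S M aPtr 0 = 2 := by
  simp [headerCmd, run_seq, run_write, Mem.store_apply]

end Run

theorem Encodes.run_constraintsCmd {I : UTVPIProblem} {M : Mem} {S : ℕ}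
    (hI : Encodes I (M aIn)) (hm : I.m ≤ S) (hn : I.n ≤ S) (hlit : M aLit = 0)
    (hprev : M aPrev = 0) :
    Lists I (M aIn) (fun i => constraintsCmd.run S M aLit i)
      (fun i => constraintsCmd.run S M aPrev i)
      (fun i => if i < I.m then M aIn (2 + (I.m : ℤ) * I.n + i) else 0) ∧
    constraintsCmd.run S M aM 0 = I.m ∧ constraintsCmd.run S M aN 0 = I.n ∧
    constraintsCmd.run S M aPtr 0 = 2 + I.m * I.n := by
  obtain ⟨hm₁, hn₁, hptr₁⟩ := run_headerCmd S M
  have hM₁ : ∀ b ∉ headerCmd.writes, headerCmd.run S M b = M b := fun b hb => run_frame _ _ hb _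
  obtain ⟨hlit₂, hprev₂, hptr₂⟩ := run_matrixCmd (hm₁.trans hI.rows) (hn₁.trans hI.cols) hm hn
    hptr₁ ((hM₁ _ (by decide)).trans hlit) ((hM₁ _ (by decide)).trans hprev)
  set M₁ := headerCmd.run S M
  set M₂ := matrixCmd.run S M₁
  have run_eq : constraintsCmd.run S M = nonnegCmd.run S M₂ := rfl
  have hM₂ : ∀ b ∉ matrixCmd.writes, M₂ b = M₁ b := fun b hb => run_frame _ _ hb _
  have hM₃ : ∀ b ∉ nonnegCmd.writes, nonnegCmd.run S M₂ b = M₂ b := fun b hb => run_frame _ _ hb _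
  have hm₂ : M₂ aM 0 = I.m := by rw [hM₂ aM (by decide), hm₁, hI.rows]
  have hn₂ : M₂ aN 0 = I.n := by rw [hM₂ aN (by decide), hn₁, hI.cols]
  refine ⟨?_, ?_, ?_, ?_⟩
  · rw [run_eq, ← hM₁ aIn (by decide)]
    constructor
    all_goals
      intro i hi
      rw [(run_nonnegCmd hm₂ hn₂ hn _).1, (run_nonnegCmd hm₂ hn₂ hn _).2, hlit₂, hprev₂]
      split_ifs <;> grind [rowLiterals]
  · rw [run_eq, hM₃ aM (by decide), hm₂]
  · rw [run_eq, hM₃ aN (by decide), hn₂]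
  · rw [run_eq, hM₃ aPtr (by decide), hptr₂]

theorem Encodes.run_networkCmd {I : UTVPIProblem} {M : Mem} {S : ℕ} (hI : Encodes I (M aIn))
    (hmn : 2 * (I.m + I.n) ≤ S) (hsize : M aSize 0 = S) (hlit : M aLit = 0) (hprev : M aPrev = 0) :
    (∃ N : Network ℤ, N.size = S ∧ Holds N I.n (networkCmd.run S M) ∧ Represents I N) ∧
    networkCmd.run S M aM 0 = I.m ∧ networkCmd.run S M aPtr 0 = 2 + I.m * I.n := by
  obtain ⟨lists, hm, hn, hptr⟩ := hI.run_constraintsCmd (S := S) (by omega) (by omega) hlit hprev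
  have hM' : ∀ b ∉ constraintsCmd.writes, constraintsCmd.run S M b = M b :=
    fun b hb => run_frame _ _ hb _
  have hM'' : ∀ b ∉ (Cmd.rep cArc arcCmd).writes,
    networkCmd.run S M b = constraintsCmd.run S M b := fun b hb => run_frame _ _ hb _
  refine ⟨⟨⟨S, networkCmd.run S M aTail, networkCmd.run S M aHead, networkCmd.run S M aCost⟩, rfl,
    ⟨?_, ?_, rfl, rfl, rfl⟩, lists.represents hI ⟨?_, ?_, ?_⟩ hmn⟩, ?_, ?_⟩
  · rw [hM'' aSize (by decide), hM' aSize (by decide), hsize]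
  · rw [hM'' aN (by decide), hn]
  · exact fun k hk => (run_rep_arcCmd hk).1
  · exact fun k hk => (run_rep_arcCmd hk).2.1
  · intro k hk
    refine (run_rep_arcCmd hk).2.2.trans ?_
    rw [hm, hptr, hM' aIn (by decide)]
    simp only [Nat.cast_lt]
  · rw [hM'' aM (by decide), hm]
  · rw [hM'' aPtr (by decide), hptr]

/-! ## Weight commands -/

/-- A step of the binary multiplication of `aMul` by `aBits`. -/
def mulStepCmd : Cmd :=
  .ite (oddE (var aBits)) (.write aAcc 0 (var aAcc + var aMul)) .skip ;;
  .write aMul 0 (var aMul + var aMul) ;; .write aBits 0 (var aBits / 2)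

/-- Multiply the weight of variable `cBit` by the content of `aBits`. -/
def mulCmd : Cmd :=
  (.write aAcc 0 0 ;; .write aMul 0 (rd aWeight (var cBit + 1))) ;;
  .rep cMap mulStepCmd ;; .write aWeight (var cBit + 1) (var aAcc)

/-- Read the factor `cVar` of the weight of variable `cBit`. -/
def factorCmd : Cmd :=
  .write aBits 0 (rd aIn (var aPtr + var aM + var aN + var cVar)) ;;
  ifEq (var cVar) (var cBit) (.write aBits 0 (rd aIn (var aPtr + var aM + var cVar)))

/-- Compute the weights, multiplied by the product of their denominators. -/
def weightCmd : Cmd :=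
  upTo aN cBit (.write aWeight (var cBit + 1) 1 ;; upTo aN cVar (factorCmd ;; mulCmd))

/-- The factor `i` of the scaled weight `j` in the input `f`, whose `m` right-hand sides start at
`c`: the numerator of the weight `j` itself, and the denominators of all others. -/
def factor (f : ℤ → ℤ) (c : ℤ) (m n : ℕ) (j i : ℤ) : ℤ :=
  if i = j then f (c + m + i) else f (c + m + n + i)

theorem run_mulStepCmd (S : ℕ) (M : Mem) :
    mulStepCmd.run S M aAcc 0 + mulStepCmd.run S M aMul 0 * mulStepCmd.run S M aBits 0 =
      M aAcc 0 + M aMul 0 * M aBits 0 ∧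
    mulStepCmd.run S M aBits 0 = M aBits 0 / 2 := by
  rw [mulStepCmd, run_seq, run_seq, run_ite, run_write, run_write]
  simp only [val_oddE_pos, Expr.val_var]
  split_ifs with hodd
  · have : 2 * (M aBits 0 / 2) + 1 = M aBits 0 := Int.two_mul_ediv_two_add_one_of_odd hodd
    simp only [run_write, Expr.val_zero, Expr.val_add, Expr.val_var, Mem.store_apply,
      Nat.succ_ne_self, ↓reduceIte, Expr.val_div, Nat.reduceEqDiff, Expr.val_two,
      Function.update_self, and_true]
    linear_combination M aMul 0 * this
  · have : 2 * (M aBits 0 / 2) = M aBits 0 :=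
      Int.two_mul_ediv_two_of_even (Int.not_odd_iff_even.1 hodd)
    simp only [run_skip, Expr.val_zero, Expr.val_add, Expr.val_var, Expr.val_div,
      Mem.store_apply, Nat.succ_ne_self, ↓reduceIte, Expr.val_two, Nat.reduceEqDiff,
      Function.update_self, add_right_inj, and_true]
    linear_combination M aMul 0 * this

theorem run_rep_mulStepCmd {S : ℕ} {M : Mem} (hbits : 0 ≤ M aBits 0) (hS : M aBits 0 < 2 ^ S) :
    (Cmd.rep cMap mulStepCmd).run S M aAcc 0 = M aAcc 0 + M aMul 0 * M aBits 0 := by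
  obtain ⟨hprod, hzero⟩ := run_rep_induction (S := S) (a := cMap) (c := mulStepCmd) (M := M)
    (I := fun t N => N aAcc 0 + N aMul 0 * N aBits 0 = M aAcc 0 + M aMul 0 * M aBits 0 ∧
      N aBits 0 = M aBits 0 / 2 ^ t) (by simp [Mem.store_apply]) fun t _ N _ _ ⟨hprod, hhalf⟩ => by
    obtain ⟨hprod', hhalf'⟩ := run_mulStepCmd S N
    simp only [Mem.store_of_ne _ (show aAcc ≠ cMap by decide),
      Mem.store_of_ne _ (show aMul ≠ cMap by decide),
      Mem.store_of_ne _ (show aBits ≠ cMap by decide)]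
    rw [hprod', hhalf', hprod, hhalf, Int.ediv_ediv_of_nonneg (by positivity), pow_succ]
    exact ⟨rfl, rfl⟩
  rwa [hzero, Int.ediv_eq_zero_of_lt hbits hS, mul_zero, add_zero] at hprod

theorem run_mulCmd {S : ℕ} {M : Mem} {j : ℤ} (hj : M cBit 0 = j) (hbits : 0 ≤ M aBits 0)
    (hS : M aBits 0 < 2 ^ S) : mulCmd.run S M aWeight =
      Function.update (M aWeight) (j + 1) (M aWeight (j + 1) * M aBits 0) := by
  rw [mulCmd, run_seq, run_seq]
  set M₁ := (Cmd.write aAcc 0 0 ;; .write aMul 0 (rd aWeight (var cBit + 1))).run S M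
  have hM₁ : ∀ b ∉ [aAcc, aMul], M₁ b = M b := fun b hb => run_frame _ _ hb _
  have hacc : M₁ aAcc 0 = 0 := by simp [M₁, run_seq, run_write, Mem.store_apply]
  have hmul : M₁ aMul 0 = M aWeight (j + 1) := by
    simp [M₁, run_seq, run_write, Mem.store_apply, hj]
  have hbits₁ : M₁ aBits 0 = M aBits 0 := by rw [hM₁ _ (by decide)]
  have hprod := run_rep_mulStepCmd (hbits₁.symm ▸ hbits) (hbits₁.symm ▸ hS)
  rw [run_write, Mem.store_self]
  simp only [Expr.val_add, Expr.val_var, Expr.val_one]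
  rw [hprod, hacc, hmul, hbits₁, zero_add, run_frame S _ (by decide), run_frame S _ (by decide),
    hM₁ _ (by decide), hM₁ _ (by decide), hj]

section Run

variable {S m n : ℕ} {M : Mem} {c : ℤ} {f : ℤ → ℤ}

theorem run_factorCmd (hf : M aIn = f) (hc : M aPtr 0 = c) (hm : M aM 0 = m) (hn : M aN 0 = n)
    {i j : ℤ} (hi : M cVar 0 = i) (hj : M cBit 0 = j) :
    factorCmd.run S M aBits 0 = factor f c m n j i := by
  rw [factorCmd, run_seq, run_ifEq, factor]
  obtain rfl | hij := eq_or_ne i j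
  · simp [run_write, Mem.store_apply, hf, hc, hm, hi, hj]
  · simp [run_write, Mem.store_apply, hf, hc, hm, hn, hi, hj, hij]

theorem run_upTo_factorCmd (hf : M aIn = f) (hc : M aPtr 0 = c) (hm : M aM 0 = m) (hn : M aN 0 = n)
    (hnS : n ≤ S) {j : ℤ} (hj : M cBit 0 = j)
    (hfactor : ∀ i < n, 0 ≤ factor f c m n j i ∧ factor f c m n j i < 2 ^ S)
    (hone : M aWeight (j + 1) = 1) :
    (upTo aN cVar (factorCmd ;; mulCmd)).run S M aWeight =
      Function.update (M aWeight) (j + 1) (∏ i ∈ Finset.range n, factor f c m n j i) := by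
  refine run_upTo_induction (by decide) hn hnS (I := fun k N => N aWeight =
    Function.update (M aWeight) (j + 1) (∏ i ∈ Finset.range k, factor f c m n j i)) ?_ ?_ ?_
  · intro k N v h
    simpa (disch := decide) only [Mem.store_of_ne] using h
  · exact (Function.update_eq_self_iff.2 hone.symm).symm
  · intro k hk N hN hNk ih
    have hbits := run_factorCmd (S := S) ((hN _ (by decide)).trans hf)
      (hN aPtr (by decide) ▸ hc) (hN aM (by decide) ▸ hm) (hN aN (by decide) ▸ hn) hNk
      (hN cBit (by decide) ▸ hj)
    rw [run_seq, run_mulCmd (j := j) (by rw [run_frame S _ (by decide), hN _ (by decide), hj])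
      (hbits ▸ (hfactor k hk).1) (hbits ▸ (hfactor k hk).2), hbits, run_frame S _ (by decide), ih,
      Finset.prod_range_succ, Function.update_idem, Function.update_self]

theorem run_weightCmd (hf : M aIn = f) (hc : M aPtr 0 = c) (hm : M aM 0 = m) (hn : M aN 0 = n)
    (hnS : n ≤ S) (hfactor : ∀ j < n, ∀ i < n,
      0 ≤ factor f c m n j i ∧ factor f c m n j i < 2 ^ S) (hW : M aWeight = 0) (u : ℤ) :
    weightCmd.run S M aWeight u =
      if 1 ≤ u ∧ u < 1 + n then ∏ i ∈ Finset.range n, factor f c m n (u - 1) i else 0 := by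
  refine (run_upTo_map (by decide) hn hnS (by decide) 1
    (fun j => ∏ i ∈ Finset.range n, factor f c m n j i) (fun k hk N hN hNk => ?_) u).trans
    (by rw [hW]; rfl)
  rw [run_seq]
  set N₁ := (Cmd.write aWeight (var cBit + 1) 1).run S N
  have hN₁ : ∀ b ∉ [aWeight], N₁ b = N b := fun b hb => run_frame _ _ hb _
  have hW₁ : N₁ aWeight = Function.update (N aWeight) (k + 1) 1 := by
    simp [N₁, run_write, hNk]
  rw [run_upTo_factorCmd (f := f) (c := c) (m := m) (n := n) (j := k), hW₁, Function.update_idem,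
    add_comm (1 : ℤ)]
  · rw [hN₁ _ (by decide), hN _ (by decide), hf]
  · rw [hN₁ _ (by decide), hN _ (by decide), hc]
  · rw [hN₁ _ (by decide), hN _ (by decide), hm]
  · rw [hN₁ _ (by decide), hN _ (by decide), hn]
  · exact hnS
  · rw [hN₁ _ (by decide), hNk]
  · exact hfactor k hk
  · rw [hW₁, Function.update_self]

end Run

end UTVPI

namespace RAM

open Cmd

/-! ## Computing the size of the input -/

theorem initMem_zero (l : List ℤ) (k : ℕ) : initMem l 0 k = l.getD k 0 := by
  simp [initMem]

theorem length_le_inputSize (l : List ℤ) : l.length ≤ inputSize l := by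
  simpa only [inputSize, List.length_map, smul_eq_mul, mul_one] using
    List.card_nsmul_le_sum (l.map bitLength) 1 (by simp [bitLength])

theorem natAbs_le_of_mem {l : List ℤ} {x : ℤ} (hx : x ∈ l) : x.natAbs ≤ 2 ^ inputSize l := by
  have hlen : bitLength x ≤ inputSize l := List.single_le_sum (by simp) _ (List.mem_map_of_mem hx)
  calc x.natAbs ≤ 2 ^ Nat.size x.natAbs := (Nat.lt_size_self _).le
    _ ≤ 2 ^ inputSize l := Nat.pow_le_pow_right two_pos ((Nat.le_succ _).trans hlen)

theorem bitBounded_initMem (l : List ℤ) : (initMem l).BitBounded (inputSize l) := by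
  intro a i
  unfold initMem
  split_ifs
  · by_cases h : i.toNat < l.length
    · rw [List.getD_eq_getElem _ _ h]
      exact natAbs_le_of_mem (List.getElem_mem h)
    · rw [List.getD_eq_default _ _ (not_lt.1 h)]
      exact Nat.zero_le _
  · rw [Int.natAbs_natCast]
    exact (length_le_inputSize l).trans Nat.lt_two_pow_self.le
  · simp

theorem inputSize_drop {l : List ℤ} {k : ℕ} (hk : k < l.length) :
    inputSize (l.drop k) = Nat.size (l.getD k 0).natAbs + 1 + inputSize (l.drop (k + 1)) := by
  rw [List.drop_eq_getElem_cons hk, List.getD_eq_getElem _ _ hk]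
  rfl

theorem size_div_two {t : ℕ} (ht : 0 < t) : Nat.size t = Nat.size (t / 2) + 1 := by
  conv_lhs => rw [← Nat.bit_bodd_div2 t]
  rw [Nat.size_bit (by rw [Nat.bit_bodd_div2]; omega), Nat.div2_val]

/-- Count one bit of the input: of the number in `aRest`, or the sign bit of the next entry. -/
def countCmd : Cmd :=
  .ite (var aRest) (.write aRest 0 (var aRest / 2))
    (.write aRest 0 (rd aIn (var aPos)) ;;
      .ite (0 - var aRest) (.write aRest 0 (0 - var aRest)) .skip ;;
      .write aPos 0 (var aPos + 1)) ;;
  .write aCount 0 (var aCount + 1)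

/-- The number of entries of the input not yet read plus the number whose bits are being counted:
this is positive until all bits are counted. -/
def uncounted : Expr := var aInLen - var aPos + var aRest

/-- Compute the size of the input. -/
def sizeProgram : Program :=
  .seq (.loop uncounted countCmd.toProgram) (Cmd.write aSize 0 (var aCount)).toProgram

theorem run_countCmd (S : ℕ) (M : Mem) :
    countCmd.run S M aCount 0 = M aCount 0 + 1 ∧
    (0 < M aRest 0 → countCmd.run S M aRest 0 = M aRest 0 / 2 ∧
      countCmd.run S M aPos 0 = M aPos 0) ∧
    (M aRest 0 ≤ 0 → countCmd.run S M aRest 0 = (M aIn (M aPos 0)).natAbs ∧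
      countCmd.run S M aPos 0 = M aPos 0 + 1) := by
  simp only [countCmd, run_seq, run_ite, run_write, run_skip]
  refine ⟨?_, fun h => ?_, fun h => ?_⟩ <;> split_ifs <;>
    simp_all [Mem.store_apply] <;> grind

/-- After `j` steps of the count, the input from position `k` on and the bits of `t` remain. -/
def Counting (l : List ℤ) (j : ℕ) (M : Mem) : Prop :=
  ∃ k t : ℕ, k ≤ l.length ∧ M aPos 0 = k ∧ M aRest 0 = t ∧ M aCount 0 = j ∧
    j + Nat.size t + inputSize (l.drop k) = inputSize l

theorem Counting.run_countCmd {l : List ℤ} {j : ℕ} {M : Mem} (hM : Counting l j M)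
    (hin : M aIn = initMem l aIn) (hj : j < inputSize l) (S : ℕ) :
    Counting l (j + 1) (countCmd.run S M) := by
  obtain ⟨k, t, hk, hpos, hrest, hcount, hsize⟩ := hM
  obtain ⟨hcount', hhalf, hnext⟩ := RAM.run_countCmd S M
  rw [hcount] at hcount'
  rcases t.eq_zero_or_pos with rfl | ht
  · obtain ⟨hrest', hpos'⟩ := hnext hrest.le
    rw [hpos] at hpos' hrest'
    rw [hin, initMem_zero] at hrest'
    rcases hk.eq_or_lt with rfl | hk
    · rw [List.drop_length, Nat.size_zero, add_zero] at hsize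
      exact absurd hsize hj.ne
    rw [inputSize_drop hk, Nat.size_zero] at hsize
    exact ⟨k + 1, _, hk, hpos', hrest', hcount', by omega⟩
  · obtain ⟨hrest', hpos'⟩ := hhalf (by rw [hrest]; exact_mod_cast ht)
    rw [size_div_two ht] at hsize
    exact ⟨k, t / 2, hk, hpos'.trans hpos, by rw [hrest', hrest]; rfl, hcount', by omega⟩

theorem counting_iterate (l : List ℤ) (S : ℕ) {j : ℕ} (hj : j ≤ inputSize l) :
    Counting l j ((countCmd.run S)^[j] (initMem l)) := by
  induction j with
  | zero => exact ⟨0, 0, by simp [initMem]⟩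
  | succ j ih =>
    rw [Function.iterate_succ_apply']
    exact (ih (by omega)).run_countCmd (iterate_run_frame S (by decide) _ _) hj S

theorem Counting.uncounted_pos {l : List ℤ} {j : ℕ} {M : Mem} (hM : Counting l j M)
    (hlen : M aInLen 0 = l.length) (hj : j < inputSize l) : 0 < uncounted.val M := by
  obtain ⟨k, t, hk, hpos, hrest, -, hsize⟩ := hM
  simp only [uncounted, Expr.val_add, Expr.val_sub, Expr.val_var, hlen, hpos, hrest]
  by_contra! h
  obtain rfl : k = l.length := by omega
  obtain rfl : t = 0 := by omega
  rw [List.drop_length, Nat.size_zero, add_zero] at hsize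
  exact hj.ne hsize

theorem Counting.uncounted_nonpos {l : List ℤ} {M : Mem} (hM : Counting l (inputSize l) M)
    (hlen : M aInLen 0 = l.length) : uncounted.val M ≤ 0 := by
  obtain ⟨k, t, hk, hpos, hrest, -, hsize⟩ := hM
  have ht : t = 0 := Nat.size_eq_zero.1 (by omega)
  have hdrop := length_le_inputSize (l.drop k)
  rw [List.length_drop] at hdrop
  simp only [uncounted, Expr.val_add, Expr.val_sub, Expr.val_var, hlen, hpos, hrest]
  omega

/-- The memory when all bits of the input are counted. -/
def countedMem (l : List ℤ) : Mem := (countCmd.run 0)^[inputSize l] (initMem l)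

theorem countedMem_frame (l : List ℤ) {b : ℕ} (hb : b ∉ countCmd.writes) :
    countedMem l b = initMem l b :=
  iterate_run_frame 0 hb _ _

theorem countedMem_count (l : List ℤ) : countedMem l aCount 0 = inputSize l :=
  let ⟨_, _, _, _, _, hcount, _⟩ := counting_iterate l 0 le_rfl
  hcount

theorem wf_countCmd : countCmd.WF := by
  unfold countCmd
  repeat' first | exact trivial | rfl | decide | apply And.intro

theorem exec_count_loop : ∃ G Q : Polynomial ℕ, ∀ l : List ℤ,
    (countedMem l).BitBounded (G.eval (inputSize l)) ∧ ∃ t ≤ Q.eval (inputSize l),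
      Exec (.loop uncounted countCmd.toProgram) (initMem l) t (countedMem l) := by
  obtain ⟨G, Q, hcount⟩ := wf_countCmd.exists_polyBounded
  refine ⟨.X + .X * .C (G.eval 0),
    (.X + 1) * (.C (uncounted.costBound.eval 0 + Q.eval 0 + 1) * (.X + .X * .C (G.eval 0) + 1)),
    fun l => ?_⟩
  have hsize : initMem l aSize 0 = (0 : ℕ) := by simp [initMem]
  have hlen (n : ℕ) : (countCmd.run 0)^[n] (initMem l) aInLen 0 = l.length := by
    rw [iterate_run_frame 0 (by decide)]
    simp [initMem]
  have hbits := bitBounded_initMem l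
  constructor
  · simpa [countedMem] using hcount.bitBounded_iterate (by decide) hsize hbits (inputSize l)
  · simpa [countedMem] using hcount.exec_loop (e := uncounted) (by decide)
      ⟨⟨trivial, trivial⟩, trivial⟩ hsize hbits
      (fun j hj => (counting_iterate l 0 hj.le).uncounted_pos (hlen j) hj)
      ((counting_iterate l 0 le_rfl).uncounted_nonpos (hlen _))

theorem exec_sizeProgram : ∃ G Q : Polynomial ℕ, ∀ l : List ℤ, ∃ M : Mem,
    (∃ t ≤ Q.eval (inputSize l), Exec sizeProgram (initMem l) t M) ∧
    M.BitBounded (G.eval (inputSize l)) ∧ M aSize 0 = inputSize l ∧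
    ∀ b ∉ [aSize, aPos, aRest, aCount], M b = initMem l b := by
  obtain ⟨G, Q, hloop⟩ := exec_count_loop
  have hwrite := polyBounded_write (a := aSize) (i := 0) (e := var aCount) trivial trivial
  set G' : Polynomial ℕ := .C (var aCount).weight * (.X + 1)
  set Q' : Polynomial ℕ := Expr.costBound 0 + (var aCount).costBound + 1
  refine ⟨G + .C (G'.eval 0), Q + .C (Q'.eval 0) * (G + 1), fun l => ?_⟩
  obtain ⟨hbits, t, ht, hexec⟩ := hloop l
  have hsize : countedMem l aSize 0 = (0 : ℕ) := by
    rw [countedMem_frame l (by decide)]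
    simp [initMem]
  obtain ⟨hbits', t', ht', hexec'⟩ := hwrite hsize hbits
  refine ⟨_, ⟨t + t', ?_, hexec.seq hexec'⟩, ?_, ?_, fun b hb => ?_⟩
  · simpa using add_le_add ht ht'
  · simpa using hbits'
  · simpa [run_write, Mem.store_apply] using countedMem_count l
  · have hcount : ∀ a ∈ countCmd.writes, a ∈ [aSize, aPos, aRest, aCount] := by decide
    rw [run_frame _ _ (fun h => hb (List.mem_cons.2 (.inl (List.mem_singleton.1 h)))),
      countedMem_frame l fun h => hb (hcount b h)]

end RAM

namespace UTVPI

open RAM RAM.Cmd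

/-! ## The input -/

theorem getD_append_ofFn {l : List ℤ} {n k : ℕ} (g : Fin n → ℤ) (hl : l.length = k) (r : List ℤ)
    (j : Fin n) : (l ++ List.ofFn g ++ r).getD (k + j) 0 = g j := by
  rw [List.getD_append _ _ _ _ (by simp [hl]), List.getD_append_right _ _ _ _ (by omega), hl,
    Nat.add_sub_cancel_left, List.getD_eq_getElem _ _ (by simp), List.getElem_ofFn]

theorem flatten_ofFn {m n : ℕ} (A : Matrix (Fin m) (Fin n) ℤ) :
    (List.ofFn fun i => List.ofFn (A i)).flatten =
      List.ofFn fun k => (Function.uncurry A) (finProdFinEquiv.symm k) := by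
  rw [List.ofFn_mul]
  refine congrArg _ (congrArg _ (funext fun i => congrArg _ (funext fun j => ?_)))
  refine (congrArg (Function.uncurry A) (finProdFinEquiv.symm_apply_eq (y := (i, j)).2 ?_)).symm
  ext
  simp only [finProdFinEquiv_apply_val]
  ring

theorem getD_append_flatten {m n : ℕ} (A : Matrix (Fin m) (Fin n) ℤ) {l : List ℤ} {k : ℕ}
    (hl : l.length = k) (r : List ℤ) (i : Fin m) (j : Fin n) :
    (l ++ (List.ofFn fun i => List.ofFn (A i)).flatten ++ r).getD (k + (j + n * i)) 0 = A i j := by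
  rw [flatten_ofFn]
  exact (getD_append_ofFn _ hl r (finProdFinEquiv (i, j))).trans
    (congrArg (Function.uncurry A) (finProdFinEquiv.symm_apply_apply (i, j)))

theorem encodes_encode (I : UTVPIProblem) : Encodes I (initMem I.encode 0) where
  rows := by simpa [UTVPIProblem.encode] using initMem_zero I.encode 0
  cols := by simpa [UTVPIProblem.encode] using initMem_zero I.encode 1
  matrix i j := by
    rw [show 2 + (i : ℤ) * I.n + j = ((2 + (j + I.n * i) : ℕ) : ℤ) by push_cast; ring,
      initMem_zero, UTVPIProblem.encode, List.append_assoc, List.append_assoc]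
    exact getD_append_flatten _ rfl _ i j
  rhs i := by
    rw [show 2 + (I.m : ℤ) * I.n + i = ((2 + I.m * I.n + i : ℕ) : ℤ) by push_cast; ring,
      initMem_zero, UTVPIProblem.encode, List.append_assoc, flatten_ofFn]
    exact getD_append_ofFn _ (by simp; omega) _ i
  num j := by
    rw [show 2 + (I.m : ℤ) * I.n + I.m + j = ((2 + I.m * I.n + I.m + j : ℕ) : ℤ) by
      push_cast; ring, initMem_zero, UTVPIProblem.encode, flatten_ofFn]
    exact getD_append_ofFn _ (by simp; omega) _ j
  den j := by
    rw [show 2 + (I.m : ℤ) * I.n + I.m + I.n + j =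
      ((2 + I.m * I.n + I.m + I.n + j : ℕ) : ℤ) by push_cast; ring, initMem_zero,
      UTVPIProblem.encode, flatten_ofFn,
      ← List.append_nil (_ ++ List.ofFn fun j => ((I.w j).den : ℤ))]
    exact getD_append_ofFn (fun j => ((I.w j).den : ℤ)) (by simp; omega) [] j

theorem two_mul_add_le_inputSize (I : UTVPIProblem) : 2 * (I.m + I.n) ≤ inputSize I.encode := by
  have hlen := length_le_inputSize I.encode
  rw [UTVPIProblem.encode, flatten_ofFn] at hlen
  simp only [List.length_append, List.length_cons, List.length_nil, List.length_ofFn] at hlen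
  have := Nat.le_mul_of_pos_right I.m I.n_pos
  rw [UTVPIProblem.encode, flatten_ofFn]
  omega

theorem sum_bitLength_lt (I : UTVPIProblem) :
    ∑ j, (bitLength (I.w j).num + bitLength (I.w j).den) < inputSize I.encode := by
  have : 0 < bitLength I.m := Nat.succ_pos _
  rw [Finset.sum_add_distrib]
  simp only [inputSize, UTVPIProblem.encode, List.map_append, List.sum_append, List.map_cons,
    List.sum_cons, List.map_ofFn, List.sum_ofFn, Function.comp_def]
  omega

theorem lt_two_pow_of_bitLength_le {z : ℤ} {k : ℕ} (h : bitLength z ≤ k) : z < 2 ^ k := by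
  have hlt : z.natAbs < 2 ^ k := Nat.size_le.1 ((Nat.le_succ _).trans h)
  exact Int.le_natAbs.trans_lt (mod_cast hlt)

/-! ## Integral weights -/

/-- The array `W` holds the weights of `I`, multiplied by the product of their denominators, from
cell `1` on, and `S` bits suffice for its entries. -/
structure ScaledWeights (I : UTVPIProblem) (S : ℕ) (W : ℤ → ℤ) : Prop where
  eq_mul (j : Fin I.n) : (W (j + 1) : ℚ) = I.w j * ∏ i, ((I.w i).den : ℚ)
  eq_zero (u : ℤ) : I.n < u → W u = 0
  nonneg (u : ℤ) : 0 ≤ W u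
  lt_two_pow (u : ℤ) : W u < 2 ^ S

section Factor

variable {I : UTVPIProblem} {f : ℤ → ℤ} (hf : Encodes I f)

include hf

theorem Encodes.factor_eq (j i : Fin I.n) : factor f (2 + (I.m : ℤ) * I.n) I.m I.n j i =
    if i = j then (I.w i).num else (I.w i).den := by
  simp only [factor, hf.num i, hf.den i, Int.natCast_inj, Fin.ext_iff]

theorem Encodes.prod_factor (j : Fin I.n) :
    ((∏ i : Fin I.n, factor f (2 + (I.m : ℤ) * I.n) I.m I.n j i : ℤ) : ℚ) =
      I.w j * ∏ i, ((I.w i).den : ℚ) := by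
  have split_factor (i : Fin I.n) : (if i = j then ((I.w i).num : ℚ) else (I.w i).den) =
      (if i = j then I.w i else 1) * (I.w i).den := by
    split_ifs
    exacts [(Rat.mul_den_eq_num _).symm, (one_mul _).symm]
  simp only [hf.factor_eq, Int.cast_prod, Int.cast_ite, Int.cast_natCast, split_factor,
    Finset.prod_mul_distrib, Finset.prod_ite_eq', Finset.mem_univ, if_true]

theorem Encodes.factor_nonneg (j i : Fin I.n) :
    0 ≤ factor f (2 + (I.m : ℤ) * I.n) I.m I.n j i := by
  rw [hf.factor_eq]
  split_ifs
  exacts [Rat.num_nonneg.2 (I.w_nonneg i), Int.natCast_nonneg _]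

theorem Encodes.factor_lt (j i : Fin I.n) : factor f (2 + (I.m : ℤ) * I.n) I.m I.n j i <
    2 ^ (bitLength (I.w i).num + bitLength (I.w i).den) := by
  rw [hf.factor_eq]
  split_ifs <;> exact lt_two_pow_of_bitLength_le (by omega)

theorem Encodes.factor_lt_inputSize (j i : Fin I.n) :
    factor f (2 + (I.m : ℤ) * I.n) I.m I.n j i < 2 ^ inputSize I.encode :=
  (hf.factor_lt j i).trans_le <| pow_le_pow_right₀ one_le_two <|
    (Finset.single_le_sum (f := fun i => bitLength (I.w i).num + bitLength (I.w i).den)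
      (fun _ _ => Nat.zero_le _) (Finset.mem_univ i)).trans (sum_bitLength_lt I).le

theorem Encodes.prod_factor_lt (j : Fin I.n) :
    ∏ i : Fin I.n, factor f (2 + (I.m : ℤ) * I.n) I.m I.n j i < 2 ^ inputSize I.encode :=
  calc _ ≤ ∏ i : Fin I.n, (2 : ℤ) ^ (bitLength (I.w i).num + bitLength (I.w i).den) :=
        Finset.prod_le_prod (fun i _ => hf.factor_nonneg j i) fun i _ => (hf.factor_lt j i).le
    _ = 2 ^ ∑ i, (bitLength (I.w i).num + bitLength (I.w i).den) := Finset.prod_pow_eq_pow_sum _ _ _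
    _ < _ := pow_lt_pow_right₀ one_lt_two (sum_bitLength_lt I)

theorem Encodes.scaledWeights {W : ℤ → ℤ} (hW : ∀ u, W u = if 1 ≤ u ∧ u < 1 + I.n then
    ∏ i ∈ Finset.range I.n, factor f (2 + (I.m : ℤ) * I.n) I.m I.n (u - 1) i else 0) :
    ScaledWeights I (inputSize I.encode) W := by
  have apply_succ (j : Fin I.n) :
      W (j + 1) = ∏ i : Fin I.n, factor f (2 + (I.m : ℤ) * I.n) I.m I.n j i := by
    rw [hW, if_pos (by omega), add_sub_cancel_right, Finset.prod_range]
  have zero_or_succ (u : ℤ) : W u = 0 ∨ ∃ j : Fin I.n, u = j + 1 := by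
    by_cases h : 1 ≤ u ∧ u < 1 + I.n
    · exact .inr ⟨⟨(u - 1).toNat, by omega⟩, by simp only; omega⟩
    · exact .inl ((hW u).trans (if_neg h))
  refine ⟨fun j => ?_, fun u hu => (hW u).trans (if_neg (by omega)), fun u => ?_, fun u => ?_⟩
  · rw [apply_succ, hf.prod_factor]
  · obtain h | ⟨j, rfl⟩ := zero_or_succ u
    · exact h.ge
    · exact apply_succ j ▸ Finset.prod_nonneg fun i _ => hf.factor_nonneg j i
  · obtain h | ⟨j, rfl⟩ := zero_or_succ u
    · exact h ▸ by positivity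
    · exact apply_succ j ▸ hf.prod_factor_lt j

end Factor

section ScaledWeights

variable {I : UTVPIProblem} {S : ℕ} {W : ℤ → ℤ} (hW : ScaledWeights I S W)

include hW

theorem ScaledWeights.sum_mul (x : Fin I.n → ℤ) : ((∑ j : Fin I.n, W (j + 1) * x j : ℤ) : ℚ) =
    I.objective x * ∏ i, ((I.w i).den : ℚ) := by
  rw [UTVPIProblem.objective, Finset.sum_mul, Int.cast_sum]
  refine Finset.sum_congr rfl fun j _ => ?_
  rw [Int.cast_mul, hW.eq_mul]
  ring

theorem ScaledWeights.objective_le {x y : Fin I.n → ℤ} {k : ℤ}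
    (h : ∑ j : Fin I.n, W (j + 1) * x j ≤ k * ∑ j : Fin I.n, W (j + 1) * y j) :
    I.objective x ≤ k * I.objective y := by
  have den_pos : (0 : ℚ) < ∏ i, ((I.w i).den : ℚ) :=
    Finset.prod_pos fun i _ => Nat.cast_pos.2 (I.w i).pos
  refine le_of_mul_le_mul_right ?_ den_pos
  rw [mul_assoc, ← hW.sum_mul, ← hW.sum_mul]
  exact_mod_cast h

theorem ScaledWeights.exists_isOptimal (h : ∃ x, I.Feasible x) : ∃ z, I.IsOptimal z := by
  have sum_nonneg (x : Fin I.n → ℤ) (hx : I.Feasible x) :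
      0 ≤ ∑ j : Fin I.n, W (j + 1) * x j :=
    Finset.sum_nonneg fun j _ => mul_nonneg (hW.nonneg _) (hx.2 j)
  let value (x : Fin I.n → ℤ) : ℕ := (∑ j : Fin I.n, W (j + 1) * x j).toNat
  set z := Function.argminOn value {x | I.Feasible x} h
  have hz : I.Feasible z := Function.argminOn_mem value _ h
  refine ⟨z, hz, fun y hy => ?_⟩
  have hle : value z ≤ value y := Function.argminOn_le value {x | I.Feasible x} hy
  have := hW.objective_le (x := z) (y := y) (k := 1) (by
    rw [one_mul]
    exact (Int.toNat_le.1 hle).trans_eq (Int.toNat_of_nonneg (sum_nonneg y hy)))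
  rwa [Int.cast_one, one_mul] at this

end ScaledWeights

/-! ## The approximation algorithm -/

namespace Network

variable {N : Network ℤ} {n : ℕ} {X₀ X : ℤ → ℤ}

theorem Rounded.two_mul_oddExt_half (hX : N.Rounded (nodes n) X₀ X)
    (heven : ∀ j : ℕ, j < n → Even (X (j + 1))) {u : ℤ} (hu : u ∈ nodes n) :
    2 * oddExt (fun u => X u / 2) u = X u := by
  have two_mul_half {v : ℤ} (hv : v ∈ nodes n) (hpos : 0 < v) : 2 * (X v / 2) = X v := by
    rw [mem_nodes] at hv
    have := heven (v - 1).toNat (by omega)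
    rw [show (((v - 1).toNat : ℕ) : ℤ) + 1 = v by omega] at this
    exact Int.two_mul_ediv_two_of_even this
  obtain hneg | rfl | hpos := lt_trichotomy u 0
  · have := two_mul_half (neg_mem_nodes hu) (by omega)
    rw [← neg_neg u, oddExt_neg, oddExt_of_pos _ (by omega), mul_neg, this, hX.neg _ hu, neg_neg,
      neg_neg]
  · have := hX.neg 0 hu
    rw [neg_zero] at this
    rw [oddExt_zero]
    omega
  · rw [oddExt_of_pos _ hpos, two_mul_half hu hpos]

theorem Rounded.potential_half (hX : N.double.Rounded (nodes n) X₀ X) (hN : N.OnNodes (nodes n))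
    (heven : ∀ j : ℕ, j < n → Even (X (j + 1))) : N.Potential (oddExt fun u => X u / 2) :=
  potential_double_two_mul.1 <| hN.double.potential_congr hX.potential fun _ hu =>
    hX.two_mul_oddExt_half heven hu

/-- Rounding the non-negative half-integer `X₀ u / 2` to an integer at most doubles it. -/
theorem Rounded.half_le (hX : N.Rounded (nodes n) X₀ X) {u : ℤ} (hu : u ∈ nodes n)
    (h₀ : 0 ≤ X₀ u) : X u / 2 ≤ X₀ u := by
  obtain h | ⟨⟨c, hc⟩, -, h | h⟩ := hX.near u hu <;> omega

theorem HasNonnegArcs.nonneg (hA : N.HasNonnegArcs n) {p : ℤ → ℤ} (hp : N.Potential p) {j : ℕ}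
    (hj : j < n) : 0 ≤ p (j + 1) - p (-(j + 1)) := by
  obtain ⟨k, hk, htail, hhead, hcost⟩ := hA j hj
  have := hp hk
  rwa [slack, htail, hhead, hcost, sub_zero] at this

/-- The symmetrization of `p` is twice an optimal half-integral solution by duality, and rounding
loses a factor of at most two. -/
theorem Rounded.sum_mul_half_le {w F p z : ℤ → ℤ}
    (hX : N.double.Rounded (nodes n) (fun u => p u - p (-u)) X) (hN : N.OnNodes (nodes n))
    (hA : N.HasNonnegArcs n) (hw : ∀ u, 0 ≤ w u) (hsol : N.Solves (oddExt w) F p)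
    (hz : N.Potential (oddExt z)) :
    ∑ j : Fin n, w (j + 1) * (X (j + 1) / 2) ≤ 2 * ∑ j : Fin n, w (j + 1) * z (j + 1) := by
  have duality := hsol.complementary.sum_divergence_mul_le hN hz
  simp only [hsol.divergence_eq, sum_oddExt_mul, Finset.sum_range] at duality
  calc _ ≤ ∑ j : Fin n, w (j + 1) * (p (j + 1) - p (-(j + 1))) :=
        Finset.sum_le_sum fun j _ => mul_le_mul_of_nonneg_left (hX.half_le
          (by rw [mem_nodes]; omega) (hA.nonneg hsol.potential j.2)) (hw _)
    _ ≤ _ := duality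
    _ = _ := by
      rw [Finset.mul_sum]
      refine Finset.sum_congr rfl fun j _ => ?_
      rw [oddExt_neg, oddExt_of_pos _ (by omega)]
      ring

end Network

/-- Solve the relaxed problem, and round its solution. -/
def roundedCmd : Cmd := initPotCmd ;; solveCmd ;; symmetrizeCmd ;; roundCmd

/-- The algorithm, once the size of the input is known. -/
def mainCmd : Cmd := networkCmd ;; weightCmd ;; roundedCmd ;; outputCmd

theorem Holds.run_roundedCmd {N : Network ℤ} {n : ℕ} {M : Mem} (hM : Holds N n M)
    (hN : N.OnNodes (nodes n)) (hsym : N.Symmetric (nodes n)) (hA : N.HasNonnegArcs n)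
    (hF : M aFlow = 0) (hp : M aPot = 0) (hW : ∀ u, (n : ℤ) < u → M aWeight u = 0)
    (hW₀ : ∀ u, 0 ≤ M aWeight u) (hW₂ : ∀ u, M aWeight u < 2 ^ N.size)
    {z : ℤ → ℤ} (hz : N.Potential (oddExt z)) :
    ∃ F p : ℤ → ℤ, N.Solves (oddExt (M aWeight)) F p ∧
      N.double.Rounded (nodes n) (fun u => p u - p (-u)) (roundedCmd.run N.size M aPot) ∧
      ∀ j : ℕ, j < n → Even (roundedCmd.run N.size M aPot (j + 1)) := by
  have pot₁ := hM.run_initPotCmd hN hF hp hz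
  have frame₁ : ∀ b ∉ initPotCmd.writes, initPotCmd.run N.size M b = M b :=
    fun b hb => run_frame _ _ hb _
  have holds₁ := hM.run (c := initPotCmd) (by decide) N.size
  set M₁ := initPotCmd.run N.size M
  have weight₁ := frame₁ aWeight (by decide)
  have hsol := holds₁.run_solveCmd hN hA ((frame₁ aFlow (by decide)).trans hF) (weight₁ ▸ hW)
    (weight₁ ▸ hW₀) (weight₁ ▸ hW₂) pot₁
  rw [weight₁] at hsol
  have holds₂ := holds₁.run (c := solveCmd) (by decide) N.size
  set M₂ := solveCmd.run N.size M₁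
  have pot₃ := fun u (hu : u ∈ nodes n) => holds₂.run_symmetrizeCmd_pot hN hu
  have holds₃ := holds₂.run_symmetrizeCmd
  have flow₃ := fun k (hk : k < N.size) => run_symmetrizeCmd_flow N.size M₂ hk
  set M₃ := symmetrizeCmd.run N.size M₂
  have hp₃ : N.double.Potential (M₃ aPot) :=
    hN.double.potential_congr (hsym.potential_double hsol.potential) pot₃
  have hneg₃ : ∀ u ∈ nodes n, M₃ aPot (-u) = -M₃ aPot u := fun u hu => by
    rw [pot₃ u hu, pot₃ _ (neg_mem_nodes hu), neg_neg, neg_sub]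
  obtain ⟨hX, heven⟩ := holds₃.run_roundCmd hN.double hsym.double Network.even_cost_double flow₃
    (Network.potential_double_two_mul.2 hz) (fun u => by rw [oddExt_neg, mul_neg])
    (fun _ => even_two_mul _) hp₃ hneg₃
  exact ⟨_, _, hsol, ⟨hX.potential, hX.neg, fun u hu => pot₃ u hu ▸ hX.near u hu⟩, heven⟩

theorem Holds.run_roundedCmd_double {N : Network ℤ} {M : Mem} {n : ℕ} (hM : Holds N n M) :
    Holds N.double n (roundedCmd.run N.size M) :=
  ((hM.run (c := initPotCmd) (by decide) N.size).run (c := solveCmd) (by decide)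
    N.size).run_symmetrizeCmd.run (c := roundCmd) (by decide) N.size

theorem wf_mainCmd : mainCmd.WF := by
  unfold mainCmd
  repeat' first | exact trivial | rfl | decide | apply And.intro

theorem Holds.isApproxAnswer_run {I : UTVPIProblem} {N : Network ℤ} {M : Mem}
    (hM : Holds N I.n M) (hI : Represents I N) (hF : M aFlow = 0) (hp : M aPot = 0)
    (hW : ScaledWeights I N.size (M aWeight)) :
    I.IsApproxAnswer 2 (output ((roundedCmd ;; outputCmd).run N.size M)) := by
  have holds' : Holds N.double I.n (roundedCmd.run N.size M) := hM.run_roundedCmd_double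
  have rounded (x : Fin I.n → ℤ) (hx : I.Feasible x) :
      N.Potential (oddExt fun u => roundedCmd.run N.size M aPot u / 2) ∧
      ∑ j : Fin I.n, M aWeight (j + 1) * (roundedCmd.run N.size M aPot (j + 1) / 2) ≤
        2 * ∑ j : Fin I.n, M aWeight (j + 1) * x j := by
    obtain ⟨z, hz⟩ : ∃ z : ℤ → ℤ, ∀ j : Fin I.n, z (j + 1) = x j := by
      refine ⟨Function.extend (fun j : Fin I.n => (j + 1 : ℤ)) x 0,
        Function.Injective.extend_apply (f := fun j : Fin I.n => (j + 1 : ℤ)) ?_ x 0⟩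
      exact fun i j h => Fin.ext (by simpa using h)
    have hzp : N.Potential (oddExt z) := (hI.potential_iff z).2 (by simpa only [hz] using hx)
    obtain ⟨F, p, hsol, hX, heven⟩ := hM.run_roundedCmd hI.onNodes hI.symmetric hI.nonnegArcs hF hp
      hW.eq_zero hW.nonneg hW.lt_two_pow hzp
    refine ⟨hX.potential_half hI.onNodes heven, ?_⟩
    simpa only [hz] using hX.sum_mul_half_le hI.onNodes hI.nonnegArcs hW.nonneg hsol hzp
  obtain ⟨hfeas, hout⟩ | ⟨hinfeas, hout⟩ := holds'.run_outputCmd hI.onNodes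
  · have hfeas' := (hI.potential_iff _).1 hfeas
    obtain ⟨z, hz⟩ := hW.exists_isOptimal ⟨_, hfeas'⟩
    exact .inl ⟨_, ⟨hfeas', z, hz, hW.objective_le (rounded z hz.1).2⟩, hout⟩
  · exact .inr ⟨fun ⟨x, hx⟩ => hinfeas (rounded x hx).1, hout⟩

theorem isApproxAnswer_run_mainCmd {I : UTVPIProblem} {M : Mem} (hI : Encodes I (M aIn))
    (hsize : M aSize 0 = inputSize I.encode)
    (hzero : ∀ a ∈ [aLit, aPrev, aFlow, aPot, aWeight], M a = 0) :
    I.IsApproxAnswer 2 (output (mainCmd.run (inputSize I.encode) M)) := by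
  have hmn := two_mul_add_le_inputSize I
  obtain ⟨⟨N, hN, holds₁, represents⟩, hm₁, hptr₁⟩ := hI.run_networkCmd hmn hsize
    (hzero _ (by decide)) (hzero _ (by decide))
  set S := inputSize I.encode
  have frame₁ : ∀ b ∉ networkCmd.writes, networkCmd.run S M b = M b :=
    fun b hb => run_frame _ _ hb _
  have run_eq : mainCmd.run S M =
    (roundedCmd ;; outputCmd).run S (weightCmd.run S (networkCmd.run S M)) := rfl
  set M₁ := networkCmd.run S M
  have hW : ScaledWeights I S (weightCmd.run S M₁ aWeight) := by
    refine hI.scaledWeights (run_weightCmd (frame₁ aIn (by decide)) hptr₁ hm₁ holds₁.vars (by omega)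
      (fun j hj i hi => ?_) ((frame₁ _ (by decide)).trans (hzero _ (by decide))))
    exact ⟨hI.factor_nonneg ⟨j, hj⟩ ⟨i, hi⟩, hI.factor_lt_inputSize ⟨j, hj⟩ ⟨i, hi⟩⟩
  have frame₂ : ∀ b ∉ weightCmd.writes, weightCmd.run S M₁ b = M₁ b :=
    fun b hb => run_frame _ _ hb _
  have zero₂ (a : ℕ) (ha : a ∈ [aFlow, aPot]) : weightCmd.run S M₁ a = 0 :=
    (frame₂ a (by revert a; decide)).trans <| (frame₁ a (by revert a; decide)).trans <|
      hzero a (by revert a; decide)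
  rw [run_eq, ← hN]
  rw [← hN] at hW zero₂
  exact (holds₁.run (by decide) _).isApproxAnswer_run represents (zero₂ aFlow (by decide))
    (zero₂ aPot (by decide)) hW

end UTVPI

theorem mainTheorem3 :
    ∃ (p : RAM.Program) (q : Polynomial ℕ), ∀ I : UTVPIProblem, ∃ out : List ℤ,
      p.OutputsWithin I.encode out (q.eval (RAM.inputSize I.encode)) ∧
        I.IsApproxAnswer 2 out := by
  obtain ⟨G, Q, hsize⟩ := RAM.exec_sizeProgram
  obtain ⟨G', Q', hmain⟩ := UTVPI.wf_mainCmd.exists_polyBounded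
  refine ⟨.seq RAM.sizeProgram UTVPI.mainCmd.toProgram, Q + Q' * (G + 1), fun I => ?_⟩
  obtain ⟨M, ⟨t, ht, hexec⟩, hbits, hS, hM⟩ := hsize I.encode
  obtain ⟨-, t', ht', hexec'⟩ := hmain hS hbits
  refine ⟨_, ⟨t + t', _, hexec.seq hexec', ?_, rfl⟩,
    UTVPI.isApproxAnswer_run_mainCmd ?_ hS fun a ha => ?_⟩
  · simpa using add_le_add ht ht'
  · exact hM 0 (by decide) ▸ UTVPI.encodes_encode I
  · rw [hM a (by revert a; decide)]
    have : a ≠ 0 ∧ a ≠ 1 := by revert a; decide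
    simp [RAM.initMem, this, funext_iff]
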